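/- Let $t_a=\sigma_a/2$ ($a=1,2,3$) with the Pauli matrices $\sigma_a$, and identify $S^3$ with $SU_2$. For $s\in\frac12\mathbb N_0$ let $\rho^s$ be the irreducible representation of $su_2$ on $\mathbb C^{2s+1}$, with Hermitian matrices $\rho^s(t_a)$, $[\rho^s(t_a),\rho^s(t_b)]=i\epsilon_{abc}\rho^s(t_c)$, and let $W_s$ be the space of smooth functions $\phi:SU_2\to\mathbb C^{2s+1}$. (Repeated indices are summed.) Define $$(\xi^L_a\phi)(g)=\tfrac{d}{dr}\Big|_{r=0}\phi(e^{irt_a}g),\qquad (\xi^R_a\phi)(g)=\tfrac{d}{dr}\Big|_{r=0}\phi(ge^{-irt_a}),$$ $$J^L_a=i\xi^L_a+\rho^s(t_a),\qquad J^R_a=i\xi^R_a,\qquad (\xi^R)^2=\sum_a\xi^R_a\xi^R_a .$$ 1. On $W_s$ one has $[J^L_a,J^L_b]=i\epsilon_{abc}J^L_c$, $[J^R_a,J^R_b]=i\epsilon_{abc}J^R_c$, $[J^L_a,J^R_b]=0$ and $(J^L)^2=(J^R)^2+2i\,\xi^L_a\rho^s(t_a)+s(s+1)$. 2. For $s,k\in\frac12\mathbb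 N_0$ let $V_{k,s}\subset W_s$ be the space of all $\phi\in W_s$ satisfying both $$(i\xi^L_a\rho^s(t_a)-ks)\phi=0\qquad\text{and}\qquad((\xi^R)^2+k(k+1))\phi=0 .$$ Then $V_{k,s}$ is invariant under all $J^L_a,J^R_a$ and is an irreducible representation of $su_2\oplus su_2$, of dimension $(2(s+k)+1)(2k+1)$; it is isomorphic to the representation of spins $(s+k,k)$, i.e. to $\mathbb C^{2(s+k)+1}\otimes\mathbb C^{2k+1}$ with $J^L_a$ acting as $\rho^{s+k}(t_a)\otimes 1$ and $J^R_a$ as $1\otimes\rho^k(t_a)$. The representations $\rho^p$ integrate to homomorphisms $R^p$ of $SU_2$ with $R^p(e^{ix_at_a})=e^{ix_a\rho^p(t_a)}$; the group $SU_2\times SU_2$ acts irreducibly on $V_{k,s}$ by $((g,h)\cdot\phi)(x)=R^s(g)\,\phi(g^{-1}xh)$, and the isomorphism intertwines this action with $R^{s+k}\otimes R^k$. 3. If $s=\frac12$ or $s=1$ and $k\in\frac12\mathbb N_0$, every $\phi\in W_s$ with $(i\xi^L_a\rho^s(t_a)-ks)\phi=0$ also satisfies $((\xi^R)^2+k(k+1))\phi=0$.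 4. Let $s\in\frac12\mathbb N_0$, $m\in\mathbb R$, and let $\lambda_j>0$, $k_j\in\mathbb R$ be sequences with $\lambda_j\to0$ and $\lambda_jk_j=m$ for all $j$. Use the coordinates $x\mapsto e^{i\lambda_jx_at_a}$ from $\mathbb R^3$ to $SU_2$. Let $\phi_j\in W_s$ and let $f:\mathbb R^3\to\mathbb C^{2s+1}$ be differentiable, such that the functions $x\mapsto\phi_j(e^{i\lambda_jx_at_a})$ and their first derivatives converge pointwise to $f$ and its first derivatives. Then for all $x\in\mathbb R^3$ $$\lambda_j\big((i\xi^L_a\rho^s(t_a)-k_js)\phi_j\big)(e^{i\lambda_jx_bt_b})\;\longrightarrow\;\big((i\rho^s(t_a)\partial_a-ms)f\big)(x);$$ in particular, if $(i\xi^L_a\rho^s(t_a)-k_js)\phi_j=0$ for all $j$, then $(i\rho^s(t_a)\partial_a-ms)f=0$ on $\mathbb R^3$. -/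

import Mathlib

open scoped Matrix ContDiff Topology
open Filter

noncomputable section

namespace SU2Wave

/-! ### The group `SU₂ = S³` and its one-parameter subgroups -/

/-- The group `SU₂` of unitary `2 × 2` matrices of determinant `1`, which is the three-sphere. -/
abbrev SU2 : Type := Matrix.specialUnitaryGroup (Fin 2) ℂ

/-- Euclidean three-space. -/
abbrev E3 : Type := EuclideanSpace ℝ (Fin 3)

/-- The Hermitian generators `t_a = σ_a / 2` with the Pauli matrices `σ_a`;
the indices `1, 2, 3` are `0, 1, 2` here. -/
def tGen : Fin 3 → Matrix (Fin 2) (Fin 2) ℂ :=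
  ![(1 / 2 : ℂ) • !![0, 1; 1, 0],
    (1 / 2 : ℂ) • !![0, -Complex.I; Complex.I, 0],
    (1 / 2 : ℂ) • !![1, 0; 0, -1]]

/-- The totally antisymmetric symbol, with `ε 0 1 2 = 1`. -/
def eps (a b c : Fin 3) : ℂ :=
  Matrix.det (Matrix.of ![Pi.single a (1 : ℂ), Pi.single b 1, Pi.single c 1])

/-- The matrix `i x_a t_a` of the Lie algebra of `SU₂`. -/
def algMat (x : E3) : Matrix (Fin 2) (Fin 2) ℂ :=
  Complex.I • ∑ a, ((x a : ℝ) : ℂ) • tGen a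

lemma algMat_conjTranspose (x : E3) : (algMat x)ᴴ = -algMat x := by
  ext i j
  fin_cases i <;> fin_cases j <;>
    simp [algMat, tGen, Fin.sum_univ_three]

lemma algMat_adj (x : E3) :
    -algMat x = !![0, 1; -1, 0] * (algMat x)ᵀ * !![0, -1; 1, 0] := by
  ext i j
  fin_cases i <;> fin_cases j <;>
    simp [algMat, tGen, Fin.sum_univ_three, Matrix.mul_apply, Fin.sum_univ_two, Matrix.vecMul,
      dotProduct]

lemma exp_algMat_mem (x : E3) :
    NormedSpace.exp (algMat x) ∈ Matrix.specialUnitaryGroup (Fin 2) ℂ := by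
  set A := algMat x with hA
  have hinv : NormedSpace.exp A * NormedSpace.exp (-A) = 1 := by
    rw [← Matrix.exp_add_of_commute _ _ (Commute.neg_right (Commute.refl A))]
    simp
  have hstar : (NormedSpace.exp A)ᴴ = NormedSpace.exp (-A) := by
    rw [← Matrix.exp_conjTranspose, hA, algMat_conjTranspose]
  rw [Matrix.mem_specialUnitaryGroup_iff]
  refine ⟨?_, ?_⟩
  · rw [Matrix.mem_unitaryGroup_iff, Matrix.star_eq_conjTranspose, hstar, hinv]
  · let J : (Matrix (Fin 2) (Fin 2) ℂ)ˣ :=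
      ⟨!![0, 1; -1, 0], !![0, -1; 1, 0],
        by ext i j; fin_cases i <;> fin_cases j <;> simp [Matrix.mul_apply],
        by ext i j; fin_cases i <;> fin_cases j <;> simp [Matrix.mul_apply]⟩
    have h2 : NormedSpace.exp (-A)
        = !![0, 1; -1, 0] * (NormedSpace.exp A)ᵀ * !![0, -1; 1, 0] := by
      rw [hA, algMat_adj, ← Matrix.exp_transpose]
      exact Matrix.exp_units_conj J _
    rw [h2] at hinv
    have h3 := congrFun (congrFun hinv 0) 0
    rw [Matrix.det_fin_two]
    simp [Matrix.mul_apply, Fin.sum_univ_two, Matrix.vecMul, dotProduct] at h3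
    linear_combination h3

/-- The group element `e^{i x_a t_a}`. -/
def su2Exp (x : E3) : SU2 := ⟨NormedSpace.exp (algMat x), exp_algMat_mem x⟩

/-- The element `e^{i r t_a}` of the one-parameter subgroup generated by `t_a`. -/
def oneParam (a : Fin 3) (r : ℝ) : SU2 := su2Exp (r • EuclideanSpace.single a (1 : ℝ))

/-! ### Smooth fields on `S³` -/

/-- The matrix entries of a group element, i.e. the embedding of `SU₂` into `ℂ⁴ = ℝ⁸`. -/
def entries (g : SU2) : Fin 2 → Fin 2 → ℂ := fun i j => (g : Matrix (Fin 2) (Fin 2) ℂ) i j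

/-- A field on the compact embedded submanifold `SU₂` of the space of complex `2 × 2` matrices is
smooth if it is the restriction of a smooth function of the matrix entries. -/
def IsSmooth {N : ℕ} (φ : SU2 → Fin N → ℂ) : Prop :=
  ∃ F : (Fin 2 → Fin 2 → ℂ) → (Fin N → ℂ), ContDiff ℝ ∞ F ∧ ∀ g, φ g = F (entries g)

/-- The left-generated vector field: `(ξ^L_a φ)(g) = d/dr|_{r=0} φ(e^{i r t_a} g)`. -/
def leftField {N : ℕ} (a : Fin 3) (φ : SU2 → Fin N → ℂ) (g : SU2) : Fin N → ℂ :=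
  deriv (fun r : ℝ => φ (oneParam a r * g)) 0

/-- The right-generated vector field: `(ξ^R_a φ)(g) = d/dr|_{r=0} φ(g e^{-i r t_a})`. -/
def rightField {N : ℕ} (a : Fin 3) (φ : SU2 → Fin N → ℂ) (g : SU2) : Fin N → ℂ :=
  deriv (fun r : ℝ => φ (g * oneParam a (-r))) 0

lemma algMat_single (a : Fin 3) (r : ℝ) :
    algMat (r • EuclideanSpace.single a (1 : ℝ)) = r • (Complex.I • tGen a) := by
  ext i j
  fin_cases a <;>
    simp [algMat] <;> ring

section
open scoped Matrix.Norms.Operator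

lemma hasDerivAt_oneParam (a : Fin 3) :
    HasDerivAt (fun r : ℝ => (oneParam a r : Matrix (Fin 2) (Fin 2) ℂ))
      (Complex.I • tGen a) 0 := by
  have h := hasDerivAt_exp_smul_const (𝕂 := ℝ) (Complex.I • tGen a) (0 : ℝ)
  simp only [zero_smul, NormedSpace.exp_zero, one_mul] at h
  refine h.congr_of_eventuallyEq (Eventually.of_forall fun r => ?_)
  simp only [oneParam, su2Exp, algMat_single]
  rfl

lemma hasDerivAt_left (a : Fin 3) (g : SU2) :
    HasDerivAt (fun r : ℝ => entries (oneParam a r * g))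
      (fun i j => ∑ l, (Complex.I • tGen a) i l * entries g l j) 0 := by
  have h := (hasDerivAt_oneParam a).mul_const (g : Matrix (Fin 2) (Fin 2) ℂ)
  rw [hasDerivAt_pi]
  intro i
  rw [hasDerivAt_pi]
  intro j
  have hL := ((Matrix.entryLinearMap ℝ ℂ i j).toContinuousLinearMap).hasFDerivAt.comp_hasDerivAt
    (0 : ℝ) h
  exact hL

lemma hasDerivAt_right (a : Fin 3) (g : SU2) :
    HasDerivAt (fun r : ℝ => entries (g * oneParam a (-r)))
      (fun i j => -∑ l, entries g i l * (Complex.I • tGen a) l j) 0 := by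
  have h0 : HasDerivAt (fun r : ℝ => (oneParam a (-r) : Matrix (Fin 2) (Fin 2) ℂ))
      (-(Complex.I • tGen a)) 0 := by
    have h1 : HasDerivAt (fun r : ℝ => -r) (-1) 0 := hasDerivAt_neg (0 : ℝ)
    have h2 := hasDerivAt_oneParam a
    rw [show (0 : ℝ) = -0 by simp] at h2
    have h3 := h2.scomp (0 : ℝ) h1
    rw [neg_one_smul] at h3
    exact h3
  have h := h0.const_mul (g : Matrix (Fin 2) (Fin 2) ℂ)
  rw [mul_neg] at h
  rw [hasDerivAt_pi]
  intro i
  rw [hasDerivAt_pi]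
  intro j
  have hL := ((Matrix.entryLinearMap ℝ ℂ i j).toContinuousLinearMap).hasFDerivAt.comp_hasDerivAt
    (0 : ℝ) h
  exact hL

end

section
variable {N : ℕ} {φ ψ : SU2 → Fin N → ℂ}

lemma oneParam_zero (a : Fin 3) : oneParam a 0 = 1 := by
  ext1
  simp [oneParam, su2Exp, algMat]

lemma hasDerivAt_leftField (hφ : IsSmooth φ) (a : Fin 3) (g : SU2) :
    HasDerivAt (fun r : ℝ => φ (oneParam a r * g)) (leftField a φ g) 0 := by
  obtain ⟨F, hF, h⟩ := hφ
  have hd : DifferentiableAt ℝ F (entries (oneParam a 0 * g)) :=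
    (hF.differentiable (by simp)).differentiableAt
  have := hd.hasFDerivAt.comp_hasDerivAt (0 : ℝ) (hasDerivAt_left a g)
  simp only [Function.comp_def, ← h] at this
  exact this.differentiableAt.hasDerivAt

lemma hasDerivAt_rightField (hφ : IsSmooth φ) (a : Fin 3) (g : SU2) :
    HasDerivAt (fun r : ℝ => φ (g * oneParam a (-r))) (rightField a φ g) 0 := by
  obtain ⟨F, hF, h⟩ := hφ
  have hd : DifferentiableAt ℝ F (entries (g * oneParam a (-0))) :=
    (hF.differentiable (by simp)).differentiableAt
  have := hd.hasFDerivAt.comp_hasDerivAt (0 : ℝ) (hasDerivAt_right a g)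
  simp only [Function.comp_def, ← h] at this
  exact this.differentiableAt.hasDerivAt

lemma IsSmooth.leftField (hφ : IsSmooth φ) (a : Fin 3) : IsSmooth (leftField a φ) := by
  obtain ⟨F, hF, h⟩ := hφ
  refine ⟨fun M => fderiv ℝ F M (fun i j => ∑ l, (Complex.I • tGen a) i l * M l j), ?_, ?_⟩
  · refine (hF.fderiv_right (m := ∞) (by simp)).clm_apply ?_
    fun_prop
  · intro g
    have hd : DifferentiableAt ℝ F (entries (oneParam a 0 * g)) :=
      (hF.differentiable (by simp)).differentiableAt
    have := hd.hasFDerivAt.comp_hasDerivAt (0 : ℝ) (hasDerivAt_left a g)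
    simp only [Function.comp_def, ← h, oneParam_zero, one_mul] at this
    exact this.deriv

lemma IsSmooth.rightField (hφ : IsSmooth φ) (a : Fin 3) : IsSmooth (rightField a φ) := by
  obtain ⟨F, hF, h⟩ := hφ
  refine ⟨fun M => fderiv ℝ F M (fun i j => -∑ l, M i l * (Complex.I • tGen a) l j), ?_, ?_⟩
  · refine (hF.fderiv_right (m := ∞) (by simp)).clm_apply ?_
    fun_prop
  · intro g
    have hd : DifferentiableAt ℝ F (entries (g * oneParam a (-0))) :=
      (hF.differentiable (by simp)).differentiableAt
    have := hd.hasFDerivAt.comp_hasDerivAt (0 : ℝ) (hasDerivAt_right a g)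
    simp only [Function.comp_def, ← h, neg_zero, oneParam_zero, mul_one] at this
    exact this.deriv

lemma IsSmooth.add (hφ : IsSmooth φ) (hψ : IsSmooth ψ) : IsSmooth (φ + ψ) := by
  obtain ⟨F, hF, h⟩ := hφ
  obtain ⟨G, hG, h'⟩ := hψ
  exact ⟨fun M => F M + G M, hF.add hG, fun g => by simp [h, h']⟩

lemma IsSmooth.smul (c : ℂ) (hφ : IsSmooth φ) : IsSmooth (c • φ) := by
  obtain ⟨F, hF, h⟩ := hφ
  exact ⟨fun M => c • F M, hF.const_smul c, fun g => by simp [h]⟩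

lemma IsSmooth.mulVec (A : Matrix (Fin N) (Fin N) ℂ) (hφ : IsSmooth φ) :
    IsSmooth (fun g => A *ᵥ φ g) := by
  obtain ⟨F, hF, h⟩ := hφ
  refine ⟨fun M => A *ᵥ F M, ?_, fun g => by simp [h]⟩
  unfold Matrix.mulVec dotProduct
  fun_prop

end

/-- The space `W_s`, `s = n / 2`, of all smooth functions `S³ → ℂ^{2s+1}`. -/
def Fields (n : ℕ) : Submodule ℂ (SU2 → Fin (n + 1) → ℂ) where
  carrier := {φ | IsSmooth φ}
  add_mem' := fun h h' => h.add h'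
  zero_mem' := ⟨fun _ => 0, contDiff_const, fun _ => rfl⟩
  smul_mem' := fun c _ h => h.smul c

/-! ### The spin `s` representation -/

/-- Matrix of the raising operator `ρ^s(t_1 + i t_2)`, `s = n / 2`, in the orthonormal basis of
`t_3`-eigenvectors `|s, s - q⟩`, `q = 0, …, n`:
`|s, s - q⟩ ↦ √(q (n + 1 - q)) |s, s - q + 1⟩`. -/
def raising (n : ℕ) : Matrix (Fin (n + 1)) (Fin (n + 1)) ℂ :=
  Matrix.of fun p q =>
    if (p : ℕ) + 1 = (q : ℕ) then ((Real.sqrt ((q : ℝ) * ((n : ℝ) + 1 - (q : ℝ))) : ℝ) : ℂ) else 0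

/-- The matrices `ρ^s(t_a)`, `s = n / 2`, of the irreducible representation of dimension
`2 s + 1 = n + 1`, in the orthonormal basis of `t_3`-eigenvectors `|s, s - q⟩`, `q = 0, …, n`. -/
def spinMat (n : ℕ) : Fin 3 → Matrix (Fin (n + 1)) (Fin (n + 1)) ℂ :=
  ![(1 / 2 : ℂ) • (raising n + (raising n)ᴴ),
    (1 / (2 * Complex.I) : ℂ) • (raising n - (raising n)ᴴ),
    Matrix.diagonal fun q => (n : ℂ) / 2 - (q : ℂ)]

/-! ### Operators on the fields -/

/-- `ξ^L_a` as a linear operator on `W_s`. -/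
def xiL (n : ℕ) (a : Fin 3) : Module.End ℂ (Fields n) where
  toFun φ := ⟨leftField a φ.1, φ.2.leftField a⟩
  map_add' φ ψ := Subtype.ext <| funext fun g =>
    ((hasDerivAt_leftField φ.2 a g).add (hasDerivAt_leftField ψ.2 a g)).deriv
  map_smul' c φ := Subtype.ext <| funext fun g =>
    ((hasDerivAt_leftField φ.2 a g).const_smul c).deriv

/-- `ξ^R_a` as a linear operator on `W_s`. -/
def xiR (n : ℕ) (a : Fin 3) : Module.End ℂ (Fields n) where
  toFun φ := ⟨rightField a φ.1, φ.2.rightField a⟩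
  map_add' φ ψ := Subtype.ext <| funext fun g =>
    ((hasDerivAt_rightField φ.2 a g).add (hasDerivAt_rightField ψ.2 a g)).deriv
  map_smul' c φ := Subtype.ext <| funext fun g =>
    ((hasDerivAt_rightField φ.2 a g).const_smul c).deriv

/-- Pointwise multiplication by the matrix `ρ^s(t_a)` as a linear operator on `W_s`. -/
def rho (n : ℕ) (a : Fin 3) : Module.End ℂ (Fields n) where
  toFun φ := ⟨fun g => spinMat n a *ᵥ φ.1 g, IsSmooth.mulVec _ φ.2⟩
  map_add' φ ψ := Subtype.ext <| funext fun g => Matrix.mulVec_add _ (φ.1 g) (ψ.1 g)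
  map_smul' c φ := Subtype.ext <| funext fun g => Matrix.mulVec_smul _ c (φ.1 g)

/-- `J^L_a = i ξ^L_a + ρ^s(t_a)`. -/
def JL (n : ℕ) (a : Fin 3) : Module.End ℂ (Fields n) := Complex.I • xiL n a + rho n a

/-- `J^R_a = i ξ^R_a`. -/
def JR (n : ℕ) (a : Fin 3) : Module.End ℂ (Fields n) := Complex.I • xiR n a

/-- The first-order operator `i ξ^L_a ρ^s(t_a) - k s` on `W_s`, `s = n / 2`. -/
def constraintOp (n : ℕ) (k : ℝ) : Module.End ℂ (Fields n) :=
  Complex.I • ∑ a, xiL n a * rho n a - ((k * ((n : ℝ) / 2) : ℝ) : ℂ) • 1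

/-- The second-order operator `(ξ^R)² + k (k + 1)` on `W_s`, `s = n / 2`. -/
def laplaceOp (n : ℕ) (k : ℝ) : Module.End ℂ (Fields n) :=
  ∑ a, xiR n a * xiR n a + ((k * (k + 1) : ℝ) : ℂ) • 1

/-- The fields of spin `s = n / 2` that satisfy both the first-order constraint and the
Laplace–Beltrami equation with parameter `k = m / 2`. -/
def solutions (n m : ℕ) : Submodule ℂ (Fields n) :=
  LinearMap.ker (constraintOp n ((m : ℝ) / 2)) ⊓ LinearMap.ker (laplaceOp n ((m : ℝ) / 2))

/-- A subspace of `W_s` is invariant under all the operators `J^L_a` and `J^R_a`. -/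
def IsInvariant (n : ℕ) (U : Submodule ℂ (Fields n)) : Prop :=
  ∀ a, (∀ φ ∈ U, JL n a φ ∈ U) ∧ (∀ φ ∈ U, JR n a φ ∈ U)

/-- A subspace of `W_s` is an irreducible representation of `su₂ ⊕ su₂`
under the operators `J^L_a` and `J^R_a`. -/
def IsIrrep (n : ℕ) (V : Submodule ℂ (Fields n)) : Prop :=
  IsInvariant n V ∧ V ≠ ⊥ ∧ ∀ U ≤ V, IsInvariant n U → U = ⊥ ∨ U = V

/-- The carrier space `V_l ⊗ V_k` with `l = p / 2` and `k = m / 2`. -/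
abbrev SpinTensor (p m : ℕ) : Type :=
  TensorProduct ℂ (Fin (p + 1) → ℂ) (Fin (m + 1) → ℂ)

/-! ### The flat equation -/

/-- The flat Dirac-type operator `i ρ^s(t_a) ∂_a - μ s`, `s = n / 2`, of mass `μ` on functions
`ℝ³ → ℂ^{2s+1}`. -/
def flatOp (n : ℕ) (μ : ℝ) (f : E3 → Fin (n + 1) → ℂ) (x : E3) : Fin (n + 1) → ℂ :=
  Complex.I • ∑ a, spinMat n a *ᵥ (fderiv ℝ f x (EuclideanSpace.single a (1 : ℝ)))
    - ((μ * ((n : ℝ) / 2) : ℝ) : ℂ) • f x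

/-- The field on `ℝ³` obtained from a field on `S³` of radius proportional to `1 / r` through
the coordinates `x ↦ e^{i r x_a t_a}`. -/
def pullback {n : ℕ} (r : ℝ) (φ : Fields n) (x : E3) : Fin (n + 1) → ℂ := φ.1 (su2Exp (r • x))

end SU2Wave

end

/-! The commutators and the Casimir identity are computed on a smooth extension of a field to all 2
× 2 matrices. In a commutator of two invariant fields the second derivatives cancel by symmetry, and
the commutator of the generators remains. At every point the left generators are an orthogonal
combination of the right ones (`exists_rotation`), so ξ^L and ξ^R have the same sum of squares;
expanding (iξ^L + ρ)² gives `casimir_eq`.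

The solutions are written down explicitly. The antisymmetric form of SU₂ contracts spins s + k and k
to spin s (`contr`), and `emb` sends u ⊗ v to the field x ↦ contr(u, R^k(x) v). Since `contr` is
equivariant, `emb` intertwines the Lie algebra and the group actions. The Casimirs take the values
(s+k)(s+k+1) and k(k+1) on its image, and the constraint is the identity (s+k)(s+k+1) - k(k+1) -
s(s+1) = 2ks. The tensor product is irreducible, so `emb`, being nonzero, is injective.

That there are no other solutions follows from a dimension count. By a Peter–Weyl argument (Haar
integral, Stone–Weierstrass, integration by parts) every eigenfield of the Laplacian has the form
Σ_b T_b R^k(x) e_b (`eigenfield_eq_coeffMap`). The constraint then says Σ_a ρ^s(t_a) T_b ρ^k(t_a) =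
-ks T_b for each of the 2k + 1 matrices T_b, and such a matrix is determined by its first row and
column (`twistSpace_eq_zero`), which leaves at most 2(s+k) + 1 dimensions for each b.

For s = 1/2 the constraint says that a 2 × 2 matrix D of operators acts as k, where D² + D is the
Casimir. For s = 1 the system splits into two overlapping systems of the first kind as soon as k + 1
is invertible.

For the flat limit, in exponential coordinates ξ^L_a differentiates along a vector field that tends
to e_a at the origin, and the rescaled points tend to the origin. -/

noncomputable section

namespace SU2Wave

/-! ### Commutation relations of the matrices -/

lemma tGen_commutator (a b : Fin 3) :
    tGen a * tGen b - tGen b * tGen a = Complex.I • ∑ c, eps a b c • tGen c := by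
  fin_cases a <;> fin_cases b <;> ext i j <;> fin_cases i <;> fin_cases j <;>
    simp [tGen, eps, Matrix.det_fin_three, Fin.sum_univ_three] <;>
    ring_nf <;> simp <;> ring_nf

lemma sum_tGen_mul_self : ∑ a, tGen a * tGen a = (3 / 4 : ℂ) • 1 := by
  ext i j
  fin_cases i <;> fin_cases j <;>
    simp [tGen, Fin.sum_univ_three] <;> ring_nf <;> simp <;> ring_nf

lemma raising_apply (n : ℕ) (p q : Fin (n + 1)) : raising n p q =
    if (p : ℕ) + 1 = (q : ℕ) then ((Real.sqrt ((q : ℝ) * ((n : ℝ) + 1 - (q : ℝ))) : ℝ) : ℂ)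
    else 0 := rfl

lemma raising_conjTranspose (n : ℕ) : (raising n)ᴴ = (raising n)ᵀ := by
  ext p q
  simp only [Matrix.conjTranspose_apply, Matrix.transpose_apply, raising_apply]
  split_ifs <;> simp

lemma raising_sq {n : ℕ} {p q : Fin (n + 1)} (h : (p : ℕ) + 1 = q) :
    raising n p q * raising n p q = ((q : ℂ) * ((n : ℂ) + 1 - (q : ℂ))) := by
  rw [raising_apply, if_pos h, ← Complex.ofReal_mul, Real.mul_self_sqrt]
  · push_cast; ring
  · have : (q : ℝ) ≤ n := by exact_mod_cast Nat.lt_succ_iff.mp q.2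
    exact mul_nonneg (by positivity) (by linarith)

lemma raising_ne_zero {n : ℕ} {p q : Fin (n + 1)} (h : (p : ℕ) + 1 = q) : raising n p q ≠ 0 := by
  intro h0
  have h1 := raising_sq h
  rw [h0, zero_mul] at h1
  have hq : (q : ℝ) ≤ n := by exact_mod_cast Nat.lt_succ_iff.mp q.2
  have hq' : (0 : ℝ) < q := by exact_mod_cast (by omega : 0 < (q : ℕ))
  have : (q : ℝ) * ((n : ℝ) + 1 - q) = 0 := by exact_mod_cast h1.symm
  nlinarith

lemma raising_of_ne {n : ℕ} {p q : Fin (n + 1)} (h : (p : ℕ) + 1 ≠ q) : raising n p q = 0 := by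
  rw [raising_apply, if_neg h]

lemma raising_mul_conjTranspose (n : ℕ) : raising n * (raising n)ᴴ =
    Matrix.diagonal fun q : Fin (n + 1) => ((q : ℂ) + 1) * ((n : ℂ) - q) := by
  ext p r
  rw [raising_conjTranspose, Matrix.mul_apply, Matrix.diagonal_apply]
  simp only [Matrix.transpose_apply]
  by_cases hp : (p : ℕ) < n
  · rw [Finset.sum_eq_single (⟨p + 1, by omega⟩ : Fin (n + 1))]
    · split_ifs with h
      · subst h
        rw [raising_sq rfl]
        push_cast; ring
      · rw [raising_of_ne (p := r), mul_zero]
        intro h'; apply h; ext; simpa using h'.symm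
    · intro q _ hq
      rw [raising_of_ne (p := p), zero_mul]
      intro h'; apply hq; ext; exact h'.symm
    · simp
  -- The last row of `raising n` is zero, and the factor `n - q` vanishes there as well.
  · have hpn : (p : ℕ) = n := by omega
    rw [Finset.sum_eq_zero]
    · simp [hpn]
    · intro q _
      rw [raising_of_ne (p := p), zero_mul]
      omega

lemma conjTranspose_mul_raising (n : ℕ) : (raising n)ᴴ * raising n =
    Matrix.diagonal fun q : Fin (n + 1) => (q : ℂ) * ((n : ℂ) + 1 - q) := by
  ext p r
  rw [raising_conjTranspose, Matrix.mul_apply, Matrix.diagonal_apply]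
  simp only [Matrix.transpose_apply]
  by_cases hp : 0 < (p : ℕ)
  · rw [Finset.sum_eq_single (⟨p - 1, by omega⟩ : Fin (n + 1))]
    · split_ifs with h
      · subst h
        rw [raising_sq (by simp; omega)]
      · rw [raising_of_ne (q := r), mul_zero]
        intro h'; apply h; ext; simp at h'; omega
    · intro q _ hq
      rw [raising_of_ne (q := p), zero_mul]
      intro h'; apply hq; ext; simp; omega
    · simp
  · have hpn : (p : ℕ) = 0 := by omega
    rw [Finset.sum_eq_zero]
    · simp [hpn]
    · intro q _
      rw [raising_of_ne (q := p), zero_mul]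
      omega

lemma weight_mul_raising (n : ℕ) :
    spinMat n 2 * raising n = raising n * spinMat n 2 + raising n := by
  ext p q
  simp only [spinMat, Matrix.cons_val, Matrix.add_apply, Matrix.diagonal_mul, Matrix.mul_diagonal]
  by_cases h : (p : ℕ) + 1 = q
  · rw [← h]; push_cast; ring
  · rw [raising_of_ne h]; ring

lemma weight_mul_lowering (n : ℕ) :
    spinMat n 2 * (raising n)ᴴ = (raising n)ᴴ * spinMat n 2 - (raising n)ᴴ := by
  rw [raising_conjTranspose]
  ext p q
  simp only [spinMat, Matrix.cons_val, Matrix.sub_apply, Matrix.diagonal_mul, Matrix.mul_diagonal,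
    Matrix.transpose_apply]
  by_cases h : (q : ℕ) + 1 = p
  · rw [← h]; push_cast; ring
  · rw [raising_of_ne h]; ring

lemma raising_lowering (n : ℕ) :
    raising n * (raising n)ᴴ = (raising n)ᴴ * raising n + (2 : ℂ) • spinMat n 2 := by
  rw [raising_mul_conjTranspose, conjTranspose_mul_raising]
  simp only [spinMat, Matrix.cons_val]
  rw [← Matrix.diagonal_smul, Matrix.diagonal_add]
  congr 1
  ext q
  simp
  ring

lemma spinMat_zero (n : ℕ) : spinMat n 0 = (1 / 2 : ℂ) • (raising n + (raising n)ᴴ) := rfl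

lemma spinMat_one (n : ℕ) :
    spinMat n 1 = (-Complex.I / 2 : ℂ) • (raising n - (raising n)ᴴ) := by
  have : (-Complex.I / 2 : ℂ) = 1 / (2 * Complex.I) := by
    field_simp
    simp
  rw [this]; rfl

lemma spinMat_commutator (n : ℕ) (a b : Fin 3) :
    spinMat n a * spinMat n b - spinMat n b * spinMat n a
      = Complex.I • ∑ c, eps a b c • spinMat n c := by
  have h1 := weight_mul_raising n
  have h2 := weight_mul_lowering n
  have h3 := raising_lowering n
  fin_cases a <;> fin_cases b <;>
    simp only [Fin.zero_eta, Fin.mk_one, Fin.reduceFinMk, eps, Matrix.det_fin_three,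
      Fin.sum_univ_three, spinMat_zero, spinMat_one, Matrix.of_apply, Matrix.cons_val,
      smul_mul_assoc, mul_smul_comm, add_mul, mul_add, sub_mul, mul_sub, h1, h2, h3] <;>
    simp <;>
    match_scalars <;> ring_nf <;> (try rw [Complex.I_sq]) <;> (try ring)

/-- Ladder form of the sum. With `T = 1` it yields the Casimir; with rectangular `T` it turns the
constraint on coefficient matrices into a recursion between entries. -/
lemma sum_spinMat_mul_eq {n m : ℕ} (T : Matrix (Fin (n + 1)) (Fin (m + 1)) ℂ) :
    ∑ a, spinMat n a * T * spinMat m a = spinMat n 2 * T * spinMat m 2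
      + (1 / 2 : ℂ) • (raising n * T * (raising m)ᴴ + (raising n)ᴴ * T * raising m) := by
  simp only [Fin.sum_univ_three, spinMat_zero, spinMat_one,
    Matrix.add_mul, Matrix.mul_add, Matrix.sub_mul, Matrix.mul_sub, Matrix.smul_mul,
    Matrix.mul_smul]
  match_scalars <;> ring_nf <;> (try rw [Complex.I_sq]) <;> (try ring)

lemma sum_spinMat_mul_self (n : ℕ) :
    ∑ a, spinMat n a * spinMat n a = (((n : ℂ) / 2) * ((n : ℂ) / 2 + 1)) • 1 := by
  have h := sum_spinMat_mul_eq (1 : Matrix (Fin (n + 1)) (Fin (n + 1)) ℂ)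
  simp only [mul_one] at h
  rw [h, raising_mul_conjTranspose, conjTranspose_mul_raising]
  simp only [spinMat, Matrix.cons_val]
  rw [Matrix.diagonal_mul_diagonal, Matrix.diagonal_add, ← Matrix.diagonal_smul,
    Matrix.diagonal_add, ← Matrix.diagonal_one, ← Matrix.diagonal_smul]
  congr 1
  ext q
  simp
  ring

/-! ### Irreducibility of the spin matrices -/

lemma raising_mem_adjoin (n : ℕ) :
    raising n ∈ Algebra.adjoin ℂ (Set.range (spinMat n)) ∧
    (raising n)ᴴ ∈ Algebra.adjoin ℂ (Set.range (spinMat n)) := by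
  have h (a) : spinMat n a ∈ Algebra.adjoin ℂ (Set.range (spinMat n)) :=
    Algebra.subset_adjoin ⟨a, rfl⟩
  constructor
  · have : raising n = spinMat n 0 + Complex.I • spinMat n 1 := by
      rw [spinMat_zero, spinMat_one]
      match_scalars <;> ring_nf <;> (try rw [Complex.I_sq]) <;> (try ring)
    rw [this]
    exact add_mem (h 0) (Subalgebra.smul_mem _ (h 1) _)
  · have : (raising n)ᴴ = spinMat n 0 - Complex.I • spinMat n 1 := by
      rw [spinMat_zero, spinMat_one]
      match_scalars <;> ring_nf <;> (try rw [Complex.I_sq]) <;> (try ring)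
    rw [this]
    exact sub_mem (h 0) (Subalgebra.smul_mem _ (h 1) _)

/-- Lagrange interpolation: `spinMat n 2` is diagonal with distinct entries, so the projection onto
an eigenvector is a polynomial in it. -/
lemma single_zero_mem_adjoin (n : ℕ) :
    Matrix.single 0 0 (1 : ℂ) ∈ Algebra.adjoin ℂ (Set.range (spinMat n)) := by
  set S := Algebra.adjoin ℂ (Set.range (spinMat n))
  set d : Fin (n + 1) → ℂ := fun q => (n : ℂ) / 2 - (q : ℂ) with hd
  have hmem (c : ℂ) : Matrix.diagonal (fun i => d i - c) ∈ S := by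
    have h2 : spinMat n 2 - c • 1 = Matrix.diagonal (fun i => d i - c) := by
      ext i j
      by_cases hij : i = j <;> simp [spinMat, hij, hd]
    rw [← h2]
    exact sub_mem (Algebra.subset_adjoin ⟨2, rfl⟩) (S.smul_mem S.one_mem _)
  have hprod (s : Finset (Fin (n + 1))) : Matrix.diagonal (fun i => ∏ q ∈ s, (d i - d q)) ∈ S := by
    induction s using Finset.induction_on with
    | empty => simp [S.one_mem]
    | insert q s hq ih =>
      simp only [Finset.prod_insert hq]
      rw [← Matrix.diagonal_mul_diagonal]
      exact S.mul_mem (hmem _) ih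
  have hne : ∏ q ∈ Finset.univ.erase (0 : Fin (n + 1)), (d 0 - d q) ≠ 0 := by
    rw [Finset.prod_ne_zero_iff]
    intro q hq h0
    apply Finset.ne_of_mem_erase hq
    ext
    simpa [hd] using h0
  have h4 : Matrix.single 0 0 (1 : ℂ) = (∏ q ∈ Finset.univ.erase (0 : Fin (n + 1)), (d 0 - d q))⁻¹ •
      Matrix.diagonal (fun i => ∏ q ∈ Finset.univ.erase (0 : Fin (n + 1)), (d i - d q)) := by
    rw [← Matrix.diagonal_smul, ← Matrix.diagonal_single]
    congr 1
    ext i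
    by_cases hi : i = 0
    · subst hi; simp [inv_mul_cancel₀ hne]
    · have h5 : ∏ q ∈ Finset.univ.erase (0 : Fin (n + 1)), (d i - d q) = 0 :=
        Finset.prod_eq_zero (i := i) (by simp [hi]) (sub_self _)
      rw [Pi.single_eq_of_ne hi, Pi.smul_apply, h5, smul_zero]
  rw [h4]
  exact S.smul_mem (hprod _) _

/-- Irreducibility in the form of Burnside: starting from one matrix unit, lowering on the left
reaches every row and raising on the right every column, because the ladder coefficients do not
vanish. -/
lemma adjoin_spinMat (n : ℕ) : Algebra.adjoin ℂ (Set.range (spinMat n)) = ⊤ := by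
  set S := Algebra.adjoin ℂ (Set.range (spinMat n)) with hS
  have hrow : ∀ i (hi : i < n + 1), Matrix.single (⟨i, hi⟩ : Fin (n + 1)) 0 (1 : ℂ) ∈ S := by
    intro i
    induction i with
    | zero => exact fun _ => single_zero_mem_adjoin n
    | succ i ih =>
      intro hi
      have h1 := S.mul_mem (raising_mem_adjoin n).2 (ih (by omega))
      set a : Fin (n + 1) := ⟨i, by omega⟩
      set b : Fin (n + 1) := ⟨i + 1, hi⟩
      have hne := raising_ne_zero (n := n) (p := a) (q := b) rfl
      have : Matrix.single b 0 (1 : ℂ)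
          = (raising n a b)⁻¹ • ((raising n)ᴴ * Matrix.single a 0 1) := by
        rw [raising_conjTranspose]
        ext p q
        by_cases hq : q = 0
        · subst hq
          by_cases hp : b = p
          · subst hp; simp [hne]
          · have : raising n a p = 0 := raising_of_ne (fun h => hp (by ext; exact h))
            simp [hp, this]
        · simp [Ne.symm hq, hq]
      rw [this]
      exact S.smul_mem h1 _
  have hall : ∀ j (hj : j < n + 1) (i : Fin (n + 1)),
      Matrix.single i (⟨j, hj⟩ : Fin (n + 1)) (1 : ℂ) ∈ S := by
    intro j
    induction j with
    | zero => exact fun _ i => hrow i i.2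
    | succ j ih =>
      intro hj i
      have h1 := S.mul_mem (ih (by omega) i) (raising_mem_adjoin n).1
      set a : Fin (n + 1) := ⟨j, by omega⟩
      set b : Fin (n + 1) := ⟨j + 1, hj⟩
      have hne := raising_ne_zero (n := n) (p := a) (q := b) rfl
      have : Matrix.single i b (1 : ℂ)
          = (raising n a b)⁻¹ • (Matrix.single i a 1 * raising n) := by
        ext p q
        by_cases hq : i = p
        · subst hq
          by_cases hp : b = q
          · subst hp; simp [hne]
          · have : raising n a q = 0 := raising_of_ne (fun h => hp (by ext; exact h))
            simp [hp, this]
        · simp [Ne.symm hq, hq]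
      rw [this]
      exact S.smul_mem h1 _
  rw [eq_top_iff]
  intro A _
  rw [Matrix.matrix_eq_sum_single A]
  refine sum_mem fun i _ => sum_mem fun j _ => ?_
  have : Matrix.single i j (A i j) = A i j • Matrix.single i j 1 := by simp
  rw [this]
  exact S.smul_mem (hall j j.2 i) _

open TensorProduct in
/-- The external tensor product of two spin representations is irreducible. -/
lemma spinTensor_irreducible {p m : ℕ} (U : Submodule ℂ (SpinTensor p m))
    (hl : ∀ a, ∀ v ∈ U, TensorProduct.map (Matrix.toLin' (spinMat p a)) LinearMap.id v ∈ U)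
    (hr : ∀ a, ∀ v ∈ U, TensorProduct.map LinearMap.id (Matrix.toLin' (spinMat m a)) v ∈ U) :
    U = ⊥ ∨ U = ⊤ := by
  -- The matrices whose action on one factor preserves `U` form a subalgebra, hence are all
  -- matrices.
  have hl' (A : Matrix (Fin (p + 1)) (Fin (p + 1)) ℂ) :
      ∀ v ∈ U, TensorProduct.map (Matrix.toLin' A) LinearMap.id v ∈ U := by
    have hA : A ∈ Algebra.adjoin ℂ (Set.range (spinMat p)) := by simp [adjoin_spinMat]
    induction hA using Algebra.adjoin_induction with
    | mem x hx => obtain ⟨a, rfl⟩ := hx; exact hl a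
    | algebraMap r =>
      intro v hv
      have : TensorProduct.map (Matrix.toLin' (algebraMap ℂ (Matrix (Fin (p + 1)) (Fin (p + 1)) ℂ)
          r)) (LinearMap.id : (Fin (m + 1) → ℂ) →ₗ[ℂ] _) = r • LinearMap.id := by
        rw [Algebra.algebraMap_eq_smul_one, map_smul, Matrix.toLin'_one, TensorProduct.map_smul_left,
          TensorProduct.map_id]
      rw [this]
      exact U.smul_mem _ hv
    | add x y _ _ hx hy =>
      intro v hv
      rw [map_add, TensorProduct.map_add_left]
      exact U.add_mem (hx v hv) (hy v hv)
    | mul x y _ _ hx hy =>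
      intro v hv
      rw [Matrix.toLin'_mul, ← LinearMap.id_comp (LinearMap.id : (Fin (m + 1) → ℂ) →ₗ[ℂ] _),
        TensorProduct.map_comp]
      exact hx _ (hy v hv)
  have hr' (A : Matrix (Fin (m + 1)) (Fin (m + 1)) ℂ) :
      ∀ v ∈ U, TensorProduct.map LinearMap.id (Matrix.toLin' A) v ∈ U := by
    have hA : A ∈ Algebra.adjoin ℂ (Set.range (spinMat m)) := by simp [adjoin_spinMat]
    induction hA using Algebra.adjoin_induction with
    | mem x hx => obtain ⟨a, rfl⟩ := hx; exact hr a
    | algebraMap r =>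
      intro v hv
      have : TensorProduct.map (LinearMap.id : (Fin (p + 1) → ℂ) →ₗ[ℂ] _) (Matrix.toLin'
          (algebraMap ℂ (Matrix (Fin (m + 1)) (Fin (m + 1)) ℂ) r)) = r • LinearMap.id := by
        rw [Algebra.algebraMap_eq_smul_one, map_smul, Matrix.toLin'_one,
          TensorProduct.map_smul_right, TensorProduct.map_id]
      rw [this]
      exact U.smul_mem _ hv
    | add x y _ _ hx hy =>
      intro v hv
      rw [map_add, TensorProduct.map_add_right]
      exact U.add_mem (hx v hv) (hy v hv)
    | mul x y _ _ hx hy =>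
      intro v hv
      rw [Matrix.toLin'_mul, ← LinearMap.id_comp (LinearMap.id : (Fin (p + 1) → ℂ) →ₗ[ℂ] _),
        TensorProduct.map_comp]
      exact hx _ (hy v hv)
  let b := (Pi.basisFun ℂ (Fin (p + 1))).tensorProduct (Pi.basisFun ℂ (Fin (m + 1)))
  -- A pair of matrix units extracts one coordinate of `v` and places it at any chosen basis vector,
  -- so a single nonzero vector generates everything.
  have hcoord (i k : Fin (p + 1)) (j l : Fin (m + 1)) (v : SpinTensor p m) :
      TensorProduct.map (Matrix.toLin' (Matrix.single k i 1)) LinearMap.id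
        (TensorProduct.map LinearMap.id (Matrix.toLin' (Matrix.single l j 1)) v)
        = b.repr v (i, j) • b (k, l) := by
    induction v using TensorProduct.induction_on with
    | zero => simp
    | add x y hx hy => simp [hx, hy, add_smul]
    | tmul x y =>
      simp only [TensorProduct.map_tmul, LinearMap.id_coe, id_eq, Matrix.toLin'_apply,
        Matrix.single_mulVec, b, Module.Basis.tensorProduct_repr_tmul_apply, Pi.basisFun_repr,
        Module.Basis.tensorProduct_apply, Pi.basisFun_apply]
      have hs (N : ℕ) (q : Fin N) (c : ℂ) :
          Function.update (0 : Fin N → ℂ) q c = c • Pi.single q 1 := by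
        ext r
        by_cases h : r = q
        · subst h; simp
        · simp [h]
      rw [hs, hs, TensorProduct.smul_tmul_smul]
      simp [mul_comm]
  by_cases hU : U = ⊥
  · exact Or.inl hU
  right
  obtain ⟨v, hv, hv0⟩ := Submodule.exists_mem_ne_zero_of_ne_bot hU
  have : ∃ ij, b.repr v ij ≠ 0 := by
    by_contra! h
    exact hv0 (b.repr.map_eq_zero_iff.mp (Finsupp.ext h))
  obtain ⟨⟨i, j⟩, hij⟩ := this
  rw [eq_top_iff, ← b.span_eq, Submodule.span_le]
  rintro _ ⟨⟨k, l⟩, rfl⟩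
  have := hl' (Matrix.single k i 1) _ (hr' (Matrix.single l j 1) v hv)
  rw [hcoord] at this
  exact (U.smul_mem_iff hij).mp this

/-! ### The algebraic form of the first-order constraint -/

/-- The matrices `T` with `∑ₐ ρⁿ(tₐ) T ρᵐ(tₐ) = -(n m / 4) T`. -/
def twistSpace (n m : ℕ) : Submodule ℂ (Matrix (Fin (n + 1)) (Fin (m + 1)) ℂ) where
  carrier := {T | ∑ a, spinMat n a * T * spinMat m a = (-((n : ℂ) * m / 4)) • T}
  add_mem' {S T} hS hT := by
    simp only [Set.mem_ofPred_eq] at *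
    simp only [Matrix.mul_add, Matrix.add_mul, Finset.sum_add_distrib, hS, hT, smul_add]
  zero_mem' := by simp
  smul_mem' c T hT := by
    simp only [Set.mem_ofPred_eq] at *
    simp only [Matrix.mul_smul, Matrix.smul_mul, ← Finset.smul_sum, hT]
    rw [smul_comm]

/-- The equation at the entry `(q, r)` involves only `T` at `(q - 1, r - 1)`, `(q, r)` and `(q + 1,
r + 1)`, the last with a nonzero coefficient. Hence each diagonal of `T` is determined by its first
entry. -/
lemma twistSpace_eq_zero {n m : ℕ} {T : Matrix (Fin (n + 1)) (Fin (m + 1)) ℂ}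
    (hT : T ∈ twistSpace n m) (h0 : ∀ q, T q 0 = 0) (h0' : ∀ r, T 0 r = 0) : T = 0 := by
  have key : ∀ q (hq : q < n + 1) r (hr : r < m + 1), T ⟨q, hq⟩ ⟨r, hr⟩ = 0 := by
    intro q
    induction q using Nat.strong_induction_on with
    | _ q ih =>
      intro hq r hr
      rcases q with _ | q
      · exact h0' _
      rcases r with _ | r
      · exact h0 _
      have hT' : ∑ a, spinMat n a * T * spinMat m a = (-((n : ℂ) * m / 4)) • T := hT
      rw [sum_spinMat_mul_eq] at hT'
      have h1 := congrFun (congrFun hT' ⟨q, by omega⟩) ⟨r, by omega⟩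
      have hz := ih q (by omega) (by omega) r (by omega)
      -- This term reaches two rows back, which is why the induction is strong.
      have h2 : ((raising n)ᴴ * T * raising m) ⟨q, by omega⟩ ⟨r, by omega⟩ = 0 := by
        rw [raising_conjTranspose, Matrix.mul_apply]
        refine Finset.sum_eq_zero fun j _ => ?_
        rw [Matrix.mul_apply, Finset.sum_mul]
        refine Finset.sum_eq_zero fun i _ => ?_
        by_cases hi : (i : ℕ) + 1 = q
        · rw [ih i (by omega) i.2 j j.2]; simp
        · rw [Matrix.transpose_apply, raising_of_ne (by simpa using hi)]; simp
      have h3 : (raising n * T * (raising m)ᴴ) ⟨q, by omega⟩ ⟨r, by omega⟩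
          = raising n ⟨q, by omega⟩ ⟨q + 1, hq⟩ * T ⟨q + 1, hq⟩ ⟨r + 1, hr⟩
            * raising m ⟨r, by omega⟩ ⟨r + 1, hr⟩ := by
        rw [raising_conjTranspose, Matrix.mul_apply, Finset.sum_eq_single ⟨r + 1, hr⟩,
          Matrix.mul_apply, Finset.sum_eq_single ⟨q + 1, hq⟩, Matrix.transpose_apply]
        · intro i _ hi
          rw [raising_of_ne, zero_mul]
          intro h; apply hi; ext; exact h.symm
        · simp
        · intro i _ hi
          rw [Matrix.transpose_apply, raising_of_ne, mul_zero]
          intro h; apply hi; ext; exact h.symm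
        · simp
      simp only [Matrix.add_apply, Matrix.smul_apply, h2, h3, hz, spinMat, Matrix.cons_val,
        Matrix.diagonal_mul, Matrix.mul_diagonal, smul_eq_mul, mul_zero, zero_mul, add_zero,
        zero_add] at h1
      have e1 := raising_ne_zero (n := n) (p := ⟨q, by omega⟩) (q := ⟨q + 1, hq⟩) rfl
      have e2 := raising_ne_zero (n := m) (p := ⟨r, by omega⟩) (q := ⟨r + 1, hr⟩) rfl
      simpa [e1, e2] using h1
  ext q r
  exact key q q.2 r r.2

/-- The first column has `n + 1` entries and the first row `m` more. The bound is the dimension of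
the top component of the product of the spins `n / 2` and `m / 2`. -/
lemma finrank_twistSpace_le (n m : ℕ) : Module.finrank ℂ (twistSpace n m) ≤ n + m + 1 := by
  let f : twistSpace n m →ₗ[ℂ] (Fin (n + 1) → ℂ) × (Fin m → ℂ) :=
    { toFun := fun T => (fun q => T.1 q 0, fun r => T.1 0 r.succ)
      map_add' := fun _ _ => rfl
      map_smul' := fun _ _ => rfl }
  have hf : Function.Injective f := by
    rw [← LinearMap.ker_eq_bot, LinearMap.ker_eq_bot']
    intro T hT
    have h1 : ∀ q, T.1 q 0 = 0 := fun q => congrFun (congrArg Prod.fst hT) q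
    have h2 : ∀ r : Fin m, T.1 0 r.succ = 0 := fun r => congrFun (congrArg Prod.snd hT) r
    refine Subtype.ext (twistSpace_eq_zero T.2 h1 fun r => ?_)
    refine Fin.cases (h1 0) h2 r
  have := LinearMap.finrank_le_finrank_of_injective hf
  simp only [Module.finrank_prod, Module.finrank_fin_fun] at this
  omega

/-! ### Invariant vector fields through a smooth extension -/

/-- Left multiplication of a family of matrix entries by `i t_a`. -/
def leftGen (a : Fin 3) : (Fin 2 → Fin 2 → ℂ) →L[ℝ] (Fin 2 → Fin 2 → ℂ) :=
  LinearMap.toContinuousLinearMap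
    { toFun := fun M i j => ∑ l, (Complex.I • tGen a) i l * M l j
      map_add' := fun M N => by ext i j; simp [mul_add, Finset.sum_add_distrib]
      map_smul' := fun c M => by
        ext i j; simp only [Finset.smul_sum, Pi.smul_apply, mul_smul_comm, RingHom.id_apply] }

/-- Right multiplication of a family of matrix entries by `-i t_a`. -/
def rightGen (a : Fin 3) : (Fin 2 → Fin 2 → ℂ) →L[ℝ] (Fin 2 → Fin 2 → ℂ) :=
  LinearMap.toContinuousLinearMap
    { toFun := fun M i j => -∑ l, M i l * (Complex.I • tGen a) l j
      map_add' := fun M N => by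
        ext i j; simp only [Pi.add_apply, add_mul, Finset.sum_add_distrib]; ring
      map_smul' := fun c M => by
        ext i j
        simp only [Finset.smul_sum, Pi.smul_apply, smul_mul_assoc, RingHom.id_apply, smul_neg] }

lemma leftGen_apply (a : Fin 3) (M : Fin 2 → Fin 2 → ℂ) (i j : Fin 2) :
    leftGen a M i j = ∑ l, (Complex.I • tGen a) i l * M l j := rfl

lemma rightGen_apply (a : Fin 3) (M : Fin 2 → Fin 2 → ℂ) (i j : Fin 2) :
    rightGen a M i j = -∑ l, M i l * (Complex.I • tGen a) l j := rfl

section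
variable {N : ℕ} {φ : SU2 → Fin N → ℂ} {F : (Fin 2 → Fin 2 → ℂ) → (Fin N → ℂ)}

lemma leftField_eq_fderiv (hF : ContDiff ℝ ∞ F) (h : ∀ g, φ g = F (entries g)) (a : Fin 3)
    (g : SU2) : leftField a φ g = fderiv ℝ F (entries g) (leftGen a (entries g)) := by
  have hd : DifferentiableAt ℝ F (entries (oneParam a 0 * g)) :=
    (hF.differentiable (by simp)).differentiableAt
  have := hd.hasFDerivAt.comp_hasDerivAt (0 : ℝ) (hasDerivAt_left a g)
  simp only [Function.comp_def, ← h, oneParam_zero, one_mul] at this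
  exact this.deriv

lemma rightField_eq_fderiv (hF : ContDiff ℝ ∞ F) (h : ∀ g, φ g = F (entries g)) (a : Fin 3)
    (g : SU2) : rightField a φ g = fderiv ℝ F (entries g) (rightGen a (entries g)) := by
  have hd : DifferentiableAt ℝ F (entries (g * oneParam a (-0))) :=
    (hF.differentiable (by simp)).differentiableAt
  have := hd.hasFDerivAt.comp_hasDerivAt (0 : ℝ) (hasDerivAt_right a g)
  simp only [Function.comp_def, ← h, neg_zero, oneParam_zero, mul_one] at this
  exact this.deriv

lemma contDiff_fderiv_apply (hF : ContDiff ℝ ∞ F)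
    (S : (Fin 2 → Fin 2 → ℂ) →L[ℝ] (Fin 2 → Fin 2 → ℂ)) :
    ContDiff ℝ ∞ (fun M => fderiv ℝ F M (S M)) :=
  (hF.fderiv_right (m := ∞) (by simp)).clm_apply S.contDiff

lemma fderiv_fderiv_apply (hF : ContDiff ℝ ∞ F)
    (S : (Fin 2 → Fin 2 → ℂ) →L[ℝ] (Fin 2 → Fin 2 → ℂ)) (M v : Fin 2 → Fin 2 → ℂ) :
    fderiv ℝ (fun M => fderiv ℝ F M (S M)) M v
      = fderiv ℝ (fderiv ℝ F) M v (S M) + fderiv ℝ F M (S v) := by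
  have h1 : DifferentiableAt ℝ (fderiv ℝ F) M :=
    ((hF.fderiv_right (m := ∞) (by simp)).differentiable (by simp)).differentiableAt
  rw [(h1.hasFDerivAt.clm_apply S.hasFDerivAt).fderiv]
  simp [add_comm]

lemma fderiv_fderiv_symm (hF : ContDiff ℝ ∞ F) (M v w : Fin 2 → Fin 2 → ℂ) :
    fderiv ℝ (fderiv ℝ F) M v w = fderiv ℝ (fderiv ℝ F) M w v :=
  (hF.contDiffAt.isSymmSndFDerivAt (by simp; exact WithTop.coe_le_coe.mpr (le_top : (2 : ℕ∞) ≤ ⊤))) v w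

/-- In the first-order term the generators appear in the opposite order to the fields. The Hessian
term is symmetric and drops out of commutators. -/
lemma leftField_leftField (hF : ContDiff ℝ ∞ F) (h : ∀ g, φ g = F (entries g)) (a b : Fin 3)
    (g : SU2) : leftField b (leftField a φ) g
      = fderiv ℝ (fderiv ℝ F) (entries g) (leftGen b (entries g)) (leftGen a (entries g))
        + fderiv ℝ F (entries g) (leftGen a (leftGen b (entries g))) := by
  rw [leftField_eq_fderiv (contDiff_fderiv_apply hF (leftGen a)) (leftField_eq_fderiv hF h a),
    fderiv_fderiv_apply hF]

lemma rightField_rightField (hF : ContDiff ℝ ∞ F) (h : ∀ g, φ g = F (entries g)) (a b : Fin 3)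
    (g : SU2) : rightField b (rightField a φ) g
      = fderiv ℝ (fderiv ℝ F) (entries g) (rightGen b (entries g)) (rightGen a (entries g))
        + fderiv ℝ F (entries g) (rightGen a (rightGen b (entries g))) := by
  rw [rightField_eq_fderiv (contDiff_fderiv_apply hF (rightGen a)) (rightField_eq_fderiv hF h a),
    fderiv_fderiv_apply hF]

lemma leftField_rightField (hF : ContDiff ℝ ∞ F) (h : ∀ g, φ g = F (entries g)) (a b : Fin 3)
    (g : SU2) : leftField b (rightField a φ) g
      = fderiv ℝ (fderiv ℝ F) (entries g) (leftGen b (entries g)) (rightGen a (entries g))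
        + fderiv ℝ F (entries g) (rightGen a (leftGen b (entries g))) := by
  rw [leftField_eq_fderiv (contDiff_fderiv_apply hF (rightGen a)) (rightField_eq_fderiv hF h a),
    fderiv_fderiv_apply hF]

lemma rightField_leftField (hF : ContDiff ℝ ∞ F) (h : ∀ g, φ g = F (entries g)) (a b : Fin 3)
    (g : SU2) : rightField b (leftField a φ) g
      = fderiv ℝ (fderiv ℝ F) (entries g) (rightGen b (entries g)) (leftGen a (entries g))
        + fderiv ℝ F (entries g) (leftGen a (rightGen b (entries g))) := by
  rw [rightField_eq_fderiv (contDiff_fderiv_apply hF (leftGen a)) (leftField_eq_fderiv hF h a),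
    fderiv_fderiv_apply hF]

end

/-- The derivative of the extension is only real linear, so the structure constants have to be moved
through it as real numbers. -/
lemma eps_eq_ofReal (a b c : Fin 3) : eps a b c = ((eps a b c).re : ℂ) := by
  fin_cases a <;> fin_cases b <;> fin_cases c <;> simp [eps, Matrix.det_fin_three]

lemma gen_commutator (a b : Fin 3) :
    (Complex.I • tGen b) * (Complex.I • tGen a) - (Complex.I • tGen a) * (Complex.I • tGen b)
      = ∑ c, eps a b c • (Complex.I • tGen c) := by
  have h := tGen_commutator a b
  calc _ = tGen a * tGen b - tGen b * tGen a := by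
        simp only [smul_mul_assoc, mul_smul_comm, smul_smul, Complex.I_mul_I]
        module
    _ = _ := by
        rw [h, Finset.smul_sum]
        exact Finset.sum_congr rfl fun c _ => smul_comm _ _ _

lemma gen_commutator_apply (a b : Fin 3) (i j : Fin 2) :
    ∑ l, (Complex.I • tGen b) i l * (Complex.I • tGen a) l j
      - ∑ l, (Complex.I • tGen a) i l * (Complex.I • tGen b) l j
      = ∑ c, ((eps a b c).re : ℂ) * (Complex.I • tGen c) i j := by
  have h := congrFun (congrFun (gen_commutator a b) i) j
  rw [Matrix.sub_apply, Matrix.mul_apply, Matrix.mul_apply, Matrix.sum_apply] at h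
  rw [h]
  refine Finset.sum_congr rfl fun c _ => ?_
  rw [← eps_eq_ofReal]
  rfl

lemma leftGen_commutator (a b : Fin 3) (M : Fin 2 → Fin 2 → ℂ) :
    leftGen b (leftGen a M) - leftGen a (leftGen b M)
      = ∑ c, (eps a b c).re • leftGen c M := by
  ext i j
  have h0 := gen_commutator_apply a b i 0
  have h1 := gen_commutator_apply a b i 1
  simp only [Pi.sub_apply, Finset.sum_apply, Pi.smul_apply, Complex.real_smul, leftGen_apply,
    Fin.sum_univ_two, Fin.sum_univ_three] at *
  linear_combination M 0 j * h0 + M 1 j * h1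

lemma rightGen_commutator (a b : Fin 3) (M : Fin 2 → Fin 2 → ℂ) :
    rightGen b (rightGen a M) - rightGen a (rightGen b M)
      = ∑ c, (eps a b c).re • rightGen c M := by
  ext i j
  have h0 := gen_commutator_apply a b 0 j
  have h1 := gen_commutator_apply a b 1 j
  simp only [Pi.sub_apply, Finset.sum_apply, Pi.smul_apply, Complex.real_smul, rightGen_apply,
    Fin.sum_univ_two, Fin.sum_univ_three] at *
  linear_combination - M i 0 * h0 - M i 1 * h1

lemma leftGen_rightGen (a b : Fin 3) (M : Fin 2 → Fin 2 → ℂ) :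
    leftGen a (rightGen b M) = rightGen b (leftGen a M) := by
  ext i j
  simp only [leftGen_apply, rightGen_apply, Fin.sum_univ_two]
  ring

lemma sum_gen_mul_self_apply (i j : Fin 2) :
    ∑ a, ∑ l, (Complex.I • tGen a) i l * (Complex.I • tGen a) l j
      = -(3 / 4) * (1 : Matrix (Fin 2) (Fin 2) ℂ) i j := by
  have h := congrFun (congrFun sum_tGen_mul_self i) j
  simp only [Matrix.sum_apply, Matrix.mul_apply, Matrix.smul_apply, smul_eq_mul] at h ⊢
  rw [neg_mul, ← h, ← Finset.sum_neg_distrib]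
  refine Finset.sum_congr rfl fun a _ => ?_
  rw [← Finset.sum_neg_distrib]
  refine Finset.sum_congr rfl fun l _ => ?_
  linear_combination tGen a i l * tGen a l j * Complex.I_sq

/-- Both sides are `-(3/4) M`, since the sum of the squares of the `t_a` is the scalar 3/4. -/
lemma sum_leftGen_leftGen (M : Fin 2 → Fin 2 → ℂ) :
    ∑ a, leftGen a (leftGen a M) = ∑ a, rightGen a (rightGen a M) := by
  ext i j
  have h0 := sum_gen_mul_self_apply i 0
  have h1 := sum_gen_mul_self_apply i 1
  have k0 := sum_gen_mul_self_apply 0 j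
  have k1 := sum_gen_mul_self_apply 1 j
  simp only [Finset.sum_apply, leftGen_apply, rightGen_apply,
    Fin.sum_univ_two, Fin.sum_univ_three] at *
  have : (1 : Matrix (Fin 2) (Fin 2) ℂ) i 0 * M 0 j + (1 : Matrix (Fin 2) (Fin 2) ℂ) i 1 * M 1 j
      = (1 : Matrix (Fin 2) (Fin 2) ℂ) 0 j * M i 0 + (1 : Matrix (Fin 2) (Fin 2) ℂ) 1 j * M i 1 := by
    fin_cases i <;> fin_cases j <;> simp [Matrix.one_apply]
  linear_combination M 0 j * h0 + M 1 j * h1 - M i 0 * k0 - M i 1 * k1 - (3 / 4) * this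

lemma SU2.exists_real_coordinates (g : SU2) : ∃ x y z w : ℝ, x ^ 2 + y ^ 2 + z ^ 2 + w ^ 2 = 1 ∧
    (g : Matrix (Fin 2) (Fin 2) ℂ) =
      !![x + y * Complex.I, z + w * Complex.I; -z + w * Complex.I, x - y * Complex.I] := by
  obtain ⟨g, hg⟩ := g
  rw [Matrix.mem_specialUnitaryGroup_iff, Matrix.mem_unitaryGroup_iff'] at hg
  obtain ⟨hu, hd⟩ := hg
  rw [Matrix.det_fin_two] at hd
  have h00 := congrFun (congrFun hu 0) 0
  have h01 := congrFun (congrFun hu 0) 1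
  have h10 := congrFun (congrFun hu 1) 0
  have h11 := congrFun (congrFun hu 1) 1
  simp only [Matrix.mul_apply, Fin.sum_univ_two, Matrix.star_apply, RCLike.star_def,
    Matrix.one_apply_eq, Matrix.one_apply_ne, ne_eq, zero_ne_one, one_ne_zero, not_false_eq_true]
    at h00 h01 h10 h11
  -- The inverse of `g` is both its adjoint and its adjugate, so the lower row is determined by the
  -- upper one.
  have e11 : g 1 1 = (starRingEnd ℂ) (g 0 0) := by
    linear_combination (-g 1 1) * h00 + g 1 0 * h01 + (starRingEnd ℂ) (g 0 0) * hd
  have e10 : g 1 0 = -(starRingEnd ℂ) (g 0 1) := by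
    linear_combination (-g 1 0) * h11 + g 1 1 * h10 - (starRingEnd ℂ) (g 0 1) * hd
  refine ⟨(g 0 0).re, (g 0 0).im, (g 0 1).re, (g 0 1).im, ?_, ?_⟩
  · rw [e11, e10, Complex.mul_conj, mul_neg, Complex.mul_conj] at hd
    have := congrArg Complex.re hd
    simp [Complex.normSq_apply] at this
    nlinarith
  · ext i j
    fin_cases i <;> fin_cases j <;> apply Complex.ext <;> simp [e10, e11]

/-- The generators of left translations at `g` are the rotated generators of right
translations. -/
lemma exists_rotation (g : SU2) : ∃ O : Fin 3 → Fin 3 → ℝ,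
    (∀ a, leftGen a (entries g) = ∑ b, O a b • rightGen b (entries g)) ∧
    ∀ b c, ∑ a, O a b * O a c = if b = c then 1 else 0 := by
  obtain ⟨x, y, z, w, h, hg⟩ := SU2.exists_real_coordinates g
  have hg' : entries g = !![(x : ℂ) + y * Complex.I, z + w * Complex.I; -z + w * Complex.I,
    x - y * Complex.I] := hg
  have hC : (x : ℂ) ^ 2 + y ^ 2 + z ^ 2 + w ^ 2 = 1 := by exact_mod_cast h
  -- This is minus the matrix of t ↦ g⁻¹ t g in quaternion coordinates; the sign comes from the
  -- minus sign in `rightGen`.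
  refine ⟨![![-(x ^ 2 - y ^ 2 - z ^ 2 + w ^ 2), -(2 * x * y + 2 * z * w), 2 * (x * z - y * w)],
    ![2 * x * y - 2 * z * w, -(x ^ 2 - y ^ 2 + z ^ 2 - w ^ 2), -2 * (x * w + y * z)],
    ![-2 * (x * z + y * w), 2 * (x * w - y * z), -(x ^ 2 + y ^ 2 - z ^ 2 - w ^ 2)]], ?_, ?_⟩
  · intro a
    -- The right-hand side is cubic in the coordinates; multiplying the linear left-hand side by the
    -- norm turns the claim into a polynomial identity.
    have h1 : leftGen a (entries g) = (x ^ 2 + y ^ 2 + z ^ 2 + w ^ 2) • leftGen a (entries g) := by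
      rw [h, one_smul]
    have e00 : entries g 0 0 = x + y * Complex.I := by rw [hg']; rfl
    have e01 : entries g 0 1 = z + w * Complex.I := by rw [hg']; rfl
    have e10 : entries g 1 0 = -z + w * Complex.I := by rw [hg']; rfl
    have e11 : entries g 1 1 = x - y * Complex.I := by rw [hg']; rfl
    rw [h1]
    ext i j
    simp only [Finset.sum_apply, Pi.smul_apply, leftGen_apply, rightGen_apply, Fin.sum_univ_three,
      Fin.sum_univ_two]
    fin_cases a <;> fin_cases i <;> fin_cases j <;> apply Complex.ext <;>
      simp [tGen, e00, e01, e10, e11, -Complex.ofReal_pow] <;> ring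
  · intro b c
    -- On the diagonal the sum is N² with N the norm, and N² - 1 = (N + 1)(N - 1).
    fin_cases b <;> fin_cases c <;> simp [Fin.sum_univ_three] <;>
      first
      | linear_combination (x ^ 2 + y ^ 2 + z ^ 2 + w ^ 2 + 1) * h
      | ring

/-- The trace of a bilinear form does not change under an orthogonal change of frame. Applied to the
Hessian, it matches the second-order parts of the two Laplacians. -/
lemma sum_bilin_leftGen {V : Type*} [NormedAddCommGroup V] [NormedSpace ℝ V]
    (B : (Fin 2 → Fin 2 → ℂ) →L[ℝ] (Fin 2 → Fin 2 → ℂ) →L[ℝ] V) (g : SU2) :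
    ∑ a, B (leftGen a (entries g)) (leftGen a (entries g))
      = ∑ a, B (rightGen a (entries g)) (rightGen a (entries g)) := by
  obtain ⟨O, hO, hO'⟩ := exists_rotation g
  simp only [hO, map_sum, map_smul, sum_apply, smul_apply, Finset.smul_sum,
    smul_smul]
  rw [Finset.sum_comm]
  refine Finset.sum_congr rfl fun b _ => ?_
  rw [Finset.sum_comm]
  simp only [← Finset.sum_smul]
  simp only [mul_comm (O _ b), hO']
  simp

/-! ### The operators on the fields -/

/-- Pointwise multiplication by matrices. -/
def matOp (n : ℕ) : Matrix (Fin (n + 1)) (Fin (n + 1)) ℂ →ₐ[ℂ] Module.End ℂ (Fields n) where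
  toFun A :=
    { toFun := fun φ => ⟨fun g => A *ᵥ φ.1 g, IsSmooth.mulVec _ φ.2⟩
      map_add' := fun φ ψ => Subtype.ext <| funext fun g => Matrix.mulVec_add _ (φ.1 g) (ψ.1 g)
      map_smul' := fun c φ => Subtype.ext <| funext fun g => Matrix.mulVec_smul _ c (φ.1 g) }
  map_one' := LinearMap.ext fun φ => Subtype.ext <| funext fun g => Matrix.one_mulVec _
  map_mul' A B := LinearMap.ext fun φ => Subtype.ext <| funext fun g =>
    (Matrix.mulVec_mulVec _ A B).symm
  map_zero' := LinearMap.ext fun φ => Subtype.ext <| funext fun g =>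
    (Matrix.zero_mulVec (φ.1 g)).trans rfl
  map_add' A B := LinearMap.ext fun φ => Subtype.ext <| funext fun g => Matrix.add_mulVec A B _
  commutes' r := LinearMap.ext fun φ => Subtype.ext <| funext fun g => by
    simp only [LinearMap.coe_mk, AddHom.coe_mk, Algebra.algebraMap_eq_smul_one, Matrix.smul_mulVec,
      Matrix.one_mulVec]
    rfl

lemma rho_eq_matOp (n : ℕ) (a : Fin 3) : rho n a = matOp n (spinMat n a) := rfl

lemma matOp_apply (n : ℕ) (A : Matrix (Fin (n + 1)) (Fin (n + 1)) ℂ) (φ : Fields n) (g : SU2) :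
    (matOp n A φ).1 g = A *ᵥ φ.1 g := rfl

lemma hasDerivAt_mulVec {N M : ℕ} (A : Matrix (Fin N) (Fin M) ℂ) {u : ℝ → Fin M → ℂ}
    {u' : Fin M → ℂ} {r : ℝ} (h : HasDerivAt u u' r) :
    HasDerivAt (fun r => A *ᵥ u r) (A *ᵥ u') r :=
  ((Matrix.toLin' A).toContinuousLinearMap.restrictScalars ℝ).hasFDerivAt.comp_hasDerivAt r h

lemma xiL_matOp (n : ℕ) (a : Fin 3) (A : Matrix (Fin (n + 1)) (Fin (n + 1)) ℂ) :
    xiL n a * matOp n A = matOp n A * xiL n a :=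
  LinearMap.ext fun φ => Subtype.ext <| funext fun g =>
    (hasDerivAt_mulVec A (hasDerivAt_leftField φ.2 a g)).deriv

lemma xiR_matOp (n : ℕ) (a : Fin 3) (A : Matrix (Fin (n + 1)) (Fin (n + 1)) ℂ) :
    xiR n a * matOp n A = matOp n A * xiR n a :=
  LinearMap.ext fun φ => Subtype.ext <| funext fun g =>
    (hasDerivAt_mulVec A (hasDerivAt_rightField φ.2 a g)).deriv

lemma coe_sum_smul_apply {n : ℕ} (c : Fin 3 → ℂ) (T : Fin 3 → Module.End ℂ (Fields n))
    (φ : Fields n) (g : SU2) :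
    (((∑ a, c a • T a) φ : Fields n) : SU2 → Fin (n + 1) → ℂ) g
      = ∑ a, c a • (T a φ : Fields n).1 g := by
  rw [LinearMap.sum_apply, Submodule.coe_sum, Finset.sum_apply]
  rfl

lemma xiL_commutator (n : ℕ) (a b : Fin 3) :
    xiL n a * xiL n b - xiL n b * xiL n a = ∑ c, eps a b c • xiL n c := by
  refine LinearMap.ext fun φ => Subtype.ext <| funext fun g => ?_
  obtain ⟨F, hF, h⟩ := φ.2
  rw [coe_sum_smul_apply]
  change leftField a (leftField b φ.1) g - leftField b (leftField a φ.1) g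
    = ∑ c, eps a b c • leftField c φ.1 g
  rw [leftField_leftField hF h, leftField_leftField hF h, fderiv_fderiv_symm hF,
    add_sub_add_left_eq_sub, ← map_sub, leftGen_commutator, map_sum]
  refine Finset.sum_congr rfl fun c _ => ?_
  rw [map_smul, leftField_eq_fderiv hF h, eps_eq_ofReal, Complex.ofReal_re, Complex.coe_smul]

lemma xiR_commutator (n : ℕ) (a b : Fin 3) :
    xiR n a * xiR n b - xiR n b * xiR n a = ∑ c, eps a b c • xiR n c := by
  refine LinearMap.ext fun φ => Subtype.ext <| funext fun g => ?_
  obtain ⟨F, hF, h⟩ := φ.2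
  rw [coe_sum_smul_apply]
  change rightField a (rightField b φ.1) g - rightField b (rightField a φ.1) g
    = ∑ c, eps a b c • rightField c φ.1 g
  rw [rightField_rightField hF h, rightField_rightField hF h, fderiv_fderiv_symm hF,
    add_sub_add_left_eq_sub, ← map_sub, rightGen_commutator, map_sum]
  refine Finset.sum_congr rfl fun c _ => ?_
  rw [map_smul, rightField_eq_fderiv hF h, eps_eq_ofReal, Complex.ofReal_re, Complex.coe_smul]

lemma xiL_xiR_commute (n : ℕ) (a b : Fin 3) : xiL n a * xiR n b = xiR n b * xiL n a := by
  refine LinearMap.ext fun φ => Subtype.ext <| funext fun g => ?_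
  obtain ⟨F, hF, h⟩ := φ.2
  change leftField a (rightField b φ.1) g = rightField b (leftField a φ.1) g
  rw [leftField_rightField hF h, rightField_leftField hF h, fderiv_fderiv_symm hF,
    leftGen_rightGen]

/-- The second-order parts agree by `sum_bilin_leftGen` and the first-order parts by
`sum_leftGen_leftGen`. -/
lemma sum_xiL_mul_self (n : ℕ) : ∑ a, xiL n a * xiL n a = ∑ a, xiR n a * xiR n a := by
  refine LinearMap.ext fun φ => Subtype.ext <| funext fun g => ?_
  obtain ⟨F, hF, h⟩ := φ.2
  simp only [LinearMap.sum_apply, Submodule.coe_sum, Finset.sum_apply]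
  change ∑ a, leftField a (leftField a φ.1) g = ∑ a, rightField a (rightField a φ.1) g
  simp only [leftField_leftField hF h, rightField_rightField hF h, Finset.sum_add_distrib,
    sum_bilin_leftGen]
  rw [← map_sum, ← map_sum, sum_leftGen_leftGen]

lemma JL_commutator (n : ℕ) (a b : Fin 3) :
    ⁅JL n a, JL n b⁆ = Complex.I • ∑ c, eps a b c • JL n c := by
  have h1 := xiL_commutator n a b
  have h2 := congrArg (matOp n) (spinMat_commutator n a b)
  simp only [map_sub, map_mul, map_smul, map_sum, ← rho_eq_matOp] at h2
  have h3 : xiL n a * rho n b = rho n b * xiL n a := xiL_matOp n a _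
  have h4 : xiL n b * rho n a = rho n a * xiL n b := xiL_matOp n b _
  simp only [JL, smul_add, Finset.sum_add_distrib]
  rw [← h2, Ring.lie_def]
  have h5 : ∑ c, eps a b c • Complex.I • xiL n c = Complex.I • ∑ c, eps a b c • xiL n c := by
    rw [Finset.smul_sum]; exact Finset.sum_congr rfl fun c _ => smul_comm _ _ _
  rw [h5, ← h1, smul_smul, Complex.I_mul_I]
  simp only [add_mul, mul_add, smul_mul_assoc, mul_smul_comm, smul_smul, Complex.I_mul_I, h3, h4]
  match_scalars <;> simp

lemma JR_commutator (n : ℕ) (a b : Fin 3) :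
    ⁅JR n a, JR n b⁆ = Complex.I • ∑ c, eps a b c • JR n c := by
  have h1 := xiR_commutator n a b
  simp only [JR]
  rw [Ring.lie_def]
  have h5 : ∑ c, eps a b c • Complex.I • xiR n c = Complex.I • ∑ c, eps a b c • xiR n c := by
    rw [Finset.smul_sum]; exact Finset.sum_congr rfl fun c _ => smul_comm _ _ _
  rw [h5, ← h1, smul_smul, Complex.I_mul_I]
  simp only [smul_mul_assoc, mul_smul_comm, smul_smul, Complex.I_mul_I]
  module

lemma JL_JR_commute (n : ℕ) (a b : Fin 3) : ⁅JL n a, JR n b⁆ = 0 := by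
  have h1 := xiL_xiR_commute n a b
  have h2 : xiR n b * rho n a = rho n a * xiR n b := xiR_matOp n b _
  simp only [JL, JR]
  rw [Ring.lie_def]
  simp only [add_mul, mul_add, smul_mul_assoc, mul_smul_comm, smul_smul, Complex.I_mul_I, h1, h2]
  match_scalars <;> simp

lemma sum_rho_mul_self (n : ℕ) :
    ∑ a, rho n a * rho n a = (((n : ℂ) / 2) * ((n : ℂ) / 2 + 1)) • 1 := by
  have h := congrArg (matOp n) (sum_spinMat_mul_self n)
  simpa only [map_sum, map_mul, map_smul, map_one, ← rho_eq_matOp] using h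

lemma casimir_eq (n : ℕ) : ∑ a, JL n a * JL n a = ∑ a, JR n a * JR n a
    + (2 * Complex.I) • ∑ a, xiL n a * rho n a
    + ((((n : ℝ) / 2) * ((n : ℝ) / 2 + 1) : ℝ) : ℂ) • 1 := by
  have h1 := sum_xiL_mul_self n
  have h2 := sum_rho_mul_self n
  have h3 (a) : xiL n a * rho n a = rho n a * xiL n a := xiL_matOp n a _
  have h4 (a) : JL n a * JL n a = (-1 : ℂ) • (xiL n a * xiL n a) + (2 * Complex.I) • (xiL n a * rho n a)
      + rho n a * rho n a := by
    simp only [JL, add_mul, mul_add, smul_mul_assoc, mul_smul_comm, smul_smul, Complex.I_mul_I, h3]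
    match_scalars <;> simp <;> ring
  have h5 (a) : JR n a * JR n a = (-1 : ℂ) • (xiR n a * xiR n a) := by
    simp only [JR, smul_mul_assoc, mul_smul_comm, smul_smul, Complex.I_mul_I]
  simp only [h4, h5, Finset.sum_add_distrib, h1, h2, ← Finset.smul_sum]
  push_cast
  rfl

/-! ### Coherent vectors and the representation matrices -/

/-- The coherent vector `z ⊗ ⋯ ⊗ z` of spin `p / 2`, in the orthonormal basis. -/
def coh (p : ℕ) (z : Fin 2 → ℂ) : Fin (p + 1) → ℂ :=
  fun q => ((Real.sqrt (p.choose q) : ℝ) : ℂ) * (z 0 ^ (p - (q : ℕ)) * z 1 ^ (q : ℕ))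

lemma sqrt_choose_ne_zero {p : ℕ} (q : Fin (p + 1)) : ((Real.sqrt (p.choose q) : ℝ) : ℂ) ≠ 0 := by
  have : 0 < p.choose q := Nat.choose_pos (by omega)
  have h : 0 < Real.sqrt (p.choose q) := Real.sqrt_pos.mpr (by exact_mod_cast this)
  exact_mod_cast h.ne'

lemma sqrt_choose_mul_self {p : ℕ} (q : ℕ) :
    ((Real.sqrt (p.choose q) : ℝ) : ℂ) * ((Real.sqrt (p.choose q) : ℝ) : ℂ) = p.choose q := by
  rw [← Complex.ofReal_mul, Real.mul_self_sqrt (by positivity)]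
  simp

/-- The weights √(p choose q) make this the binomial theorem. The pairing is bilinear, without
conjugation. -/
lemma coh_dotProduct_coh (p : ℕ) (w z : Fin 2 → ℂ) :
    coh p w ⬝ᵥ coh p z = (w ⬝ᵥ z) ^ p := by
  have h : w ⬝ᵥ z = w 1 * z 1 + w 0 * z 0 := by
    simp [dotProduct, Fin.sum_univ_two, add_comm]
  rw [h, add_pow, Finset.sum_range]
  refine Finset.sum_congr rfl fun q _ => ?_
  rw [← sqrt_choose_mul_self, coh, coh, mul_pow, mul_pow]
  ring

/-- The coherent vectors of the points `(1, 0), …, (1, p)`, as columns. -/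
def cohMat (p : ℕ) : Matrix (Fin (p + 1)) (Fin (p + 1)) ℂ :=
  Matrix.of fun q i => coh p ![1, ((i : ℕ) : ℂ)] q

lemma isUnit_det_cohMat (p : ℕ) : IsUnit (cohMat p).det := by
  have h : cohMat p = Matrix.diagonal (fun q : Fin (p + 1) => ((Real.sqrt (p.choose q) : ℝ) : ℂ))
      * (Matrix.vandermonde fun i : Fin (p + 1) => ((i : ℕ) : ℂ))ᵀ := by
    ext q i
    simp [cohMat, coh, Matrix.vandermonde_apply]
  rw [h, Matrix.det_mul, Matrix.det_diagonal, Matrix.det_transpose, isUnit_iff_ne_zero]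
  refine mul_ne_zero (Finset.prod_ne_zero_iff.mpr fun q _ => sqrt_choose_ne_zero q) ?_
  rw [Matrix.det_vandermonde_ne_zero_iff]
  intro i j hij
  ext
  simpa using hij

/-- Coherent vectors contain a basis, by a Vandermonde determinant. Identities can therefore be
tested on them, where a group element simply acts on the argument `z`. -/
lemma eq_of_mulVec_coh {p N : ℕ} {A B : Matrix (Fin N) (Fin (p + 1)) ℂ}
    (h : ∀ z, A *ᵥ coh p z = B *ᵥ coh p z) : A = B := by
  have h1 : A * cohMat p = B * cohMat p := by
    ext q i
    exact congrFun (h ![1, ((i : ℕ) : ℂ)]) q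
  have h2 := congrArg (· * (cohMat p)⁻¹) h1
  simpa only [Matrix.mul_assoc, Matrix.mul_nonsing_inv _ (isUnit_det_cohMat p), mul_one,
    Matrix.mul_one] using h2

lemma span_coh (p : ℕ) : Submodule.span ℂ (Set.range (coh p)) = ⊤ := by
  rw [eq_top_iff]
  intro v _
  have h : v = ∑ i, ((cohMat p)⁻¹ *ᵥ v) i • coh p ![1, ((i : ℕ) : ℂ)] := by
    have h1 : v = cohMat p *ᵥ ((cohMat p)⁻¹ *ᵥ v) := by
      rw [Matrix.mulVec_mulVec, Matrix.mul_nonsing_inv _ (isUnit_det_cohMat p), Matrix.one_mulVec]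
    conv_lhs => rw [h1]
    ext q
    simp only [Matrix.mulVec, dotProduct, Finset.sum_apply, Pi.smul_apply, smul_eq_mul]
    exact Finset.sum_congr rfl fun i _ => mul_comm _ _
  rw [h]
  exact sum_mem fun i _ => Submodule.smul_mem _ _ (Submodule.subset_span ⟨_, rfl⟩)

/-- A binary form of degree `p`. -/
def IsBinaryForm (p : ℕ) (f : (Fin 2 → ℂ) → ℂ) : Prop :=
  ∃ c : Fin (p + 1) → ℂ, ∀ z, f z = ∑ q : Fin (p + 1), c q * (z 0 ^ (p - (q : ℕ)) * z 1 ^ (q : ℕ))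

lemma IsBinaryForm.linear_mul {p : ℕ} {f : (Fin 2 → ℂ) → ℂ} (hf : IsBinaryForm p f) (a b : ℂ) :
    IsBinaryForm (p + 1) (fun z => (a * z 0 + b * z 1) * f z) := by
  obtain ⟨c, hc⟩ := hf
  -- Multiplication by `z 0` keeps the index of a coefficient, multiplication by `z 1` shifts it by
  -- one.
  refine ⟨(Fin.snoc (fun q => a * c q) 0 : Fin (p + 2) → ℂ)
    + (Fin.cons 0 (fun q => b * c q) : Fin (p + 2) → ℂ), fun z => ?_⟩
  simp only [Pi.add_apply, add_mul, Finset.sum_add_distrib]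
  rw [Fin.sum_univ_castSucc, Fin.sum_univ_succ (n := p + 1) (fun q =>
    (Fin.cons 0 (fun q => b * c q) : Fin (p + 2) → ℂ) q * (z 0 ^ (p + 1 - (q : ℕ)) * z 1 ^ (q : ℕ)))]
  simp only [Fin.snoc_castSucc, Fin.snoc_last, Fin.cons_zero, Fin.cons_succ, zero_mul, add_zero,
    zero_add, hc, Finset.mul_sum]
  congr 1
  · refine Finset.sum_congr rfl fun q _ => ?_
    rw [Fin.val_castSucc, Nat.succ_sub (by omega : (q : ℕ) ≤ p), pow_succ]
    ring
  · refine Finset.sum_congr rfl fun q _ => ?_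
    rw [Fin.val_succ, Nat.add_sub_add_right, pow_succ (z 1)]
    ring

lemma isBinaryForm_pow_mul_pow (a b c d : ℂ) (i j : ℕ) :
    IsBinaryForm (i + j) (fun z => (a * z 0 + b * z 1) ^ i * (c * z 0 + d * z 1) ^ j) := by
  induction j with
  | zero =>
    induction i with
    | zero => exact ⟨fun _ => 1, fun z => by simp⟩
    | succ i ih =>
      have h : IsBinaryForm (i + 0 + 1) _ := ih.linear_mul a b
      obtain ⟨e, he⟩ := h
      exact ⟨e, fun z => Eq.trans (by ring) (he z)⟩
  | succ j ih =>
    have h : IsBinaryForm (i + j + 1) _ := ih.linear_mul c d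
    obtain ⟨e, he⟩ := h
    exact ⟨e, fun z => Eq.trans (by ring) (he z)⟩

lemma IsBinaryForm.exists_dotProduct {p : ℕ} {f : (Fin 2 → ℂ) → ℂ} (hf : IsBinaryForm p f) :
    ∃ c : Fin (p + 1) → ℂ, ∀ z, f z = c ⬝ᵥ coh p z := by
  obtain ⟨c, hc⟩ := hf
  refine ⟨fun q => c q / ((Real.sqrt (p.choose q) : ℝ) : ℂ), fun z => ?_⟩
  rw [hc, dotProduct]
  refine Finset.sum_congr rfl fun q _ => ?_
  have := sqrt_choose_ne_zero q
  rw [coh]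
  field_simp

/-- Each component of `coh p (M *ᵥ z)` is a form of degree `p` in `z`, hence a linear combination of
the components of `coh p z`. -/
lemma exists_mulVec_coh (p : ℕ) (M : Matrix (Fin 2) (Fin 2) ℂ) :
    ∃ A : Matrix (Fin (p + 1)) (Fin (p + 1)) ℂ, ∀ z, A *ᵥ coh p z = coh p (M *ᵥ z) := by
  have h (q : Fin (p + 1)) : ∃ c : Fin (p + 1) → ℂ, ∀ z, coh p (M *ᵥ z) q = c ⬝ᵥ coh p z := by
    have h1 := isBinaryForm_pow_mul_pow (M 0 0) (M 0 1) (M 1 0) (M 1 1) (p - (q : ℕ)) q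
    rw [Nat.sub_add_cancel (by omega : (q : ℕ) ≤ p)] at h1
    obtain ⟨c, hc⟩ := h1.exists_dotProduct
    refine ⟨((Real.sqrt (p.choose q) : ℝ) : ℂ) • c, fun z => ?_⟩
    rw [smul_dotProduct, ← hc, coh, Matrix.mulVec_eq_sum]
    simp [Fin.sum_univ_two, mul_comm]
  choose c hc using h
  exact ⟨Matrix.of c, fun z => funext fun q => (hc q z).symm⟩

/-- The action of a `2 × 2` matrix on the symmetric tensors of degree `p`. -/
def repMat (p : ℕ) (M : Matrix (Fin 2) (Fin 2) ℂ) : Matrix (Fin (p + 1)) (Fin (p + 1)) ℂ :=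
  (exists_mulVec_coh p M).choose

lemma repMat_mulVec_coh (p : ℕ) (M : Matrix (Fin 2) (Fin 2) ℂ) (z : Fin 2 → ℂ) :
    repMat p M *ᵥ coh p z = coh p (M *ᵥ z) :=
  (exists_mulVec_coh p M).choose_spec z

lemma repMat_one (p : ℕ) : repMat p 1 = 1 :=
  eq_of_mulVec_coh fun z => by rw [repMat_mulVec_coh, Matrix.one_mulVec, Matrix.one_mulVec]

lemma repMat_mul (p : ℕ) (M N : Matrix (Fin 2) (Fin 2) ℂ) :
    repMat p (M * N) = repMat p M * repMat p N :=
  eq_of_mulVec_coh fun z => by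
    rw [repMat_mulVec_coh, ← Matrix.mulVec_mulVec, ← Matrix.mulVec_mulVec, repMat_mulVec_coh,
      repMat_mulVec_coh]

/-- An explicit formula, polynomial in the entries of `M`, for a matrix that was defined by choice;
smoothness and derivatives are read off from it. -/
lemma repMat_apply (p : ℕ) (M : Matrix (Fin 2) (Fin 2) ℂ) (q r : Fin (p + 1)) :
    repMat p M q r = ∑ i : Fin (p + 1), coh p (M *ᵥ ![1, ((i : ℕ) : ℂ)]) q * (cohMat p)⁻¹ i r := by
  have h : repMat p M * cohMat p
      = Matrix.of fun q i : Fin (p + 1) => coh p (M *ᵥ ![1, ((i : ℕ) : ℂ)]) q := by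
    ext q i
    exact congrFun (repMat_mulVec_coh p M ![1, ((i : ℕ) : ℂ)]) q
  have h2 : repMat p M = repMat p M * cohMat p * (cohMat p)⁻¹ := by
    rw [Matrix.mul_assoc, Matrix.mul_nonsing_inv _ (isUnit_det_cohMat p), Matrix.mul_one]
  rw [h2, h, Matrix.mul_apply]
  rfl

lemma contDiff_repMat (p : ℕ) (q r : Fin (p + 1)) :
    ContDiff ℝ ∞ (fun M : Fin 2 → Fin 2 → ℂ => repMat p (Matrix.of M) q r) := by
  simp only [repMat_apply, coh, Matrix.mulVec, dotProduct, Matrix.of_apply, Fin.sum_univ_two]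
  refine ContDiff.sum fun i _ => ?_
  fun_prop

/-- The representation of `SU₂` of spin `p / 2`. -/
def spinRep (p : ℕ) : SU2 →* Matrix (Fin (p + 1)) (Fin (p + 1)) ℂ where
  toFun g := repMat p (g : Matrix (Fin 2) (Fin 2) ℂ)
  map_one' := repMat_one p
  map_mul' g h := repMat_mul p _ _

lemma spinRep_mulVec_coh (p : ℕ) (g : SU2) (z : Fin 2 → ℂ) :
    spinRep p g *ᵥ coh p z = coh p ((g : Matrix (Fin 2) (Fin 2) ℂ) *ᵥ z) :=
  repMat_mulVec_coh p _ z

/-! ### The infinitesimal action -/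

/-- On the monomials, raising is z₁ ∂/∂z₀, and likewise lowering is z₀ ∂/∂z₁. The truncated exponent
at `q = p` is harmless because the factor `p - q` is zero. -/
lemma raising_mulVec_coh (p : ℕ) (z : Fin 2 → ℂ) (q : Fin (p + 1)) :
    (raising p *ᵥ coh p z) q = ((Real.sqrt (p.choose q) : ℝ) : ℂ) * (((p - (q : ℕ) : ℕ) : ℂ)
      * z 0 ^ (p - (q : ℕ) - 1) * z 1 ^ ((q : ℕ) + 1)) := by
  rw [Matrix.mulVec, dotProduct]
  by_cases hq : (q : ℕ) < p
  · rw [Finset.sum_eq_single (⟨q + 1, by omega⟩ : Fin (p + 1))]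
    · rw [raising_apply, if_pos rfl, coh]
      have h : Real.sqrt ((((q : ℕ) + 1 : ℕ) : ℝ) * ((p : ℝ) + 1 - (((q : ℕ) + 1 : ℕ) : ℝ)))
          * Real.sqrt (p.choose ((q : ℕ) + 1)) = Real.sqrt (p.choose q) * ((p - (q : ℕ) : ℕ) : ℝ) := by
        have h1 := congrArg (Nat.cast : ℕ → ℝ) (Nat.choose_succ_right_eq p q)
        rw [Nat.cast_mul, Nat.cast_mul] at h1
        have h2 : (p : ℝ) + 1 - (((q : ℕ) + 1 : ℕ) : ℝ) = ((p - (q : ℕ) : ℕ) : ℝ) := by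
          rw [Nat.cast_sub hq.le]; push_cast; ring
        rw [h2, ← Real.sqrt_mul (by positivity)]
        conv_rhs => rw [← Real.sqrt_sq (Nat.cast_nonneg (α := ℝ) (p - (q : ℕ))),
          ← Real.sqrt_mul (by positivity)]
        congr 1
        linear_combination ((p - (q : ℕ) : ℕ) : ℝ) * h1
      have hC := congrArg (Complex.ofReal) h
      rw [Complex.ofReal_mul, Complex.ofReal_mul] at hC
      simp only [Nat.sub_sub]
      rw [Complex.ofReal_natCast] at hC
      linear_combination z 0 ^ (p - ((q : ℕ) + 1)) * z 1 ^ ((q : ℕ) + 1) * hC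
    · intro i _ hi
      rw [raising_of_ne, zero_mul]
      intro h; apply hi; ext; exact h.symm
    · simp
  · have hpq : p - (q : ℕ) = 0 := by omega
    rw [hpq, Finset.sum_eq_zero]
    · simp
    · intro i _
      rw [raising_of_ne (by omega), zero_mul]

lemma lowering_mulVec_coh (p : ℕ) (z : Fin 2 → ℂ) (q : Fin (p + 1)) :
    ((raising p)ᴴ *ᵥ coh p z) q = ((Real.sqrt (p.choose q) : ℝ) : ℂ) * (((q : ℕ) : ℂ)
      * z 0 ^ (p - (q : ℕ) + 1) * z 1 ^ ((q : ℕ) - 1)) := by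
  rw [raising_conjTranspose, Matrix.mulVec, dotProduct]
  simp only [Matrix.transpose_apply]
  obtain ⟨q, hq⟩ := q
  rcases q with _ | q
  · rw [Finset.sum_eq_zero]
    · simp
    · intro i _
      rw [raising_of_ne (by simp), zero_mul]
  · rw [Finset.sum_eq_single (⟨q, by omega⟩ : Fin (p + 1))]
    · rw [raising_apply, if_pos rfl, coh]
      have h : Real.sqrt (((q + 1 : ℕ) : ℝ) * ((p : ℝ) + 1 - ((q + 1 : ℕ) : ℝ)))
          * Real.sqrt (p.choose q) = Real.sqrt (p.choose (q + 1)) * ((q + 1 : ℕ) : ℝ) := by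
        have h1 := congrArg (Nat.cast : ℕ → ℝ) (Nat.choose_succ_right_eq p q)
        rw [Nat.cast_mul, Nat.cast_mul, Nat.cast_sub (by omega)] at h1
        have h2 : (p : ℝ) + 1 - ((q + 1 : ℕ) : ℝ) = (p : ℝ) - q := by
          push_cast; ring
        have h3 : (q : ℝ) ≤ p := by exact_mod_cast (by omega : q ≤ p)
        rw [h2, ← Real.sqrt_mul (mul_nonneg (by positivity) (by linarith))]
        conv_rhs => rw [← Real.sqrt_sq (Nat.cast_nonneg (α := ℝ) (q + 1)),
          ← Real.sqrt_mul (by positivity)]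
        congr 1
        linear_combination -((q + 1 : ℕ) : ℝ) * h1
      have hC := congrArg (Complex.ofReal) h
      rw [Complex.ofReal_mul, Complex.ofReal_mul, Complex.ofReal_natCast] at hC
      have h4 : p - (q + 1) + 1 = p - q := by omega
      simp only [h4, Nat.add_sub_cancel]
      linear_combination z 0 ^ (p - q) * z 1 ^ q * hC
    · intro i _ hi
      rw [raising_of_ne, zero_mul]
      intro h; apply hi; ext; simpa using h
    · simp

/-- The matrix `i x_a ρ(t_a)`. -/
def spinAlg (p : ℕ) (x : E3) : Matrix (Fin (p + 1)) (Fin (p + 1)) ℂ :=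
  Complex.I • ∑ a, ((x a : ℝ) : ℂ) • spinMat p a

lemma spinAlg_eq (p : ℕ) (x : E3) : spinAlg p x
    = (Complex.I * x 2) • spinMat p 2 + (Complex.I / 2 * (x 0 - x 1 * Complex.I)) • raising p
      + (Complex.I / 2 * (x 0 + x 1 * Complex.I)) • (raising p)ᴴ := by
  rw [spinAlg, Fin.sum_univ_three, spinMat_zero, spinMat_one]
  match_scalars <;> ring

/-- The product rule yields the operator (Xz)₀ ∂/∂z₀ + (Xz)₁ ∂/∂z₁ with X = `algMat x`; the ladder
lemmas identify it with `spinAlg p x`. -/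
lemma hasDerivAt_coh (p : ℕ) (x : E3) {M : ℝ → Matrix (Fin 2) (Fin 2) ℂ} (h0 : M 0 = 1)
    (hM : ∀ i j, HasDerivAt (fun r => M r i j) (algMat x i j) 0) (z : Fin 2 → ℂ)
    (q : Fin (p + 1)) :
    HasDerivAt (fun r => coh p (M r *ᵥ z) q) ((spinAlg p x *ᵥ coh p z) q) 0 := by
  have hz (i : Fin 2) : HasDerivAt (fun r => (M r *ᵥ z) i) ((algMat x *ᵥ z) i) 0 := by
    simp only [Matrix.mulVec, dotProduct]
    exact HasDerivAt.fun_sum fun j _ => (hM i j).mul_const _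
  have h := (((hz 0).fun_pow (p - (q : ℕ))).fun_mul ((hz 1).fun_pow q)).const_mul
    ((Real.sqrt (p.choose q) : ℝ) : ℂ)
  refine h.congr_deriv ?_
  rw [spinAlg_eq, Matrix.add_mulVec, Matrix.add_mulVec, Matrix.smul_mulVec, Matrix.smul_mulVec,
    Matrix.smul_mulVec]
  simp only [Pi.add_apply, Pi.smul_apply, raising_mulVec_coh, lowering_mulVec_coh, smul_eq_mul, h0,
    Matrix.one_mulVec]
  have hH : (spinMat p 2 *ᵥ coh p z) q = ((p : ℂ) / 2 - (q : ℕ)) * coh p z q := by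
    simp [spinMat, Matrix.mulVec_diagonal]
  have hA0 : (algMat x *ᵥ z) 0 = Complex.I / 2 * (x 2 * z 0 + (x 0 - x 1 * Complex.I) * z 1) := by
    simp [algMat, tGen, Matrix.mulVec, dotProduct, Fin.sum_univ_three, Fin.sum_univ_two]
    ring
  have hA1 : (algMat x *ᵥ z) 1 = Complex.I / 2 * ((x 0 + x 1 * Complex.I) * z 0 - x 2 * z 1) := by
    simp [algMat, tGen, Matrix.mulVec, dotProduct, Fin.sum_univ_three, Fin.sum_univ_two]
    ring
  rw [hH, hA0, hA1, coh]
  have hpq : (p : ℂ) = ((p - (q : ℕ) : ℕ) : ℂ) + (q : ℕ) := by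
    rw [← Nat.cast_add, Nat.sub_add_cancel (by omega)]
  rw [hpq]
  generalize p - (q : ℕ) = a
  generalize (q : ℕ) = b
  rcases a with _ | a <;> rcases b with _ | b <;> simp [pow_succ] <;> ring

lemma hasDerivAt_repMat (p : ℕ) (x : E3) {M : ℝ → Matrix (Fin 2) (Fin 2) ℂ} (h0 : M 0 = 1)
    (hM : ∀ i j, HasDerivAt (fun r => M r i j) (algMat x i j) 0) (q r : Fin (p + 1)) :
    HasDerivAt (fun s => repMat p (M s) q r) (spinAlg p x q r) 0 := by
  simp only [repMat_apply]
  have h : spinAlg p x q r = ∑ i : Fin (p + 1),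
      (spinAlg p x *ᵥ coh p ![1, ((i : ℕ) : ℂ)]) q * (cohMat p)⁻¹ i r := by
    have h2 : spinAlg p x = spinAlg p x * cohMat p * (cohMat p)⁻¹ := by
      rw [Matrix.mul_assoc, Matrix.mul_nonsing_inv _ (isUnit_det_cohMat p), Matrix.mul_one]
    conv_lhs => rw [h2, Matrix.mul_apply]
    rfl
  rw [h]
  exact HasDerivAt.fun_sum fun i _ => (hasDerivAt_coh p x h0 hM _ q).mul_const _

section
open scoped Matrix.Norms.Operator

lemma hasDerivAt_matrix {N : ℕ} {U : ℝ → Matrix (Fin N) (Fin N) ℂ} {D : Matrix (Fin N) (Fin N) ℂ}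
    {r : ℝ} (h : ∀ i j, HasDerivAt (fun s => U s i j) (D i j) r) : HasDerivAt U D r := by
  have h1 : HasDerivAt (fun s => ∑ i, ∑ j, U s i j • Matrix.single i j (1 : ℂ))
      (∑ i, ∑ j, D i j • Matrix.single i j (1 : ℂ)) r :=
    HasDerivAt.fun_sum fun i _ => HasDerivAt.fun_sum fun j _ => (h i j).smul_const _
  have h2 (A : Matrix (Fin N) (Fin N) ℂ) : ∑ i, ∑ j, A i j • Matrix.single i j (1 : ℂ) = A := by
    conv_rhs => rw [Matrix.matrix_eq_sum_single A]
    simp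
  simpa only [h2] using h1

lemma hasDerivAt_matrix_apply {N : ℕ} {U : ℝ → Matrix (Fin N) (Fin N) ℂ}
    {D : Matrix (Fin N) (Fin N) ℂ} {r : ℝ} (h : HasDerivAt U D r) (i j : Fin N) :
    HasDerivAt (fun s => U s i j) (D i j) r :=
  ((Matrix.entryLinearMap ℝ ℂ i j).toContinuousLinearMap).hasFDerivAt.comp_hasDerivAt r h

lemma hasDerivAt_exp_smul_apply {N : ℕ} (A : Matrix (Fin N) (Fin N) ℂ) (i j : Fin N) :
    HasDerivAt (fun r : ℝ => NormedSpace.exp (r • A) i j) (A i j) 0 := by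
  have h := hasDerivAt_exp_smul_const (𝕂 := ℝ) A (0 : ℝ)
  simp only [zero_smul, NormedSpace.exp_zero, one_mul] at h
  exact hasDerivAt_matrix_apply h i j

/-- The product of U(s) with e^{-sD} has derivative zero. -/
lemma exp_of_one_parameter {N : ℕ} {U : ℝ → Matrix (Fin N) (Fin N) ℂ}
    {D : Matrix (Fin N) (Fin N) ℂ} (h0 : U 0 = 1) (hU : ∀ r s, U (r + s) = U r * U s)
    (hD : ∀ i j, HasDerivAt (fun s => U s i j) (D i j) 0) (r : ℝ) :
    U r = NormedSpace.exp (r • D) := by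
  have h1 (r : ℝ) : HasDerivAt U (U r * D) r := by
    have h2 : HasDerivAt (fun s => U (s - r)) D r := by
      have := hasDerivAt_matrix hD
      rw [← sub_self r] at this
      exact this.comp_sub_const r r
    have h3 := h2.const_mul (U r)
    simp only [← hU, add_sub_cancel] at h3
    exact h3
  have h2 (r : ℝ) : HasDerivAt (fun s => U s * NormedSpace.exp (s • (-D))) 0 r := by
    have h3 := (h1 r).mul (hasDerivAt_exp_smul_const' (𝕂 := ℝ) (-D) r)
    refine h3.congr_deriv ?_
    simp [mul_assoc]
  have h3 := is_const_of_deriv_eq_zero (f := fun s => U s * NormedSpace.exp (s • (-D)))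
    (fun s => (h2 s).differentiableAt) (fun s => (h2 s).deriv) r 0
  simp only [h0, zero_smul, NormedSpace.exp_zero, one_mul] at h3
  have h4 : NormedSpace.exp (r • (-D)) * NormedSpace.exp (r • D) = 1 := by
    rw [← Matrix.exp_add_of_commute _ _ (by rw [smul_neg]; exact (Commute.refl (r • D)).neg_left)]
    simp
  calc U r = U r * (NormedSpace.exp (r • (-D)) * NormedSpace.exp (r • D)) := by rw [h4, mul_one]
    _ = _ := by rw [← mul_assoc, h3, one_mul]

end

lemma algMat_smul (r : ℝ) (x : E3) : algMat (r • x) = r • algMat x := by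
  ext i j
  simp [algMat, Fin.sum_univ_three]
  ring

lemma spinAlg_smul (p : ℕ) (r : ℝ) (x : E3) : spinAlg p (r • x) = r • spinAlg p x := by
  ext i j
  simp [spinAlg, Fin.sum_univ_three]
  ring

lemma algMat_add (x y : E3) : algMat (x + y) = algMat x + algMat y := by
  ext i j
  simp [algMat, Fin.sum_univ_three]
  ring

lemma coe_su2Exp (x : E3) : (su2Exp x : Matrix (Fin 2) (Fin 2) ℂ) = NormedSpace.exp (algMat x) := rfl

lemma su2Exp_zero : su2Exp 0 = 1 := by
  ext1
  have := algMat_smul 0 0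
  rw [zero_smul, zero_smul] at this
  rw [coe_su2Exp, this, NormedSpace.exp_zero]
  rfl

lemma su2Exp_add_smul (r s : ℝ) (x : E3) :
    su2Exp ((r + s) • x) = su2Exp (r • x) * su2Exp (s • x) := by
  ext1
  rw [Submonoid.coe_mul, coe_su2Exp, coe_su2Exp, coe_su2Exp, ← Matrix.exp_add_of_commute, add_smul,
    algMat_add]
  rw [algMat_smul, algMat_smul]
  exact ((Commute.refl (algMat x)).smul_left r).smul_right s

lemma hasDerivAt_spinRep (p : ℕ) (x : E3) (i j : Fin (p + 1)) :
    HasDerivAt (fun r : ℝ => spinRep p (su2Exp (r • x)) i j) (spinAlg p x i j) 0 := by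
  refine hasDerivAt_repMat p x (M := fun r => (su2Exp (r • x) : Matrix (Fin 2) (Fin 2) ℂ)) ?_ ?_ i j
  · simp [su2Exp_zero]
  · intro i j
    simp only [coe_su2Exp, algMat_smul]
    exact hasDerivAt_exp_smul_apply _ i j

lemma spinRep_su2Exp (p : ℕ) (x : E3) : spinRep p (su2Exp x) = NormedSpace.exp (spinAlg p x) := by
  have h := exp_of_one_parameter (U := fun r : ℝ => spinRep p (su2Exp (r • x))) (D := spinAlg p x)
    (by simp [su2Exp_zero]) (fun r s => by rw [su2Exp_add_smul, map_mul])
    (hasDerivAt_spinRep p x) 1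
  simpa using h

/-! ### The contraction of symmetric tensors -/

/-- The equivariant contraction of symmetric tensors of degree `n + m` and `m` to symmetric tensors
of degree `n`, by the invariant antisymmetric form of `SU₂`. -/
def contr (n m : ℕ) : (Fin (n + m + 1) → ℂ) →ₗ[ℂ] (Fin (m + 1) → ℂ) →ₗ[ℂ] (Fin (n + 1) → ℂ) :=
  LinearMap.mk₂ ℂ
    -- The weights are those that make `contr_coh` hold. The division removes the normalisation of
    -- `u`, and √(m choose c) combines with the one inside `w` to the binomial coefficient of (z₀w₁
    -- - z₁w₀)^m. The reversed index pairs opposite weights.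
    (fun u w q => ∑ c : Fin (m + 1), ((-1) ^ (c : ℕ) * ((Real.sqrt (n.choose q) : ℝ) : ℂ)
      * ((Real.sqrt (m.choose c) : ℝ) : ℂ)
      / ((Real.sqrt ((n + m).choose ((q : ℕ) + (c : ℕ))) : ℝ) : ℂ))
      * (u ⟨(q : ℕ) + (c : ℕ), by omega⟩ * w c.rev))
    (fun u u' w => by ext q; simp [add_mul, mul_add, Finset.sum_add_distrib])
    (fun c u w => by
      ext q; simp only [Pi.smul_apply, smul_eq_mul, Finset.mul_sum]
      exact Finset.sum_congr rfl fun _ _ => by ring)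
    (fun u w w' => by ext q; simp [mul_add, Finset.sum_add_distrib])
    (fun c u w => by
      ext q; simp only [Pi.smul_apply, smul_eq_mul, Finset.mul_sum]
      exact Finset.sum_congr rfl fun _ _ => by ring)

lemma contr_apply (n m : ℕ) (u : Fin (n + m + 1) → ℂ) (w : Fin (m + 1) → ℂ) (q : Fin (n + 1)) :
    contr n m u w q = ∑ c : Fin (m + 1), ((-1) ^ (c : ℕ) * ((Real.sqrt (n.choose q) : ℝ) : ℂ)
      * ((Real.sqrt (m.choose c) : ℝ) : ℂ)
      / ((Real.sqrt ((n + m).choose ((q : ℕ) + (c : ℕ))) : ℝ) : ℂ))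
      * (u ⟨(q : ℕ) + (c : ℕ), by omega⟩ * w c.rev) := rfl

lemma contr_coh (n m : ℕ) (z w : Fin 2 → ℂ) :
    contr n m (coh (n + m) z) (coh m w) = (z 0 * w 1 - z 1 * w 0) ^ m • coh n z := by
  ext q
  have h : z 0 * w 1 - z 1 * w 0 = -(z 1 * w 0) + z 0 * w 1 := by ring
  rw [contr_apply, Pi.smul_apply, h, add_pow, Finset.sum_range, smul_eq_mul, Finset.sum_mul]
  refine Finset.sum_congr rfl fun c _ => ?_
  have hne := sqrt_choose_ne_zero (p := n + m) ⟨(q : ℕ) + (c : ℕ), by omega⟩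
  have hq : (q : ℕ) ≤ n := by omega
  have hc : (c : ℕ) ≤ m := by omega
  have hrev : ((c.rev : Fin (m + 1)) : ℕ) = m - c := by rw [Fin.val_rev]; omega
  simp only [coh, hrev]
  simp only at hne
  rw [Nat.choose_symm hc, Nat.sub_sub_self hc, ← sqrt_choose_mul_self,
    show n + m - ((q : ℕ) + (c : ℕ)) = (n - q) + (m - c) by omega, pow_add, pow_add, neg_pow (z 1 * w 0),
    mul_pow, mul_pow]
  field_simp

lemma linearMap_ext_coh {p : ℕ} {V : Type*} [AddCommGroup V] [Module ℂ V]
    {f g : (Fin (p + 1) → ℂ) →ₗ[ℂ] V} (h : ∀ z, f (coh p z) = g (coh p z)) : f = g :=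
  LinearMap.ext_on (span_coh p) (by rintro _ ⟨z, rfl⟩; exact h z)

/-- On coherent vectors the contraction depends on `z` and `w` through z₀w₁ - z₁w₀, which matrices
of determinant one preserve. -/
lemma contr_spinRep (n m : ℕ) (g : SU2) (u : Fin (n + m + 1) → ℂ) (w : Fin (m + 1) → ℂ) :
    contr n m (spinRep (n + m) g *ᵥ u) (spinRep m g *ᵥ w) = spinRep n g *ᵥ contr n m u w := by
  have h : (contr n m).compl₁₂ (Matrix.toLin' (spinRep (n + m) g)) (Matrix.toLin' (spinRep m g))
      = (contr n m).compr₂ (Matrix.toLin' (spinRep n g)) := by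
    refine linearMap_ext_coh fun z => linearMap_ext_coh fun w => ?_
    have hd : (g : Matrix (Fin 2) (Fin 2) ℂ).det = 1 :=
      (Matrix.mem_specialUnitaryGroup_iff.mp g.2).2
    rw [Matrix.det_fin_two] at hd
    simp only [LinearMap.compl₁₂_apply, LinearMap.compr₂_apply, Matrix.toLin'_apply,
      spinRep_mulVec_coh, contr_coh, Matrix.mulVec_smul]
    congr 2
    simp only [Matrix.mulVec, dotProduct, Fin.sum_univ_two]
    linear_combination (z 0 * w 1 - z 1 * w 0) * hd
  exact LinearMap.congr_fun (LinearMap.congr_fun h u) w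

lemma hasDerivAt_linearMap {N M : ℕ} (L : (Fin N → ℂ) →ₗ[ℂ] (Fin M → ℂ)) {u : ℝ → Fin N → ℂ}
    {u' : Fin N → ℂ} {r : ℝ} (h : HasDerivAt u u' r) : HasDerivAt (fun r => L (u r)) (L u') r :=
  (L.toContinuousLinearMap.restrictScalars ℝ).hasFDerivAt.comp_hasDerivAt r h

lemma hasDerivAt_spinRep_mulVec (p : ℕ) (x : E3) (v : Fin (p + 1) → ℂ) :
    HasDerivAt (fun r : ℝ => spinRep p (su2Exp (r • x)) *ᵥ v) (spinAlg p x *ᵥ v) 0 := by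
  rw [hasDerivAt_pi]
  intro i
  simp only [Matrix.mulVec, dotProduct]
  exact HasDerivAt.fun_sum fun j _ => (hasDerivAt_spinRep p x i j).mul_const _

lemma spinAlg_single (p : ℕ) (a : Fin 3) :
    spinAlg p (EuclideanSpace.single a (1 : ℝ)) = Complex.I • spinMat p a := by
  rw [spinAlg, Finset.sum_eq_single a]
  · simp
  · intro b _ hb
    simp [hb]
  · simp

/-- The derivative of `contr_spinRep` along a one-parameter subgroup. -/
lemma contr_spinAlg (n m : ℕ) (x : E3) (u : Fin (n + m + 1) → ℂ) (w : Fin (m + 1) → ℂ) :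
    contr n m (spinAlg (n + m) x *ᵥ u) w + contr n m u (spinAlg m x *ᵥ w)
      = spinAlg n x *ᵥ contr n m u w := by
  have h1 : HasDerivAt (fun r : ℝ => contr n m (spinRep (n + m) (su2Exp (r • x)) *ᵥ u)
      (spinRep m (su2Exp (r • x)) *ᵥ w))
      (contr n m (spinAlg (n + m) x *ᵥ u) w + contr n m u (spinAlg m x *ᵥ w)) 0 := by
    rw [hasDerivAt_pi]
    intro q
    rw [Pi.add_apply, contr_apply, contr_apply, ← Finset.sum_add_distrib]
    simp only [contr_apply]
    refine HasDerivAt.fun_sum fun c _ => ?_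
    have hu := hasDerivAt_pi.mp (hasDerivAt_spinRep_mulVec (n + m) x u)
      ⟨(q : ℕ) + (c : ℕ), by omega⟩
    have hw := hasDerivAt_pi.mp (hasDerivAt_spinRep_mulVec m x w) c.rev
    refine ((hu.fun_mul hw).const_mul _).congr_deriv ?_
    simp [su2Exp_zero]
    ring
  have h2 := hasDerivAt_spinRep_mulVec n x (contr n m u w)
  simp only [contr_spinRep] at h1
  exact h1.unique h2

lemma contr_spinMat (n m : ℕ) (a : Fin 3) (u : Fin (n + m + 1) → ℂ) (w : Fin (m + 1) → ℂ) :
    contr n m (spinMat (n + m) a *ᵥ u) w + contr n m u (spinMat m a *ᵥ w)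
      = spinMat n a *ᵥ contr n m u w := by
  have h := contr_spinAlg n m (EuclideanSpace.single a 1) u w
  simp only [spinAlg_single, Matrix.smul_mulVec, map_smul, LinearMap.smul_apply, ← smul_add] at h
  exact (smul_right_inj Complex.I_ne_zero).mp h

/-! ### The embedding of the spin tensors into the fields -/

lemma contDiff_spinRep_mulVec (m : ℕ) (v : Fin (m + 1) → ℂ) :
    ContDiff ℝ ∞ (fun M : Fin 2 → Fin 2 → ℂ => repMat m (Matrix.of M) *ᵥ v) := by
  rw [contDiff_pi]
  intro i
  simp only [Matrix.mulVec, dotProduct]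
  exact ContDiff.sum fun j _ => (contDiff_repMat m i j).mul contDiff_const

lemma isSmooth_linearMap_spinRep {m N : ℕ} (L : (Fin (m + 1) → ℂ) →ₗ[ℂ] (Fin N → ℂ))
    (v : Fin (m + 1) → ℂ) : IsSmooth (fun x => L (spinRep m x *ᵥ v)) :=
  ⟨fun M => L (repMat m (Matrix.of M) *ᵥ v),
    (L.toContinuousLinearMap.restrictScalars ℝ).contDiff.comp (contDiff_spinRep_mulVec m v),
    fun _ => rfl⟩

/-- The field `x ↦ L (R(x) v)`. -/
def linField {n m : ℕ} (L : (Fin (m + 1) → ℂ) →ₗ[ℂ] (Fin (n + 1) → ℂ)) (v : Fin (m + 1) → ℂ) :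
    Fields n := ⟨fun x => L (spinRep m x *ᵥ v), isSmooth_linearMap_spinRep L v⟩

lemma linField_apply {n m : ℕ} (L : (Fin (m + 1) → ℂ) →ₗ[ℂ] (Fin (n + 1) → ℂ))
    (v : Fin (m + 1) → ℂ) (x : SU2) : (linField L v).1 x = L (spinRep m x *ᵥ v) := rfl

lemma xiL_linField {n m : ℕ} (L : (Fin (m + 1) → ℂ) →ₗ[ℂ] (Fin (n + 1) → ℂ))
    (v : Fin (m + 1) → ℂ) (a : Fin 3) :
    xiL n a (linField L v) = linField (Complex.I • L ∘ₗ Matrix.toLin' (spinMat m a)) v := by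
  refine Subtype.ext (funext fun x => ?_)
  have h := hasDerivAt_linearMap L (hasDerivAt_spinRep_mulVec m (EuclideanSpace.single a 1)
    (spinRep m x *ᵥ v))
  simp only [Matrix.mulVec_mulVec, ← map_mul] at h
  refine h.deriv.trans ?_
  rw [spinAlg_single, linField_apply]
  simp [Matrix.smul_mulVec]

lemma xiR_linField {n m : ℕ} (L : (Fin (m + 1) → ℂ) →ₗ[ℂ] (Fin (n + 1) → ℂ))
    (v : Fin (m + 1) → ℂ) (a : Fin 3) :
    xiR n a (linField L v) = linField L ((-Complex.I) • (spinMat m a *ᵥ v)) := by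
  refine Subtype.ext (funext fun x => ?_)
  have h := hasDerivAt_linearMap (L ∘ₗ Matrix.toLin' (spinRep m x))
    (hasDerivAt_spinRep_mulVec m (-(EuclideanSpace.single a 1)) v)
  simp only [LinearMap.comp_apply, Matrix.toLin'_apply, Matrix.mulVec_mulVec, ← map_mul,
    smul_neg, ← neg_smul] at h
  refine h.deriv.trans ?_
  have hneg := spinAlg_smul m (-1) (EuclideanSpace.single a 1)
  rw [neg_one_smul, neg_one_smul, spinAlg_single] at hneg
  rw [hneg, linField_apply, ← Matrix.mulVec_mulVec]
  simp [Matrix.smul_mulVec, Matrix.neg_mulVec]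

lemma linField_add_left {n m : ℕ} (L L' : (Fin (m + 1) → ℂ) →ₗ[ℂ] (Fin (n + 1) → ℂ))
    (v : Fin (m + 1) → ℂ) : linField (L + L') v = linField L v + linField L' v := rfl

lemma linField_smul_left {n m : ℕ} (c : ℂ) (L : (Fin (m + 1) → ℂ) →ₗ[ℂ] (Fin (n + 1) → ℂ))
    (v : Fin (m + 1) → ℂ) : linField (c • L) v = c • linField L v := rfl

lemma linField_add_right {n m : ℕ} (L : (Fin (m + 1) → ℂ) →ₗ[ℂ] (Fin (n + 1) → ℂ))
    (v v' : Fin (m + 1) → ℂ) : linField L (v + v') = linField L v + linField L v' :=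
  Subtype.ext <| funext fun x => by
    change _ = L _ + L _
    rw [linField_apply, Matrix.mulVec_add, map_add]

lemma linField_smul_right {n m : ℕ} (c : ℂ) (L : (Fin (m + 1) → ℂ) →ₗ[ℂ] (Fin (n + 1) → ℂ))
    (v : Fin (m + 1) → ℂ) : linField L (c • v) = c • linField L v :=
  Subtype.ext <| funext fun x => by
    change _ = c • L _
    rw [linField_apply, Matrix.mulVec_smul, map_smul]

/-- The embedding of the tensor product of the spaces of spins `(n + m) / 2` and `m / 2` into the
fields of spin `n / 2`. -/
def emb (n m : ℕ) : SpinTensor (n + m) m →ₗ[ℂ] Fields n :=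
  TensorProduct.lift (LinearMap.mk₂ ℂ (fun u v => linField (contr n m u) v)
    (fun u u' v => by rw [map_add, linField_add_left])
    (fun c u v => by rw [map_smul, linField_smul_left])
    (fun u v v' => linField_add_right _ _ _)
    (fun c u v => linField_smul_right _ _ _))

lemma emb_tmul (n m : ℕ) (u : Fin (n + m + 1) → ℂ) (v : Fin (m + 1) → ℂ) :
    emb n m (u ⊗ₜ v) = linField (contr n m u) v := rfl

/-- By the Leibniz rule `contr_spinMat`, ρ^s(t_a) acts on both arguments of the contraction; iξ^L_a
cancels the action on the second one. -/
lemma emb_JL (n m : ℕ) (a : Fin 3) (t : SpinTensor (n + m) m) :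
    emb n m (TensorProduct.map (Matrix.toLin' (spinMat (n + m) a)) LinearMap.id t)
      = JL n a (emb n m t) := by
  induction t using TensorProduct.induction_on with
  | zero => simp
  | add x y hx hy => simp only [map_add, hx, hy]
  | tmul u v =>
    rw [TensorProduct.map_tmul, emb_tmul, emb_tmul, JL, LinearMap.add_apply, LinearMap.smul_apply,
      xiL_linField]
    refine Subtype.ext (funext fun x => ?_)
    change contr n m (spinMat (n + m) a *ᵥ u) (spinRep m x *ᵥ v)
      = Complex.I • Complex.I • contr n m u (spinMat m a *ᵥ (spinRep m x *ᵥ v))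
        + spinMat n a *ᵥ contr n m u (spinRep m x *ᵥ v)
    rw [← contr_spinMat, smul_smul, Complex.I_mul_I]
    module

lemma emb_JR (n m : ℕ) (a : Fin 3) (t : SpinTensor (n + m) m) :
    emb n m (TensorProduct.map LinearMap.id (Matrix.toLin' (spinMat m a)) t)
      = JR n a (emb n m t) := by
  induction t using TensorProduct.induction_on with
  | zero => simp
  | add x y hx hy => simp only [map_add, hx, hy]
  | tmul u v =>
    rw [TensorProduct.map_tmul, emb_tmul, emb_tmul, JR, LinearMap.smul_apply,
      xiR_linField, linField_smul_right, smul_smul]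
    simp

lemma emb_group (n m : ℕ) (g h x : SU2) (t : SpinTensor (n + m) m) :
    (emb n m (TensorProduct.map (Matrix.toLin' (spinRep (n + m) g)) (Matrix.toLin' (spinRep m h))
      t)).1 x = spinRep n g *ᵥ (emb n m t).1 (g⁻¹ * x * h) := by
  induction t using TensorProduct.induction_on with
  | zero => simp
  | add s t hs ht =>
    rw [map_add, map_add, map_add]
    change (emb n m _).1 x + (emb n m _).1 x = _ *ᵥ ((emb n m s).1 _ + (emb n m t).1 _)
    rw [hs, ht, Matrix.mulVec_add]
  | tmul u v =>
    rw [TensorProduct.map_tmul, emb_tmul, emb_tmul, linField_apply, linField_apply,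
      ← contr_spinRep, Matrix.mulVec_mulVec, Matrix.toLin'_apply, Matrix.toLin'_apply,
      Matrix.mulVec_mulVec, ← map_mul, ← map_mul]
    simp [mul_assoc]

lemma emb_injective (n m : ℕ) : Function.Injective (emb n m) := by
  rw [← LinearMap.ker_eq_bot]
  refine (spinTensor_irreducible (LinearMap.ker (emb n m)) (fun a v hv => ?_)
    (fun a v hv => ?_)).resolve_right fun h => ?_
  · rw [LinearMap.mem_ker] at hv ⊢
    rw [emb_JL, hv, map_zero]
  · rw [LinearMap.mem_ker] at hv ⊢
    rw [emb_JR, hv, map_zero]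
  -- For these two points z₀w₁ - z₁w₀ = 1, so the field has first component 1 at the identity.
  · have h1 : coh (n + m) ![1, 0] ⊗ₜ[ℂ] coh m ![0, 1] ∈ LinearMap.ker (emb n m) := by
      rw [h]; trivial
    rw [LinearMap.mem_ker, emb_tmul] at h1
    have h2 := congrFun (congrFun (congrArg Subtype.val h1) 1) 0
    rw [linField_apply, map_one, Matrix.one_mulVec, contr_coh] at h2
    simp [coh] at h2

lemma sum_JR_mul_self (n : ℕ) :
    ∑ a, JR n a * JR n a = (-1 : ℂ) • ∑ a, xiR n a * xiR n a := by
  rw [Finset.smul_sum]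
  refine Finset.sum_congr rfl fun a _ => ?_
  simp only [JR, smul_mul_assoc, mul_smul_comm, smul_smul, Complex.I_mul_I]

lemma sum_map_spinMat_left (p m : ℕ) (t : SpinTensor p m) :
    ∑ a, TensorProduct.map (Matrix.toLin' (spinMat p a)) LinearMap.id
      (TensorProduct.map (Matrix.toLin' (spinMat p a)) LinearMap.id t)
      = (((p : ℂ) / 2) * ((p : ℂ) / 2 + 1)) • t := by
  induction t using TensorProduct.induction_on with
  | zero => simp
  | add x y hx hy => simp only [map_add, Finset.sum_add_distrib, hx, hy, smul_add]
  | tmul u v =>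
    simp only [TensorProduct.map_tmul, Matrix.toLin'_apply, LinearMap.id_apply,
      Matrix.mulVec_mulVec, ← TensorProduct.sum_tmul]
    rw [← Matrix.sum_mulVec, sum_spinMat_mul_self, Matrix.smul_mulVec, Matrix.one_mulVec,
      TensorProduct.smul_tmul']

lemma sum_map_spinMat_right (p m : ℕ) (t : SpinTensor p m) :
    ∑ a, TensorProduct.map LinearMap.id (Matrix.toLin' (spinMat m a))
      (TensorProduct.map LinearMap.id (Matrix.toLin' (spinMat m a)) t)
      = (((m : ℂ) / 2) * ((m : ℂ) / 2 + 1)) • t := by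
  induction t using TensorProduct.induction_on with
  | zero => simp
  | add x y hx hy => simp only [map_add, Finset.sum_add_distrib, hx, hy, smul_add]
  | tmul u v =>
    simp only [TensorProduct.map_tmul, Matrix.toLin'_apply, LinearMap.id_apply,
      Matrix.mulVec_mulVec, ← TensorProduct.tmul_sum]
    rw [← Matrix.sum_mulVec, sum_spinMat_mul_self, Matrix.smul_mulVec, Matrix.one_mulVec,
      TensorProduct.tmul_smul]

/-- Both Casimirs are scalars on the image. The right one is the Laplace equation, and inserting
both in `casimir_eq` gives twice the first-order constraint. -/
lemma emb_mem_solutions (n m : ℕ) (t : SpinTensor (n + m) m) : emb n m t ∈ solutions n m := by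
  have hR : (∑ a, JR n a * JR n a) (emb n m t)
      = (((m : ℂ) / 2) * ((m : ℂ) / 2 + 1)) • emb n m t := by
    rw [LinearMap.sum_apply, ← map_smul, ← sum_map_spinMat_right, map_sum]
    simp only [Module.End.mul_apply, emb_JR]
  have hL : (∑ a, JL n a * JL n a) (emb n m t)
      = ((((n + m : ℕ) : ℂ) / 2) * (((n + m : ℕ) : ℂ) / 2 + 1)) • emb n m t := by
    rw [LinearMap.sum_apply, ← map_smul, ← sum_map_spinMat_left, map_sum]
    simp only [Module.End.mul_apply, emb_JL]
  refine Submodule.mem_inf.mpr ⟨?_, ?_⟩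
  · rw [casimir_eq, LinearMap.add_apply, LinearMap.add_apply, hR] at hL
    rw [LinearMap.mem_ker, constraintOp]
    simp only [LinearMap.sub_apply, LinearMap.smul_apply, Module.End.one_apply] at hL ⊢
    generalize (∑ a, xiL n a * rho n a) (emb n m t) = y at *
    have h2 : (2 : ℂ) • (Complex.I • y - ((((m : ℝ) / 2) * ((n : ℝ) / 2) : ℝ) : ℂ) • emb n m t) = 0 := by
      push_cast at hL ⊢
      linear_combination (norm := module) hL
    exact (smul_eq_zero.mp h2).resolve_left two_ne_zero
  · rw [sum_JR_mul_self, LinearMap.smul_apply] at hR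
    rw [LinearMap.mem_ker]
    change (∑ a, xiR n a * xiR n a) (emb n m t)
      + ((((m : ℝ) / 2) * ((m : ℝ) / 2 + 1) : ℝ) : ℂ) • emb n m t = 0
    push_cast
    rw [← hR, neg_smul, one_smul]
    exact add_neg_cancel _

/-! ### Harmonic analysis on `SU₂` -/

open MeasureTheory in
/-- The Haar integral of a compact group, as a functional on the continuous functions. -/
lemma exists_invariant_functional (G : Type) [Group G] [TopologicalSpace G] [IsTopologicalGroup G]
    [CompactSpace G] : ∃ I : C(G, ℂ) →L[ℂ] ℂ,
    (∀ (g : G) (f : C(G, ℂ)), I (f.comp (ContinuousMap.mulLeft g)) = I f) ∧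
    (∀ f : C(G, ℂ), I (star f * f) = 0 → f = 0) ∧
    (∀ (p : ℝ → G) (f f' h : C(G, ℂ)), p 0 = 1 →
      (∀ g r, HasDerivAt (fun s => f (p s * g)) (f' (p r * g)) r) →
      HasDerivAt (fun r => I (f.comp (ContinuousMap.mulLeft (p r)) * h)) (I (f' * h)) 0) := by
  letI : MeasurableSpace G := borel G
  haveI : BorelSpace G := ⟨rfl⟩
  let μ : Measure G := Measure.haar
  have hint (f : C(G, ℂ)) : Integrable f μ :=
    f.continuous.integrable_of_hasCompactSupport (HasCompactSupport.of_compactSpace _)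
  let I₀ : C(G, ℂ) →ₗ[ℂ] ℂ :=
    { toFun := fun f => ∫ g, f g ∂μ
      map_add' := fun f h => integral_add (hint f) (hint h)
      map_smul' := fun c f => integral_const_mul c _ }
  let I : C(G, ℂ) →L[ℂ] ℂ := I₀.mkContinuous (μ.real Set.univ) fun f => by
    rw [mul_comm]
    exact norm_integral_le_of_norm_le_const (Filter.Eventually.of_forall fun g => f.norm_coe_le_norm g)
  have hI (f : C(G, ℂ)) : I f = ∫ g, f g ∂μ := rfl
  refine ⟨I, ?_, ?_, ?_⟩
  · intro g f
    exact integral_mul_left_eq_self (μ := μ) f g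
  · intro f hf
    have h1 : ∫ g, ‖f g‖ ^ 2 ∂μ = 0 := by
      have h2 : ∫ g, ((‖f g‖ ^ 2 : ℝ) : ℂ) ∂μ = 0 := by
        rw [← hf, hI]
        refine integral_congr_ae (Filter.Eventually.of_forall fun g => ?_)
        simp [← Complex.conj_mul']
      rw [integral_complex_ofReal] at h2
      exact_mod_cast h2
    ext g
    by_contra hg
    have h3 := Continuous.integral_pos_of_hasCompactSupport_nonneg_nonzero (μ := μ)
      (f := fun g => ‖f g‖ ^ 2) (x := g) (by fun_prop) (HasCompactSupport.of_compactSpace _)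
      (fun g => by positivity) (by simpa using hg)
    exact h3.ne' h1
  · intro p f f' h hp hd
    simp only [hI]
    -- On a compact group the constant ‖f'‖ ‖h‖ dominates the derivative for all parameters.
    have := hasDerivAt_integral_of_dominated_loc_of_deriv_le (μ := μ) (x₀ := (0 : ℝ))
      (s := Set.univ) (F := fun r g => f (p r * g) * h g) (F' := fun r g => f' (p r * g) * h g)
      (bound := fun g => ‖f'‖ * ‖h‖) Filter.univ_mem
      (Filter.Eventually.of_forall fun r =>
        ((hint (f.comp (ContinuousMap.mulLeft (p r)) * h))).aestronglyMeasurable)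
      (hint (f.comp (ContinuousMap.mulLeft (p 0)) * h))
      (hint (f'.comp (ContinuousMap.mulLeft (p 0)) * h)).aestronglyMeasurable
      (Filter.Eventually.of_forall fun g r _ => by
        rw [norm_mul]
        exact mul_le_mul (f'.norm_coe_le_norm _) (h.norm_coe_le_norm _) (norm_nonneg _)
          (norm_nonneg _))
      (integrable_const _)
      (Filter.Eventually.of_forall fun g r _ => (hd g r).mul_const _)
    refine this.2.congr_deriv ?_
    simp [hp]

/-! ### Matrix coefficients on the compact group SU₂ and their density -/

instance : IsTopologicalGroup SU2 where
  continuous_mul := continuous_mul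
  continuous_inv := by
    refine Continuous.subtype_mk (f := fun g : SU2 => star (g : Matrix (Fin 2) (Fin 2) ℂ)) ?_ _
    exact continuous_subtype_val.star

instance : CompactSpace SU2 := by
  refine isCompact_iff_compactSpace.mp ?_
  refine IsCompact.of_isClosed_subset (isCompact_closedBall (0 : ℂ) 1).matrix ?_ ?_
  · have h : ((Matrix.specialUnitaryGroup (Fin 2) ℂ : Submonoid (Matrix (Fin 2) (Fin 2) ℂ)) :
        Set (Matrix (Fin 2) (Fin 2) ℂ)) = {A | A * star A = 1} ∩ {A | A.det = 1} := by
      ext A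
      rw [SetLike.mem_coe, Matrix.mem_specialUnitaryGroup_iff, Matrix.mem_unitaryGroup_iff]
      rfl
    rw [h]
    exact (isClosed_eq (by fun_prop) continuous_const).inter
      (isClosed_eq (Continuous.matrix_det continuous_id) continuous_const)
  · intro A hA i j
    simpa using entry_norm_bound_of_unitary (Matrix.mem_specialUnitaryGroup_iff.mp hA).1 i j

lemma continuous_entries : Continuous entries :=
  continuous_subtype_val

lemma IsSmooth.continuous {N : ℕ} {φ : SU2 → Fin N → ℂ} (h : IsSmooth φ) : Continuous φ := by
  obtain ⟨F, hF, h⟩ := h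
  rw [show φ = F ∘ entries from funext h]
  exact hF.continuous.comp continuous_entries

/-- A component of a field, as a continuous function. -/
def comp (n : ℕ) (q : Fin (n + 1)) : Fields n →ₗ[ℂ] C(SU2, ℂ) where
  toFun φ := ⟨fun x => φ.1 x q, (continuous_apply q).comp φ.2.continuous⟩
  map_add' _ _ := rfl
  map_smul' _ _ := rfl

lemma continuous_spinRep (m : ℕ) (a b : Fin (m + 1)) : Continuous fun x => spinRep m x a b :=
  (contDiff_repMat m a b).continuous.comp continuous_entries

/-- The matrix coefficient `x ↦ R(x)_{ab}`. -/
def matCoeff (m : ℕ) (a b : Fin (m + 1)) : C(SU2, ℂ) :=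
  ⟨fun x => spinRep m x a b, continuous_spinRep m a b⟩

/-- The matrix coefficient `x ↦ u ⬝ R(x) v`. -/
def coeffBilin (m : ℕ) : (Fin (m + 1) → ℂ) →ₗ[ℂ] (Fin (m + 1) → ℂ) →ₗ[ℂ] C(SU2, ℂ) :=
  LinearMap.mk₂ ℂ (fun u v => ⟨fun x => u ⬝ᵥ spinRep m x *ᵥ v, by
      simp only [dotProduct, Matrix.mulVec]
      have := continuous_spinRep m
      fun_prop⟩)
    (fun u u' v => by ext x; simp [add_dotProduct])
    (fun c u v => by ext x; simp [smul_dotProduct])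
    (fun u v v' => by ext x; simp [Matrix.mulVec_add, dotProduct_add])
    (fun c u v => by ext x; simp [Matrix.mulVec_smul, dotProduct_smul])

lemma coeffBilin_apply (m : ℕ) (u v : Fin (m + 1) → ℂ) (x : SU2) :
    coeffBilin m u v x = u ⬝ᵥ spinRep m x *ᵥ v := rfl

lemma coeffBilin_coh (m : ℕ) (w z : Fin 2 → ℂ) (x : SU2) :
    coeffBilin m (coh m w) (coh m z) x = (w ⬝ᵥ (x : Matrix (Fin 2) (Fin 2) ℂ) *ᵥ z) ^ m := by
  rw [coeffBilin_apply, spinRep_mulVec_coh, coh_dotProduct_coh]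

/-- The span of all matrix coefficients. -/
def coeffSpan : Submodule ℂ C(SU2, ℂ) :=
  ⨆ m : ℕ, Submodule.span ℂ (Set.range fun ab : Fin (m + 1) × Fin (m + 1) => matCoeff m ab.1 ab.2)

lemma matCoeff_mem (m : ℕ) (a b : Fin (m + 1)) : matCoeff m a b ∈ coeffSpan :=
  Submodule.mem_iSup_of_mem m (Submodule.subset_span ⟨(a, b), rfl⟩)

lemma coeffBilin_eq_sum (m : ℕ) (u v : Fin (m + 1) → ℂ) :
    coeffBilin m u v = ∑ a, ∑ b, (u a * v b) • matCoeff m a b := by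
  ext x
  simp only [coeffBilin_apply, dotProduct, Matrix.mulVec, ContinuousMap.sum_apply,
    ContinuousMap.smul_apply, smul_eq_mul, Finset.mul_sum, matCoeff, ContinuousMap.coe_mk]
  exact Finset.sum_congr rfl fun a _ => Finset.sum_congr rfl fun b _ => by ring

lemma coeffBilin_mem (m : ℕ) (u v : Fin (m + 1) → ℂ) : coeffBilin m u v ∈ coeffSpan := by
  rw [coeffBilin_eq_sum]
  exact sum_mem fun a _ => sum_mem fun b _ => Submodule.smul_mem _ _ (matCoeff_mem m a b)

lemma matCoeff_eq_coeffBilin (m : ℕ) (a b : Fin (m + 1)) :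
    matCoeff m a b = coeffBilin m (Pi.single a 1) (Pi.single b 1) := by
  ext x
  simp [coeffBilin_apply, matCoeff]

lemma exists_hasDerivAt_coh (p : ℕ) (w u : Fin 2 → ℂ) :
    ∃ β : Fin (p + 1) → ℂ, HasDerivAt (fun s : ℂ => coh p (w + s • u)) β 0 := by
  have h : DifferentiableAt ℂ (fun s : ℂ => coh p (w + s • u)) 0 := by
    rw [differentiableAt_pi]
    intro q
    simp only [coh, Pi.add_apply, Pi.smul_apply]
    fun_prop
  exact ⟨_, h.hasDerivAt⟩

/-- An entry of the group element as a continuous function. -/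
def entryFun (i j : Fin 2) : C(SU2, ℂ) :=
  ⟨fun x => entries x i j, (continuous_apply j).comp ((continuous_apply i).comp continuous_entries)⟩

/-- The Clebsch–Gordan decomposition of the product of a matrix entry with a matrix coefficient. -/
lemma linear_mul_coh_mem (m : ℕ) (w z u v : Fin 2 → ℂ) (f : C(SU2, ℂ))
    (hf : ∀ x : SU2, f x = u ⬝ᵥ (x : Matrix (Fin 2) (Fin 2) ℂ) *ᵥ v) :
    f * coeffBilin m (coh m w) (coh m z) ∈ coeffSpan := by
  obtain ⟨β, hβ⟩ := exists_hasDerivAt_coh (m + 1) w u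
  obtain ⟨γ, hγ⟩ := exists_hasDerivAt_coh (m + 1) z v
  have hlin (x : SU2) (y y' t : Fin 2 → ℂ) (s : ℂ) :
      (y + s • y') ⬝ᵥ (x : Matrix (Fin 2) (Fin 2) ℂ) *ᵥ t
        = y ⬝ᵥ (x : Matrix (Fin 2) (Fin 2) ℂ) *ᵥ t
          + s * (y' ⬝ᵥ (x : Matrix (Fin 2) (Fin 2) ℂ) *ᵥ t) := by
    rw [add_dotProduct, smul_dotProduct, smul_eq_mul]
  have hlin' (x : SU2) (y y' t : Fin 2 → ℂ) (s : ℂ) :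
      t ⬝ᵥ (x : Matrix (Fin 2) (Fin 2) ℂ) *ᵥ (y + s • y')
        = t ⬝ᵥ (x : Matrix (Fin 2) (Fin 2) ℂ) *ᵥ y
          + s * (t ⬝ᵥ (x : Matrix (Fin 2) (Fin 2) ℂ) *ᵥ y') := by
    rw [Matrix.mulVec_add, Matrix.mulVec_smul, dotProduct_add, dotProduct_smul, smul_eq_mul]
  have hd (A B : ℂ) (k : ℕ) : HasDerivAt (fun s : ℂ => (A + s * B) ^ k) (k * A ^ (k - 1) * B) 0 := by
    have h := (((hasDerivAt_id (0 : ℂ)).mul_const B).const_add A).fun_pow k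
    simpa using h
  -- Polarisation: the coherent matrix coefficient of degree m + 1 is differentiated in the
  -- direction `u` on the left, then in the direction `v` on the right.
  have h1 (x : SU2) (t : Fin 2 → ℂ) : β ⬝ᵥ spinRep (m + 1) x *ᵥ coh (m + 1) t
      = (m + 1) * (w ⬝ᵥ (x : Matrix (Fin 2) (Fin 2) ℂ) *ᵥ t) ^ m
        * (u ⬝ᵥ (x : Matrix (Fin 2) (Fin 2) ℂ) *ᵥ t) := by
    have e1 : HasDerivAt (fun s : ℂ => coh (m + 1) (w + s • u) ⬝ᵥ spinRep (m + 1) x *ᵥ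
        coh (m + 1) t) (β ⬝ᵥ spinRep (m + 1) x *ᵥ coh (m + 1) t) 0 := by
      simp only [dotProduct]
      exact HasDerivAt.fun_sum fun i _ => (hasDerivAt_pi.mp hβ i).mul_const _
    simp only [spinRep_mulVec_coh, coh_dotProduct_coh, hlin] at e1
    have e2 := e1.unique (hd _ _ _)
    rw [spinRep_mulVec_coh, e2]
    push_cast
    simp
  have h2 (x : SU2) : β ⬝ᵥ spinRep (m + 1) x *ᵥ γ
      = (m + 1) * (m * (w ⬝ᵥ (x : Matrix (Fin 2) (Fin 2) ℂ) *ᵥ z) ^ (m - 1)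
          * (w ⬝ᵥ (x : Matrix (Fin 2) (Fin 2) ℂ) *ᵥ v)
          * (u ⬝ᵥ (x : Matrix (Fin 2) (Fin 2) ℂ) *ᵥ z)
        + (w ⬝ᵥ (x : Matrix (Fin 2) (Fin 2) ℂ) *ᵥ z) ^ m
          * (u ⬝ᵥ (x : Matrix (Fin 2) (Fin 2) ℂ) *ᵥ v)) := by
    have e1 : HasDerivAt (fun s : ℂ => β ⬝ᵥ spinRep (m + 1) x *ᵥ coh (m + 1) (z + s • v))
        (β ⬝ᵥ spinRep (m + 1) x *ᵥ γ) 0 := by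
      simp only [dotProduct, Matrix.mulVec]
      exact HasDerivAt.fun_sum fun i _ => HasDerivAt.const_mul _
        (HasDerivAt.fun_sum fun j _ => (hasDerivAt_pi.mp hγ j).const_mul _)
    simp only [h1, hlin'] at e1
    have e3 : HasDerivAt (fun s : ℂ => u ⬝ᵥ (x : Matrix (Fin 2) (Fin 2) ℂ) *ᵥ z
        + s * (u ⬝ᵥ (x : Matrix (Fin 2) (Fin 2) ℂ) *ᵥ v))
        (u ⬝ᵥ (x : Matrix (Fin 2) (Fin 2) ℂ) *ᵥ v) 0 := by
      simpa using hd (u ⬝ᵥ (x : Matrix (Fin 2) (Fin 2) ℂ) *ᵥ z)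
        (u ⬝ᵥ (x : Matrix (Fin 2) (Fin 2) ℂ) *ᵥ v) 1
    have e4 := ((hd (w ⬝ᵥ (x : Matrix (Fin 2) (Fin 2) ℂ) *ᵥ z)
      (w ⬝ᵥ (x : Matrix (Fin 2) (Fin 2) ℂ) *ᵥ v) m).const_mul ((m : ℂ) + 1)).fun_mul e3
    have e2 := e1.unique e4
    rw [e2]
    simp
    ring
  set κ : ℂ := (w 0 * u 1 - w 1 * u 0) * (z 0 * v 1 - z 1 * v 0) with hκ
  -- A 2 × 2 minor is κ det x = κ. It exchanges the mixed term of the polarisation for the wanted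
  -- product and a coefficient of degree m - 1.
  have h3 (x : SU2) : (w ⬝ᵥ (x : Matrix (Fin 2) (Fin 2) ℂ) *ᵥ z)
        * (u ⬝ᵥ (x : Matrix (Fin 2) (Fin 2) ℂ) *ᵥ v)
      - (u ⬝ᵥ (x : Matrix (Fin 2) (Fin 2) ℂ) *ᵥ z)
        * (w ⬝ᵥ (x : Matrix (Fin 2) (Fin 2) ℂ) *ᵥ v) = κ := by
    have hdet : (x : Matrix (Fin 2) (Fin 2) ℂ).det = 1 :=
      (Matrix.mem_specialUnitaryGroup_iff.mp x.2).2
    rw [Matrix.det_fin_two] at hdet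
    simp only [Matrix.mulVec, dotProduct, Fin.sum_univ_two]
    linear_combination κ * hdet
  have hne : ((m : ℂ) + 1) ^ 2 ≠ 0 := pow_ne_zero _ (Nat.cast_add_one_ne_zero m)
  have key : f * coeffBilin m (coh m w) (coh m z)
      = (((m : ℂ) + 1) ^ 2)⁻¹ • (coeffBilin (m + 1) β γ
        + (((m : ℂ) + 1) * m * κ) • coeffBilin (m - 1) (coh (m - 1) w) (coh (m - 1) z)) := by
    ext x
    rw [ContinuousMap.mul_apply, ContinuousMap.smul_apply, ContinuousMap.add_apply,
      ContinuousMap.smul_apply, coeffBilin_coh, coeffBilin_coh, coeffBilin_apply, h2, hf,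
      smul_eq_mul, smul_eq_mul, eq_inv_mul_iff_mul_eq₀ hne, ← h3 x]
    rcases m with _ | m
    · simp
    · rw [Nat.add_sub_cancel]
      ring
  rw [key]
  exact Submodule.smul_mem _ _ (add_mem (coeffBilin_mem _ _ _)
    (Submodule.smul_mem _ _ (coeffBilin_mem _ _ _)))

lemma entryFun_mul_mem (i j : Fin 2) {f : C(SU2, ℂ)} (hf : f ∈ coeffSpan) :
    entryFun i j * f ∈ coeffSpan := by
  have hbil (m : ℕ) (u v : Fin (m + 1) → ℂ) : entryFun i j * coeffBilin m u v ∈ coeffSpan := by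
    have hu : u ∈ Submodule.span ℂ (Set.range (coh m)) := by rw [span_coh]; trivial
    have hv : v ∈ Submodule.span ℂ (Set.range (coh m)) := by rw [span_coh]; trivial
    induction hu using Submodule.span_induction with
    | zero => simp
    | add x y _ _ hx hy => rw [map_add, LinearMap.add_apply, mul_add]; exact add_mem hx hy
    | smul c x _ hx =>
      rw [map_smul, LinearMap.smul_apply, mul_smul_comm]; exact Submodule.smul_mem _ _ hx
    | mem x hx =>
      obtain ⟨w, rfl⟩ := hx
      induction hv using Submodule.span_induction with
      | zero => simp
      | add x y _ _ hx hy => rw [map_add, mul_add]; exact add_mem hx hy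
      | smul c x _ hx => rw [map_smul, mul_smul_comm]; exact Submodule.smul_mem _ _ hx
      | mem x hx =>
        obtain ⟨z, rfl⟩ := hx
        refine linear_mul_coh_mem m w z (Pi.single i 1) (Pi.single j 1) _ fun x => ?_
        simp [entryFun, entries]
  rw [coeffSpan] at hf
  induction hf using Submodule.iSup_induction' with
  | zero => simp
  | add x y _ _ hx hy => rw [mul_add]; exact add_mem hx hy
  | mem m f hf =>
    induction hf using Submodule.span_induction with
    | zero => simp
    | add x y _ _ hx hy => rw [mul_add]; exact add_mem hx hy
    | smul c x _ hx => rw [mul_smul_comm]; exact Submodule.smul_mem _ _ hx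
    | mem x hx =>
      obtain ⟨ab, rfl⟩ := hx
      simp only [matCoeff_eq_coeffBilin]
      exact hbil m _ _

/-- Conjugate entries are again entries up to sign, so the algebra generated by the entries is
closed under conjugation. -/
lemma star_entryFun (i j : Fin 2) : star (entryFun i j) ∈ Algebra.adjoin ℂ
    (Set.range fun ij : Fin 2 × Fin 2 => entryFun ij.1 ij.2) := by
  have hmem (i j) : entryFun i j ∈ Algebra.adjoin ℂ
      (Set.range fun ij : Fin 2 × Fin 2 => entryFun ij.1 ij.2) :=
    Algebra.subset_adjoin ⟨(i, j), rfl⟩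
  have hconj (x : SU2) : star (entries x 0 0) = entries x 1 1 ∧ star (entries x 0 1) = -entries x 1 0
      ∧ star (entries x 1 0) = -entries x 0 1 ∧ star (entries x 1 1) = entries x 0 0 := by
    obtain ⟨a, b, c, d, -, hx⟩ := SU2.exists_real_coordinates x
    have e (i j) : entries x i j = (!![(a : ℂ) + b * Complex.I, c + d * Complex.I;
        -c + d * Complex.I, a - b * Complex.I] : Matrix (Fin 2) (Fin 2) ℂ) i j := by
      rw [← hx]; rfl
    simp only [e]
    refine ⟨?_, ?_, ?_, ?_⟩ <;> simp <;> ring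
  have h00 : star (entryFun 0 0) = entryFun 1 1 := ContinuousMap.ext fun x => (hconj x).1
  have h01 : star (entryFun 0 1) = -entryFun 1 0 := ContinuousMap.ext fun x => (hconj x).2.1
  have h10 : star (entryFun 1 0) = -entryFun 0 1 := ContinuousMap.ext fun x => (hconj x).2.2.1
  have h11 : star (entryFun 1 1) = entryFun 0 0 := ContinuousMap.ext fun x => (hconj x).2.2.2
  fin_cases i <;> fin_cases j <;> simp only [Fin.zero_eta, Fin.mk_one, h00, h01, h10, h11]
  · exact hmem _ _
  · exact neg_mem (hmem _ _)
  · exact neg_mem (hmem _ _)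
  · exact hmem _ _

/-- The span of the coefficients contains 1 and is stable under multiplication by entries. -/
lemma adjoin_entryFun_le {f : C(SU2, ℂ)} (hf : f ∈ Algebra.adjoin ℂ
    (Set.range fun ij : Fin 2 × Fin 2 => entryFun ij.1 ij.2)) : f ∈ coeffSpan := by
  have h : ∀ h ∈ coeffSpan, f * h ∈ coeffSpan := by
    induction hf using Algebra.adjoin_induction with
    | mem x hx => obtain ⟨ij, rfl⟩ := hx; exact fun h hh => entryFun_mul_mem _ _ hh
    | algebraMap r =>
      intro h hh
      rw [← Algebra.smul_def]
      exact Submodule.smul_mem _ _ hh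
    | add x y _ _ hx hy => intro h hh; rw [add_mul]; exact add_mem (hx h hh) (hy h hh)
    | mul x y _ _ hx hy => intro h hh; rw [mul_assoc]; exact hx _ (hy h hh)
  have h1 : (1 : C(SU2, ℂ)) = coeffBilin 0 (coh 0 0) (coh 0 0) := by
    ext x
    rw [coeffBilin_coh]
    simp
  rw [← mul_one f, h1]
  exact h _ (coeffBilin_mem _ _ _)

/-- Stone–Weierstrass: the entries separate points. -/
lemma dense_coeffSpan : Dense (coeffSpan : Set C(SU2, ℂ)) := by
  set S : Set C(SU2, ℂ) := Set.range fun ij : Fin 2 × Fin 2 => entryFun ij.1 ij.2 with hS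
  have hA : ∀ f ∈ StarAlgebra.adjoin ℂ S, f ∈ coeffSpan := by
    intro f hf
    rw [← StarSubalgebra.mem_toSubalgebra, StarAlgebra.adjoin_toSubalgebra] at hf
    have h1 : Algebra.adjoin ℂ (S ∪ star S) ≤ Algebra.adjoin ℂ S := by
      rw [Algebra.adjoin_le_iff]
      rintro h (hh | hh)
      · exact Algebra.subset_adjoin hh
      · obtain ⟨ij, hij⟩ := hh
        rw [← star_star h, ← hij]
        exact star_entryFun _ _
    exact adjoin_entryFun_le (h1 hf)
  have hsep : (StarAlgebra.adjoin ℂ S).SeparatesPoints := by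
    intro x y hxy
    have : ∃ i j, entries x i j ≠ entries y i j := by
      by_contra! h
      exact hxy (Subtype.ext (Matrix.ext h))
    obtain ⟨i, j, hij⟩ := this
    exact ⟨_, ⟨entryFun i j, StarAlgebra.subset_adjoin ℂ S ⟨(i, j), rfl⟩, rfl⟩, hij⟩
  have htop := ContinuousMap.starSubalgebra_topologicalClosure_eq_top_of_separatesPoints _ hsep
  refine Dense.mono (s₁ := (StarAlgebra.adjoin ℂ S : Set C(SU2, ℂ))) hA ?_
  intro f
  have : f ∈ (StarAlgebra.adjoin ℂ S).topologicalClosure := by rw [htop]; trivial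
  exact this

/-! ### Eigenfields of the Laplacian -/

lemma hasDerivAt_flow {n : ℕ} (φ : Fields n) (a : Fin 3) (g : SU2) (r : ℝ) :
    HasDerivAt (fun s => φ.1 (oneParam a s * g)) (leftField a φ.1 (oneParam a r * g)) r := by
  have h := hasDerivAt_leftField φ.2 a (oneParam a r * g)
  rw [← sub_self r] at h
  have h2 := h.comp_sub_const r r
  refine h2.congr_of_eventuallyEq (Eventually.of_forall fun s => ?_)
  have h3 : oneParam a s = oneParam a (s - r) * oneParam a r := by
    rw [oneParam, oneParam, oneParam, ← su2Exp_add_smul, sub_add_cancel]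
  simp only [h3, mul_assoc]

lemma spinCasimir_injective {m j : ℕ}
    (h : ((m : ℂ) / 2) * ((m : ℂ) / 2 + 1) = ((j : ℂ) / 2) * ((j : ℂ) / 2 + 1)) : m = j := by
  have h2 : ((m * (m + 2) : ℕ) : ℂ) = ((j * (j + 2) : ℕ) : ℂ) := by
    push_cast
    linear_combination 4 * h
  have h3 : m * (m + 2) = j * (j + 2) := by exact_mod_cast h2
  nlinarith [lt_trichotomy m j]

/-- The pairings of a component of a field with the matrix coefficients of spin `j / 2`. -/
def pairMat (I : C(SU2, ℂ) →L[ℂ] ℂ) (n : ℕ) (q : Fin (n + 1)) (j : ℕ) :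
    Fields n →ₗ[ℂ] Matrix (Fin (j + 1)) (Fin (j + 1)) ℂ where
  toFun φ := Matrix.of fun a b => I (comp n q φ * matCoeff j a b)
  map_add' φ ψ := by ext a b; simp [add_mul]
  map_smul' c φ := by ext a b; simp [smul_mul_assoc]

lemma pairMat_apply (I : C(SU2, ℂ) →L[ℂ] ℂ) (n : ℕ) (q : Fin (n + 1)) (j : ℕ) (φ : Fields n)
    (a b : Fin (j + 1)) : pairMat I n q j φ a b = I (comp n q φ * matCoeff j a b) := rfl

section
variable {I : C(SU2, ℂ) →L[ℂ] ℂ}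
  (hinv : ∀ (g : SU2) (f : C(SU2, ℂ)), I (f.comp (ContinuousMap.mulLeft g)) = I f)
  (hder : ∀ (p : ℝ → SU2) (f f' h : C(SU2, ℂ)), p 0 = 1 →
      (∀ g r, HasDerivAt (fun s => f (p s * g)) (f' (p r * g)) r) →
      HasDerivAt (fun r => I (f.comp (ContinuousMap.mulLeft (p r)) * h)) (I (f' * h)) 0)

-- Integration by parts. Invariance moves the translation from the field to the matrix coefficient,
-- where it multiplies by the representation matrix of the inverse element.
include hinv hder in
lemma pairMat_xiL (n : ℕ) (q : Fin (n + 1)) (j : ℕ) (e : Fin 3) (φ : Fields n) :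
    pairMat I n q j (xiL n e φ) = -((Complex.I • spinMat j e) * pairMat I n q j φ) := by
  ext a b
  have h1 := hder (oneParam e) (comp n q φ) (comp n q (xiL n e φ)) (matCoeff j a b)
    (oneParam_zero e) (fun g r => hasDerivAt_pi.mp (hasDerivAt_flow φ e g r) q)
  have h2 (r : ℝ) : I ((comp n q φ).comp (ContinuousMap.mulLeft (oneParam e r)) * matCoeff j a b)
      = ∑ c, spinRep j (oneParam e (-r)) a c * I (comp n q φ * matCoeff j c b) := by
    have h3 : (comp n q φ).comp (ContinuousMap.mulLeft (oneParam e r)) * matCoeff j a b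
        = (∑ c, spinRep j (oneParam e (-r)) a c • (comp n q φ * matCoeff j c b)).comp
          (ContinuousMap.mulLeft (oneParam e r)) := by
      ext x
      have h4 : spinRep j x = spinRep j (oneParam e (-r)) * spinRep j (oneParam e r * x) := by
        rw [← map_mul, ← mul_assoc]
        congr 1
        have : oneParam e (-r) * oneParam e r = 1 := by
          rw [oneParam, oneParam, ← su2Exp_add_smul]
          simp [su2Exp_zero]
        rw [this, one_mul]
      simp only [ContinuousMap.mul_apply, ContinuousMap.comp_apply, ContinuousMap.sum_apply,
        ContinuousMap.smul_apply, ContinuousMap.coe_mulLeft, smul_eq_mul]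
      change _ * spinRep j x a b = _
      rw [h4, Matrix.mul_apply, Finset.mul_sum]
      refine Finset.sum_congr rfl fun c _ => ?_
      change _ = _ * (_ * spinRep j (oneParam e r * x) c b)
      ring
    rw [h3, hinv, map_sum]
    simp only [map_smul, smul_eq_mul]
  simp only [h2] at h1
  have h5 (c : Fin (j + 1)) : HasDerivAt (fun r : ℝ => spinRep j (oneParam e (-r)) a c)
      (-(Complex.I • spinMat j e) a c) 0 := by
    have h6 := hasDerivAt_spinRep j (-(EuclideanSpace.single e 1)) a c
    have hneg := spinAlg_smul j (-1) (EuclideanSpace.single e 1)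
    rw [neg_one_smul, neg_one_smul, spinAlg_single] at hneg
    rw [hneg] at h6
    simp only [smul_neg, ← neg_smul] at h6
    exact h6.congr_deriv (by simp)
  rw [pairMat_apply]
  refine h1.unique ((HasDerivAt.fun_sum fun c _ => (h5 c).mul_const _).congr_deriv ?_)
  rw [Matrix.neg_apply, Matrix.mul_apply, ← Finset.sum_neg_distrib]
  simp only [neg_mul]
  rfl

-- The Laplacian acts on the pairings as the negative Casimir of spin `j / 2` and on the field as
-- that of spin `m / 2`; these values differ.
include hinv hder in
lemma pairMat_eq_zero {n m j : ℕ} (hj : j ≠ m) (q : Fin (n + 1)) {φ : Fields n}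
    (hφ : laplaceOp n ((m : ℝ) / 2) φ = 0) : pairMat I n q j φ = 0 := by
  have h1 : (∑ a, xiR n a * xiR n a) φ = -((((m : ℂ) / 2) * ((m : ℂ) / 2 + 1)) • φ) := by
    have h2 : (∑ a, xiR n a * xiR n a) φ
      + ((((m : ℝ) / 2) * ((m : ℝ) / 2 + 1) : ℝ) : ℂ) • φ = 0 := hφ
    push_cast at h2
    exact eq_neg_of_add_eq_zero_left h2
  rw [← sum_xiL_mul_self, LinearMap.sum_apply] at h1
  have h2 := congrArg (pairMat I n q j) h1
  simp only [map_sum, Module.End.mul_apply, pairMat_xiL hinv hder, map_neg, map_smul,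
    mul_neg, neg_neg, ← mul_assoc, ← Finset.sum_mul] at h2
  have h3 : ∑ a, (Complex.I • spinMat j a) * (Complex.I • spinMat j a)
      = -((((j : ℂ) / 2) * ((j : ℂ) / 2 + 1)) • 1) := by
    rw [← sum_spinMat_mul_self, ← Finset.sum_neg_distrib]
    refine Finset.sum_congr rfl fun a _ => ?_
    rw [smul_mul_assoc, mul_smul_comm, smul_smul, Complex.I_mul_I, neg_one_smul]
  rw [h3, neg_mul, smul_mul_assoc, one_mul, neg_inj, ← sub_eq_zero, ← sub_smul] at h2
  refine (smul_eq_zero.mp h2).resolve_left fun h => hj ?_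
  exact spinCasimir_injective (sub_eq_zero.mp h)

end

lemma laplaceOp_linField {n m : ℕ} (L : (Fin (m + 1) → ℂ) →ₗ[ℂ] (Fin (n + 1) → ℂ))
    (v : Fin (m + 1) → ℂ) : laplaceOp n ((m : ℝ) / 2) (linField L v) = 0 := by
  change (∑ a, xiR n a * xiR n a) (linField L v)
      + ((((m : ℝ) / 2) * ((m : ℝ) / 2 + 1) : ℝ) : ℂ) • linField L v = 0
  rw [LinearMap.sum_apply]
  simp only [Module.End.mul_apply, xiR_linField, map_smul, Matrix.mulVec_smul, smul_smul,
    Matrix.mulVec_mulVec, linField_smul_right]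
  rw [← Finset.smul_sum]
  have h : ∑ a, linField L ((spinMat m a * spinMat m a) *ᵥ v)
      = (((m : ℂ) / 2) * ((m : ℂ) / 2 + 1)) • linField L v := by
    have h1 : ∑ a, (spinMat m a * spinMat m a) *ᵥ v = (((m : ℂ) / 2) * ((m : ℂ) / 2 + 1)) • v := by
      rw [← Matrix.sum_mulVec, sum_spinMat_mul_self, Matrix.smul_mulVec, Matrix.one_mulVec]
    rw [← linField_smul_right, ← h1, Fin.sum_univ_three, Fin.sum_univ_three, linField_add_right,
      linField_add_right]
  rw [h, smul_smul, ← add_smul]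
  convert zero_smul ℂ _
  push_cast
  linear_combination (((m : ℂ) / 2) * ((m : ℂ) / 2 + 1)) * Complex.I_mul_I

/-- The combination of the matrix coefficients of spin `m / 2` with given coefficients. -/
def coeffMap (m : ℕ) : Matrix (Fin (m + 1)) (Fin (m + 1)) ℂ →ₗ[ℂ] C(SU2, ℂ) where
  toFun A := ∑ a, ∑ b, A a b • matCoeff m a b
  map_add' A B := by simp [add_smul, Finset.sum_add_distrib]
  map_smul' c A := by simp [smul_smul, Finset.smul_sum]

lemma coeffMap_apply (m : ℕ) (A : Matrix (Fin (m + 1)) (Fin (m + 1)) ℂ) (x : SU2) :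
    coeffMap m A x = ∑ a, ∑ b, A a b * spinRep m x a b := by
  simp [coeffMap, matCoeff]

lemma coeffMap_single (m : ℕ) (a b : Fin (m + 1)) :
    coeffMap m (Matrix.single a b 1) = matCoeff m a b := by
  ext x
  rw [coeffMap_apply, Finset.sum_eq_single a, Finset.sum_eq_single b]
  · simp [matCoeff]
  · intro c _ hc; simp [Ne.symm hc]
  · simp
  · intro c _ hc; simp [Ne.symm hc]
  · simp

/-- Every eigenfield of the Laplacian is a combination of matrix coefficients. -/
lemma eigenfield_eq_coeffMap {n m : ℕ} {φ : Fields n} (hφ : laplaceOp n ((m : ℝ) / 2) φ = 0)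
    (q : Fin (n + 1)) : ∃ A, comp n q φ = coeffMap m A := by
  obtain ⟨I, hinv, hfaith, hder⟩ := exists_invariant_functional SU2
  -- By density the pairing of `f` with its own conjugate vanishes.
  have hzero (f : C(SU2, ℂ)) (hf : ∀ j a b, I (f * matCoeff j a b) = 0) : f = 0 := by
    refine hfaith f ?_
    have h1 : ∀ h ∈ coeffSpan, I (f * h) = 0 := by
      intro h hh
      rw [coeffSpan] at hh
      induction hh using Submodule.iSup_induction' with
      | zero => simp
      | add x y _ _ hx hy => rw [mul_add, map_add, hx, hy, add_zero]
      | mem j h hh =>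
        induction hh using Submodule.span_induction with
        | zero => simp
        | add x y _ _ hx hy => rw [mul_add, map_add, hx, hy, add_zero]
        | smul c x _ hx => rw [mul_smul_comm, map_smul, hx, smul_zero]
        | mem x hx => obtain ⟨ab, rfl⟩ := hx; exact hf j _ _
    have h2 : (fun h : C(SU2, ℂ) => I (f * h)) = fun _ => 0 :=
      Continuous.ext_on dense_coeffSpan (by fun_prop) continuous_const h1
    rw [mul_comm]
    exact congrFun h2 (star f)
  have horth (A : Matrix (Fin (m + 1)) (Fin (m + 1)) ℂ) {j : ℕ} (hj : j ≠ m) (c d : Fin (j + 1)) :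
      I (coeffMap m A * matCoeff j c d) = 0 := by
    have h1 (a b : Fin (m + 1)) : I (matCoeff m a b * matCoeff j c d) = 0 := by
      -- A matrix coefficient is itself an eigenfield of spin zero.
      have h2 := pairMat_eq_zero (I := I) hinv hder hj 0 (laplaceOp_linField (n := 0)
        (LinearMap.pi fun _ => LinearMap.proj a) (Pi.single b (1 : ℂ) : Fin (m + 1) → ℂ))
      have h3 := congrFun (congrFun h2 c) d
      rw [pairMat_apply] at h3
      have h4 : comp 0 0 (linField (n := 0)
          (LinearMap.pi fun _ => LinearMap.proj a) (Pi.single b (1 : ℂ) : Fin (m + 1) → ℂ))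
          = matCoeff m a b := by
        ext x
        change (spinRep m x *ᵥ Pi.single b 1) a = spinRep m x a b
        simp
      rw [h4] at h3
      exact h3
    simp only [coeffMap, LinearMap.coe_mk, AddHom.coe_mk, Finset.sum_mul, map_sum, smul_mul_assoc,
      map_smul, h1]
    simp
  let M := LinearMap.range (coeffMap m)
  haveI : FiniteDimensional ℂ M := inferInstance
  let B : M →ₗ[ℂ] Module.Dual ℂ M :=
    LinearMap.mk₂ ℂ (fun h h' => I (h.1 * h'.1))
      (fun a b c => by simp [add_mul]) (fun a b c => by simp) (fun a b c => by simp [mul_add])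
      (fun a b c => by simp)
  -- The pairing on the span `M` of the coefficients of one spin is nondegenerate: an element
  -- orthogonal to `M` is orthogonal to all coefficients.
  have hB : Function.Injective B := by
    rw [← LinearMap.ker_eq_bot, LinearMap.ker_eq_bot']
    rintro ⟨_, A, rfl⟩ hA
    refine Subtype.ext (hzero _ fun j a b => ?_)
    by_cases hj : j = m
    · subst hj
      exact LinearMap.congr_fun hA ⟨matCoeff j a b, Matrix.single a b 1, coeffMap_single j a b⟩
    · exact horth A hj a b
  have hBs : Function.Surjective B :=
    (LinearMap.injective_iff_surjective_of_finrank_eq_finrank Subspace.dual_finrank_eq.symm).mp hB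
  -- The element of `M` representing this functional is the projection of the component; the
  -- difference pairs to zero with every matrix coefficient.
  let ℓ : Module.Dual ℂ M :=
    { toFun := fun h => I (comp n q φ * h.1)
      map_add' := fun a b => by simp [mul_add]
      map_smul' := fun c a => by simp }
  obtain ⟨⟨_, A, rfl⟩, hA⟩ := hBs ℓ
  refine ⟨A, sub_eq_zero.mp (hzero _ fun j a b => ?_)⟩
  rw [sub_mul, map_sub, sub_eq_zero]
  by_cases hj : j = m
  · subst hj
    exact (LinearMap.congr_fun hA ⟨matCoeff j a b, Matrix.single a b 1, coeffMap_single j a b⟩).symm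
  · rw [horth A hj a b]
    exact congrFun (congrFun (pairMat_eq_zero (I := I) hinv hder hj q hφ) a) b

section
open scoped Matrix.Norms.Operator

/-- The matrix coefficients of an irreducible representation are linearly independent. -/
lemma coeffMap_injective (m : ℕ) : Function.Injective (coeffMap m) := by
  rw [← LinearMap.ker_eq_bot, LinearMap.ker_eq_bot']
  intro A hA
  let Λ : Matrix (Fin (m + 1)) (Fin (m + 1)) ℂ →ₗ[ℂ] ℂ :=
    { toFun := fun X => ∑ a, ∑ b, A a b * X a b
      map_add' := fun X Y => by simp [mul_add, Finset.sum_add_distrib]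
      map_smul' := fun c X => by
        simp only [Matrix.smul_apply, smul_eq_mul, Finset.mul_sum, RingHom.id_apply]
        exact Finset.sum_congr rfl fun _ _ => Finset.sum_congr rfl fun _ _ => by ring }
  -- Differentiating at the identity shows that the relation survives right multiplication of `X` by
  -- `spinMat m a`, hence by any matrix; matrix units then give the entries of `A`.
  have hstep (Y : Matrix (Fin (m + 1)) (Fin (m + 1)) ℂ) : ∀ X : Matrix (Fin (m + 1)) (Fin (m + 1)) ℂ,
      (∀ x, Λ (X * spinRep m x) = 0) → ∀ x, Λ (X * Y * spinRep m x) = 0 := by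
    have hY : Y ∈ Algebra.adjoin ℂ (Set.range (spinMat m)) := by rw [adjoin_spinMat]; trivial
    induction hY using Algebra.adjoin_induction with
    | mem Y hY =>
      obtain ⟨a, rfl⟩ := hY
      intro X hX x
      have h1 := hasDerivAt_matrix (hasDerivAt_spinRep m (EuclideanSpace.single a 1))
      have h2 := ((Λ ∘ₗ LinearMap.mulLeft ℂ X ∘ₗ LinearMap.mulRight ℂ
        (spinRep m x)).toContinuousLinearMap.restrictScalars ℝ).hasFDerivAt.comp_hasDerivAt (0 : ℝ) h1
      have h3 : HasDerivAt (fun _ : ℝ => (0 : ℂ)) (Λ (X * (spinAlg m (EuclideanSpace.single a 1)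
          * spinRep m x))) 0 := by
        refine h2.congr_of_eventuallyEq (Eventually.of_forall fun r => ?_)
        have := hX (su2Exp (r • EuclideanSpace.single a 1) * x)
        rw [(spinRep m).map_mul] at this
        exact this.symm
      have h4 := h3.unique (hasDerivAt_const _ _)
      rw [spinAlg_single, smul_mul_assoc, mul_smul_comm, map_smul, ← mul_assoc] at h4
      exact (smul_eq_zero.mp h4).resolve_left Complex.I_ne_zero
    | algebraMap r =>
      intro X hX x
      rw [Algebra.algebraMap_eq_smul_one, mul_smul_comm, mul_one, smul_mul_assoc, map_smul, hX,
        smul_zero]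
    | add Y Z _ _ hY hZ =>
      intro X hX x
      rw [mul_add, add_mul, map_add, hY X hX, hZ X hX, add_zero]
    | mul Y Z _ _ hY hZ =>
      intro X hX x
      rw [← mul_assoc]
      exact hZ _ (hY X hX) x
  ext a b
  have h1 := hstep (Matrix.single a b 1) 1 (fun x => by
    rw [one_mul]
    have := congrArg (fun f : C(SU2, ℂ) => f x) hA
    change ∑ a, ∑ b, A a b * spinRep m x a b = 0
    simpa [coeffMap_apply] using this) 1
  rw [one_mul, map_one, mul_one] at h1
  change ∑ c, ∑ d, A c d * Matrix.single a b 1 c d = 0 at h1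
  rw [Finset.sum_eq_single a, Finset.sum_eq_single b] at h1
  · simpa using h1
  · intro c _ hc; simp [Ne.symm hc]
  · simp
  · intro c _ hc; simp [Ne.symm hc]
  · simp

end

/-! ### The dimension of the solution space -/

/-- The field with the value `∑_b T_b R(x) e_b` at `x`. -/
def twistField (n m : ℕ) :
    (Fin (m + 1) → Matrix (Fin (n + 1)) (Fin (m + 1)) ℂ) →ₗ[ℂ] Fields n where
  toFun T := ∑ b, linField (Matrix.toLin' (T b)) (Pi.single b (1 : ℂ) : Fin (m + 1) → ℂ)
  map_add' S T := by
    simp only [Pi.add_apply, map_add, linField_add_left, Finset.sum_add_distrib]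
  map_smul' c T := by
    simp only [Pi.smul_apply, map_smul, linField_smul_left, Finset.smul_sum, RingHom.id_apply]

lemma twistField_apply (n m : ℕ) (T : Fin (m + 1) → Matrix (Fin (n + 1)) (Fin (m + 1)) ℂ)
    (q : Fin (n + 1)) :
    comp n q (twistField n m T) = coeffMap m (Matrix.of fun a b => T b q a) := by
  ext x
  rw [coeffMap_apply, Finset.sum_comm]
  have h : comp n q (twistField n m T) x = (twistField n m T).1 x q := rfl
  rw [h, twistField]
  simp only [LinearMap.coe_mk, AddHom.coe_mk, Submodule.coe_sum, Finset.sum_apply, linField_apply]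
  refine Finset.sum_congr rfl fun b _ => ?_
  simp [Matrix.mulVec, dotProduct]

lemma twistField_injective (n m : ℕ) : Function.Injective (twistField n m) := by
  intro S T h
  ext b q a
  have h1 := congrArg (comp n q) h
  rw [twistField_apply, twistField_apply] at h1
  exact congrFun (congrFun (coeffMap_injective m h1) a) b

lemma constraintOp_twistField (n m : ℕ)
    (T : Fin (m + 1) → Matrix (Fin (n + 1)) (Fin (m + 1)) ℂ) :
    constraintOp n ((m : ℝ) / 2) (twistField n m T) = twistField n m
      (fun b => -(∑ c, spinMat n c * T b * spinMat m c) - ((n : ℂ) * m / 4) • T b) := by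
  have h1 (c : Fin 3) (L : Matrix (Fin (n + 1)) (Fin (m + 1)) ℂ) (v : Fin (m + 1) → ℂ) :
      (xiL n c * rho n c) (linField (Matrix.toLin' L) v)
        = Complex.I • linField (Matrix.toLin' (spinMat n c * L * spinMat m c)) v := by
    have h2 : rho n c (linField (Matrix.toLin' L) v)
        = linField (Matrix.toLin' (spinMat n c * L)) v := by
      refine Subtype.ext (funext fun x => ?_)
      change spinMat n c *ᵥ (L *ᵥ _) = (spinMat n c * L) *ᵥ _
      rw [Matrix.mulVec_mulVec]
    rw [Module.End.mul_apply, h2, xiL_linField, linField_smul_left, ← Matrix.toLin'_mul]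
  have h3 : constraintOp n ((m : ℝ) / 2) (twistField n m T)
      = Complex.I • (∑ c, xiL n c * rho n c) (twistField n m T)
        - ((((m : ℝ) / 2) * ((n : ℝ) / 2) : ℝ) : ℂ) • twistField n m T := rfl
  have h4 : (∑ c, xiL n c * rho n c) (twistField n m T)
      = Complex.I • twistField n m (fun b => ∑ c, spinMat n c * T b * spinMat m c) := by
    rw [LinearMap.sum_apply]
    have h5 (c : Fin 3) : (xiL n c * rho n c) (twistField n m T)
        = Complex.I • twistField n m (fun b => spinMat n c * T b * spinMat m c) := by
      simp only [twistField, LinearMap.coe_mk, AddHom.coe_mk, map_sum, h1, Finset.smul_sum]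
    simp only [h5]
    rw [← Finset.smul_sum, ← map_sum]
    congr 2
  rw [h3, h4, smul_smul, Complex.I_mul_I, ← map_smul, ← map_smul, ← map_sub]
  congr 1
  ext b q a
  simp only [Pi.sub_apply, Pi.smul_apply, Matrix.sub_apply, Matrix.smul_apply, Matrix.neg_apply,
    smul_eq_mul]
  push_cast
  ring

/-- The Laplace equation provides the matrices T_b, and linear independence of the matrix
coefficients lets the constraint be imposed on each T_b separately. -/
lemma solutions_le_map (n m : ℕ) : solutions n m ≤
    LinearMap.range (twistField n m ∘ₗ (LinearMap.pi fun b =>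
      (twistSpace n m).subtype ∘ₗ LinearMap.proj (φ := fun _ : Fin (m + 1) => twistSpace n m) b)) := by
  intro φ hφ
  obtain ⟨h1, h2⟩ := Submodule.mem_inf.mp hφ
  rw [LinearMap.mem_ker] at h1 h2
  choose A hA using eigenfield_eq_coeffMap h2
  let T : Fin (m + 1) → Matrix (Fin (n + 1)) (Fin (m + 1)) ℂ := fun b => Matrix.of fun q a => A q a b
  have hT : φ = twistField n m T := by
    refine Subtype.ext (funext fun x => funext fun q => ?_)
    have h3 := congrArg (fun f : C(SU2, ℂ) => f x) ((hA q).trans (twistField_apply n m T q).symm)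
    exact h3
  rw [hT, constraintOp_twistField] at h1
  have h4 := twistField_injective n m (h1.trans (map_zero _).symm)
  refine ⟨fun b => ⟨T b, ?_⟩, hT.symm⟩
  have h5 := congrFun h4 b
  simp only [Pi.zero_apply] at h5
  change ∑ c, spinMat n c * T b * spinMat m c = (-((n : ℂ) * m / 4)) • T b
  rw [neg_smul, ← sub_eq_zero, sub_neg_eq_add, ← neg_eq_zero, ← h5]
  abel

lemma finiteDimensional_solutions (n m : ℕ) : FiniteDimensional ℂ (solutions n m) :=
  Submodule.finiteDimensional_of_le (solutions_le_map n m)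

lemma finrank_solutions_le (n m : ℕ) :
    Module.finrank ℂ (solutions n m) ≤ (n + m + 1) * (m + 1) := by
  refine (Submodule.finrank_mono (solutions_le_map n m)).trans
    ((LinearMap.finrank_range_le _).trans ?_)
  rw [Module.finrank_pi_fintype]
  simp only [Finset.sum_const, Finset.card_univ, Fintype.card_fin, smul_eq_mul]
  rw [mul_comm]
  exact Nat.mul_le_mul_right _ (finrank_twistSpace_le n m)

/-! ### The solution space as a representation -/

/-- The injective image already has the largest dimension that `finrank_solutions_le` permits. -/
lemma range_emb (n m : ℕ) : LinearMap.range (emb n m) = solutions n m := by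
  haveI := finiteDimensional_solutions n m
  refine Submodule.eq_of_le_of_finrank_le ?_ ?_
  · rintro _ ⟨t, rfl⟩
    exact emb_mem_solutions n m t
  · rw [LinearMap.finrank_range_of_inj (emb_injective n m), Module.finrank_tensorProduct]
    simpa using finrank_solutions_le n m

/-- The isomorphism of the representation of spins `(s + k, k)` with the solution space. -/
def solEquiv (n m : ℕ) : SpinTensor (n + m) m ≃ₗ[ℂ] solutions n m :=
  (LinearEquiv.ofInjective (emb n m) (emb_injective n m)).trans
    (LinearEquiv.ofEq _ _ (range_emb n m))

lemma finrank_solutions (n m : ℕ) :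
    Module.finrank ℂ (solutions n m) = (n + m + 1) * (m + 1) := by
  rw [← (solEquiv n m).finrank_eq, Module.finrank_tensorProduct]
  simp

lemma solutions_ne_bot (n m : ℕ) : solutions n m ≠ ⊥ := by
  intro h
  have h1 := finrank_solutions n m
  rw [h, finrank_bot] at h1
  exact absurd h1.symm (by positivity)

lemma isIrrep_solutions (n m : ℕ) : IsIrrep n (solutions n m) := by
  refine ⟨fun a => ⟨fun φ hφ => ?_, fun φ hφ => ?_⟩, solutions_ne_bot n m, fun U hU hinv => ?_⟩
  · rw [← range_emb] at hφ ⊢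
    obtain ⟨t, rfl⟩ := hφ
    exact ⟨_, emb_JL n m a t⟩
  · rw [← range_emb] at hφ ⊢
    obtain ⟨t, rfl⟩ := hφ
    exact ⟨_, emb_JR n m a t⟩
  · have hU' : U = (U.comap (emb n m)).map (emb n m) := by
      rw [Submodule.map_comap_eq, range_emb, inf_eq_right.mpr hU]
    rcases spinTensor_irreducible (U.comap (emb n m))
      (fun a t ht => by
        rw [Submodule.mem_comap, emb_JL]
        exact (hinv a).1 _ ht)
      (fun a t ht => by
        rw [Submodule.mem_comap, emb_JR]
        exact (hinv a).2 _ ht) with h | h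
    · left; rw [hU', h, Submodule.map_bot]
    · right; rw [hU', h, Submodule.map_top, range_emb]

/-- The tensor product of two spin representations of `SU₂`, as a representation of
`SU₂ × SU₂`. -/
def tensorRep (p m : ℕ) : Representation ℂ (SU2 × SU2) (SpinTensor p m) where
  toFun g := TensorProduct.map (Matrix.toLin' (spinRep p g.1)) (Matrix.toLin' (spinRep m g.2))
  map_one' := by
    simp
    rfl
  map_mul' g h := by
    rw [Prod.fst_mul, Prod.snd_mul, (spinRep p).map_mul, (spinRep m).map_mul, Matrix.toLin'_mul, Matrix.toLin'_mul,
      TensorProduct.map_comp]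
    rfl

/-- The action of `SU₂ × SU₂` on the solution space. -/
def solRep (n m : ℕ) : Representation ℂ (SU2 × SU2) (solutions n m) :=
  ((solEquiv n m).conjAlgEquiv ℂ).toAlgHom.toMonoidHom.comp (tensorRep (n + m) m)

lemma solRep_solEquiv (n m : ℕ) (g : SU2 × SU2) (t : SpinTensor (n + m) m) :
    solRep n m g (solEquiv n m t) = solEquiv n m (tensorRep (n + m) m g t) := by
  change solEquiv n m (tensorRep (n + m) m g ((solEquiv n m).symm (solEquiv n m t))) = _
  rw [LinearEquiv.symm_apply_apply]

lemma solRep_apply (n m : ℕ) (g h x : SU2) (φ : solutions n m) :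
    (solRep n m (g, h) φ).1.1 x = spinRep n g *ᵥ φ.1.1 (g⁻¹ * x * h) := by
  obtain ⟨t, rfl⟩ := (solEquiv n m).surjective φ
  rw [solRep_solEquiv]
  exact emb_group n m g h x t

/-- A linear functional that vanishes on the matrices of an irreducible representation is zero. -/
lemma linearMap_eq_zero_of_spinRep {p : ℕ} (Λ : Matrix (Fin (p + 1)) (Fin (p + 1)) ℂ →ₗ[ℂ] ℂ)
    (h : ∀ g, Λ (spinRep p g) = 0) : Λ = 0 := by
  have h1 (X : Matrix (Fin (p + 1)) (Fin (p + 1)) ℂ) :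
      Λ X = ∑ a, ∑ b, Λ (Matrix.single a b 1) * X a b := by
    conv_lhs => rw [Matrix.matrix_eq_sum_single X]
    simp only [map_sum]
    refine Finset.sum_congr rfl fun a _ => Finset.sum_congr rfl fun b _ => ?_
    rw [mul_comm, ← smul_eq_mul, ← map_smul, Matrix.smul_single, smul_eq_mul, mul_one]
  have h2 : (Matrix.of fun a b => Λ (Matrix.single a b 1)) = 0 := by
    refine coeffMap_injective p ?_
    ext x
    rw [coeffMap_apply, map_zero]
    exact (h1 _).symm.trans (h x)
  ext X
  rw [h1]
  simp only [LinearMap.zero_apply]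
  refine Finset.sum_eq_zero fun a _ => Finset.sum_eq_zero fun b _ => ?_
  have := congrFun (congrFun h2 a) b
  simp only [Matrix.of_apply, Matrix.zero_apply] at this
  rw [this, zero_mul]

/-- By duality this says that the group matrices span all matrices. It transfers invariance from the
group to the spin matrices. -/
lemma mem_of_spinRep {p : ℕ} {V : Type*} [AddCommGroup V] [Module ℂ V]
    (U : Submodule ℂ V) (Φ : Matrix (Fin (p + 1)) (Fin (p + 1)) ℂ →ₗ[ℂ] V)
    (h : ∀ g, Φ (spinRep p g) ∈ U) (X : Matrix (Fin (p + 1)) (Fin (p + 1)) ℂ) : Φ X ∈ U := by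
  rw [← Subspace.forall_mem_dualAnnihilator_apply_eq_zero_iff]
  intro f hf
  exact LinearMap.congr_fun (linearMap_eq_zero_of_spinRep (f ∘ₗ Φ) fun g =>
    (Submodule.mem_dualAnnihilator f).mp hf _ (h g)) X

lemma tensorRep_irreducible {p m : ℕ} (U : Submodule ℂ (SpinTensor p m))
    (h : ∀ g, ∀ t ∈ U, tensorRep p m g t ∈ U) : U = ⊥ ∨ U = ⊤ := by
  refine spinTensor_irreducible U (fun a t ht => ?_) (fun a t ht => ?_)
  · refine mem_of_spinRep U ((LinearMap.applyₗ t) ∘ₗ ((TensorProduct.mapBilinear (RingHom.id ℂ)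
      (Fin (p + 1) → ℂ) (Fin (m + 1) → ℂ) (Fin (p + 1) → ℂ) (Fin (m + 1) → ℂ)).flip
        LinearMap.id) ∘ₗ (Matrix.toLin' : _ ≃ₗ[ℂ] _).toLinearMap) (fun g => ?_) (spinMat p a)
    have := h (g, 1) t ht
    simpa [tensorRep] using this
  · refine mem_of_spinRep U ((LinearMap.applyₗ t) ∘ₗ ((TensorProduct.mapBilinear (RingHom.id ℂ)
      (Fin (p + 1) → ℂ) (Fin (m + 1) → ℂ) (Fin (p + 1) → ℂ) (Fin (m + 1) → ℂ))
        LinearMap.id) ∘ₗ (Matrix.toLin' : _ ≃ₗ[ℂ] _).toLinearMap) (fun g => ?_) (spinMat m a)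
    have := h (1, g) t ht
    simpa [tensorRep] using this

lemma isIrreducible_solRep (n m : ℕ) :
    Representation.IsIrreducible (G := SU2 × SU2) (k := ℂ) (V := solutions n m) (solRep n m) := by
  haveI : Nontrivial (Subrepresentation (solRep n m)) := by
    refine ⟨⊥, ⊤, fun h => solutions_ne_bot n m ?_⟩
    have h1 := congrArg Subrepresentation.toSubmodule h
    have h2 : (⊥ : Submodule ℂ (solutions n m)) = ⊤ := h1
    rw [eq_bot_iff]
    intro φ hφ
    have h3 : (⟨φ, hφ⟩ : solutions n m) ∈ (⊥ : Submodule ℂ (solutions n m)) := by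
      rw [h2]; trivial
    exact congrArg Subtype.val ((Submodule.mem_bot ℂ).mp h3)
  refine ⟨fun W => ?_⟩
  have h1 : W.toSubmodule = (W.toSubmodule.comap (solEquiv n m).toLinearMap).map
      (solEquiv n m).toLinearMap := by
    rw [Submodule.map_comap_eq_of_surjective (solEquiv n m).surjective]
  rcases tensorRep_irreducible (W.toSubmodule.comap (solEquiv n m).toLinearMap) (fun g t ht => by
    rw [Submodule.mem_comap] at ht ⊢
    have := W.apply_mem_toSubmodule g ht
    rwa [LinearEquiv.coe_coe, solRep_solEquiv] at this) with h | h
  · left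
    refine Subrepresentation.toSubmodule_injective ?_
    rw [h1, h, Submodule.map_bot]
    rfl
  · right
    refine Subrepresentation.toSubmodule_injective ?_
    rw [h1, h, Submodule.map_top, LinearEquiv.range]
    rfl

/-! ### Spins one half and one -/

section
variable {V : Type*} [AddCommGroup V] [Module ℂ V] {H X Y : Module.End ℂ V}

/-- For an sl₂ triple the operator matrix D = ((H, Y), (X, -H)) satisfies D² + D = Casimir, and the
hypotheses say D = k on (v, w). -/
lemma casimir_of_pair (hX : ∀ v, H (X v) = X (H v) + X v) (hY : ∀ v, H (Y v) = Y (H v) - Y v)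
    (hXY : ∀ v, X (Y v) = Y (X v) + (2 : ℂ) • H v) {k : ℂ} {v w : V}
    (h1 : H v + Y w = k • v) (h2 : X v - H w = k • w) :
    (H (H v) + (1 / 2 : ℂ) • (X (Y v) + Y (X v)) = (k * (k + 1)) • v) ∧
    (H (H w) + (1 / 2 : ℂ) • (X (Y w) + Y (X w)) = (k * (k + 1)) • w) := by
  have hH1 := congrArg H h1
  have hH2 := congrArg H h2
  have hX1 := congrArg X h1
  have hY2 := congrArg Y h2
  simp only [map_add, map_sub, map_smul] at hH1 hH2 hX1 hY2
  constructor
  · linear_combination (norm := module) (1 / 2 : ℂ) • hXY v + hY2 + (k + 1) • h1 + hH1 - hY w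
  · linear_combination (norm := module) -(1 / 2 : ℂ) • hXY w + hX1 + (k + 1) • h2 - hH2 + hX v

/-- Applying X, -H and -Y to the three equations and adding gives (k + 1)(2Hv + Yw - Xu) = 0. With k
+ 1 cancelled, the middle equation splits, so (u, v) and (v, w) each satisfy the system of
`casimir_of_pair`. -/
lemma casimir_of_triple (hX : ∀ v, H (X v) = X (H v) + X v) (hY : ∀ v, H (Y v) = Y (H v) - Y v)
    (hXY : ∀ v, X (Y v) = Y (X v) + (2 : ℂ) • H v) {k : ℂ} (hk : k + 1 ≠ 0) {u v w : V}
    (h1 : H u + Y v = k • u) (h2 : X u + Y w = (2 * k) • v) (h3 : X v - H w = k • w) :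
    (H v + Y w = k • v) ∧ (X u - H v = k • v) := by
  have hX1 := congrArg X h1
  have hH2 := congrArg H h2
  have hY3 := congrArg Y h3
  simp only [map_add, map_sub, map_smul] at hX1 hH2 hY3
  have hD : (k + 1) • ((2 : ℂ) • H v + Y w - X u) = 0 := by
    linear_combination (norm := module) hX1 - hH2 - hY3 + hX u + hY w - hXY v
  have hD' := (smul_eq_zero.mp hD).resolve_left hk
  constructor
  · linear_combination (norm := module) (1 / 2 : ℂ) • (h2 + hD')
  · linear_combination (norm := module) (1 / 2 : ℂ) • (h2 - hD')

end

/-- `i ξ^L_3`. -/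
def opH (n : ℕ) : Module.End ℂ (Fields n) := Complex.I • xiL n 2

/-- The raising operator `i ξ^L_1 - ξ^L_2`. -/
def opX (n : ℕ) : Module.End ℂ (Fields n) := Complex.I • xiL n 0 - xiL n 1

/-- The lowering operator `i ξ^L_1 + ξ^L_2`. -/
def opY (n : ℕ) : Module.End ℂ (Fields n) := Complex.I • xiL n 0 + xiL n 1

lemma xiL_commutator_cyclic (n : ℕ) (φ : Fields n) :
    (xiL n 0 (xiL n 1 φ) - xiL n 1 (xiL n 0 φ) = xiL n 2 φ) ∧
    (xiL n 1 (xiL n 2 φ) - xiL n 2 (xiL n 1 φ) = xiL n 0 φ) ∧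
    (xiL n 2 (xiL n 0 φ) - xiL n 0 (xiL n 2 φ) = xiL n 1 φ) := by
  have h (a b) := LinearMap.congr_fun (xiL_commutator n a b) φ
  refine ⟨(h 0 1).trans ?_, (h 1 2).trans ?_, (h 2 0).trans ?_⟩ <;>
    simp [Fin.sum_univ_three, eps, Matrix.det_fin_three]

lemma opH_opX (n : ℕ) (φ : Fields n) : opH n (opX n φ) = opX n (opH n φ) + opX n φ := by
  obtain ⟨h1, h2, h3⟩ := xiL_commutator_cyclic n φ
  simp only [opH, opX, LinearMap.smul_apply, LinearMap.sub_apply, map_sub, map_smul]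
  linear_combination (norm := skip) (Complex.I * Complex.I) • h3 + Complex.I • h2
  match_scalars <;> simp

lemma opH_opY (n : ℕ) (φ : Fields n) : opH n (opY n φ) = opY n (opH n φ) - opY n φ := by
  obtain ⟨h1, h2, h3⟩ := xiL_commutator_cyclic n φ
  simp only [opH, opY, LinearMap.smul_apply, LinearMap.add_apply, map_add, map_smul]
  linear_combination (norm := skip) (Complex.I * Complex.I) • h3 - Complex.I • h2
  match_scalars <;> simp

lemma opX_opY (n : ℕ) (φ : Fields n) :
    opX n (opY n φ) = opY n (opX n φ) + (2 : ℂ) • opH n φ := by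
  obtain ⟨h1, h2, h3⟩ := xiL_commutator_cyclic n φ
  simp only [opH, opX, opY, LinearMap.smul_apply, LinearMap.add_apply, LinearMap.sub_apply, map_add,
    map_sub, map_smul]
  linear_combination (norm := skip) (2 * Complex.I) • h1
  match_scalars <;> simp <;> ring

lemma sum_xiR_mul_self_apply (n : ℕ) (φ : Fields n) : (∑ a, xiR n a * xiR n a) φ
    = -(opH n (opH n φ) + (1 / 2 : ℂ) • (opX n (opY n φ) + opY n (opX n φ))) := by
  rw [← sum_xiL_mul_self, Fin.sum_univ_three]
  simp only [opH, opX, opY, LinearMap.smul_apply, LinearMap.add_apply, LinearMap.sub_apply, map_add,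
    map_sub, map_smul, Module.End.mul_apply]
  match_scalars <;> ring_nf <;> simp

/-- The component with index `q` of a field, placed in the first slot. -/
def slot (n : ℕ) (q : Fin (n + 1)) : Module.End ℂ (Fields n) := matOp n (Matrix.single 0 q 1)

lemma slot_matOp (n : ℕ) (q : Fin (n + 1)) (A : Matrix (Fin (n + 1)) (Fin (n + 1)) ℂ)
    (φ : Fields n) : slot n q (matOp n A φ) = ∑ p, A q p • slot n p φ := by
  rw [slot, ← Module.End.mul_apply, ← map_mul]
  have : Matrix.single 0 q 1 * A = ∑ p, A q p • Matrix.single (0 : Fin (n + 1)) p (1 : ℂ) := by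
    ext i j
    by_cases hi : i = 0
    · subst hi
      simp [Matrix.sum_apply, Matrix.single_apply]
    · simp [Matrix.sum_apply, Matrix.single_apply, Ne.symm hi, hi]
  rw [this, map_sum, LinearMap.sum_apply]
  simp only [map_smul]
  rfl

lemma eq_zero_of_slot {n : ℕ} {φ : Fields n} (h : ∀ q, slot n q φ = 0) : φ = 0 := by
  refine Subtype.ext (funext fun g => funext fun q => ?_)
  have h1 := congrFun (congrFun (congrArg Subtype.val (h q)) g) 0
  rw [slot, matOp_apply] at h1
  simpa [Matrix.single_mulVec] using h1

lemma slot_xiL (n : ℕ) (q : Fin (n + 1)) (a : Fin 3) (φ : Fields n) :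
    slot n q (xiL n a φ) = xiL n a (slot n q φ) :=
  (LinearMap.congr_fun (xiL_matOp n a (Matrix.single 0 q 1)) φ).symm

lemma slot_xiR (n : ℕ) (q : Fin (n + 1)) (a : Fin 3) (φ : Fields n) :
    slot n q (xiR n a φ) = xiR n a (slot n q φ) :=
  (LinearMap.congr_fun (xiR_matOp n a (Matrix.single 0 q 1)) φ).symm

/-- The first-order constraint in components. -/
lemma constraint_row {n : ℕ} {k : ℝ} {φ : Fields n} (h : constraintOp n k φ = 0)
    (q : Fin (n + 1)) : ∑ p, (spinMat n 2 q p • opH n (slot n p φ)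
      + (raising n q p / 2) • opY n (slot n p φ) + (raising n p q / 2) • opX n (slot n p φ))
      = ((k : ℂ) * ((n : ℂ) / 2)) • slot n q φ := by
  have h1 : Complex.I • (∑ a, xiL n a * rho n a) φ - ((k * ((n : ℝ) / 2) : ℝ) : ℂ) • φ = 0 := h
  have h2 := congrArg (slot n q) (sub_eq_zero.mp h1)
  rw [LinearMap.sum_apply, map_smul, map_sum, map_smul] at h2
  simp only [Module.End.mul_apply, slot_xiL, rho_eq_matOp, slot_matOp, map_sum, map_smul] at h2
  rw [Finset.sum_comm, Finset.smul_sum] at h2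
  push_cast at h2
  rw [← h2]
  refine Finset.sum_congr rfl fun p _ => ?_
  have h3 : (raising n)ᴴ q p = raising n p q := by rw [raising_conjTranspose]; rfl
  simp only [opH, opX, opY, Fin.sum_univ_three, spinMat_zero, spinMat_one, Matrix.smul_apply,
    Matrix.add_apply, Matrix.sub_apply, LinearMap.smul_apply, LinearMap.add_apply,
    LinearMap.sub_apply, h3, smul_eq_mul]
  match_scalars <;> ring_nf <;> (try rw [Complex.I_sq]) <;> (try ring)

lemma laplace_of_slot {n : ℕ} {k : ℝ} {φ : Fields n}
    (h : ∀ q, opH n (opH n (slot n q φ)) + (1 / 2 : ℂ) • (opX n (opY n (slot n q φ))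
      + opY n (opX n (slot n q φ))) = ((k : ℂ) * (k + 1)) • slot n q φ) :
    laplaceOp n k φ = 0 := by
  refine eq_zero_of_slot fun q => ?_
  have h1 : laplaceOp n k φ = (∑ a, xiR n a * xiR n a) φ + ((k * (k + 1) : ℝ) : ℂ) • φ := rfl
  have h2 : slot n q ((∑ a, xiR n a * xiR n a) φ) = (∑ a, xiR n a * xiR n a) (slot n q φ) := by
    simp only [LinearMap.sum_apply, map_sum, Module.End.mul_apply, slot_xiR]
  rw [h1, map_add, map_smul, h2, sum_xiR_mul_self_apply, h q]
  push_cast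
  exact neg_add_cancel _

lemma laplace_of_constraint_one {k : ℝ} {φ : Fields 1} (h : constraintOp 1 k φ = 0) :
    laplaceOp 1 k φ = 0 := by
  have h0 := constraint_row h 0
  have h1 := constraint_row h 1
  simp [Fin.sum_univ_two, spinMat, raising_apply] at h0 h1
  obtain ⟨c0, c1⟩ := casimir_of_pair (opH_opX 1) (opH_opY 1) (opX_opY 1) (k := (k : ℂ))
    (v := slot 1 0 φ) (w := slot 1 1 φ)
    (by linear_combination (norm := module) (2 : ℂ) • h0)
    (by linear_combination (norm := module) (2 : ℂ) • h1)
  refine laplace_of_slot fun q => ?_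
  fin_cases q
  · exact c0
  · exact c1

/-- Nonnegativity of `k` serves only to make `k + 1` invertible. -/
lemma laplace_of_constraint_two {k : ℝ} (hk : 0 ≤ k) {φ : Fields 2} (h : constraintOp 2 k φ = 0) :
    laplaceOp 2 k φ = 0 := by
  have h0 := constraint_row h 0
  have h1 := constraint_row h 1
  have h2 := constraint_row h 2
  simp [Fin.sum_univ_three, spinMat, raising_apply] at h0 h1 h2
  have hs : (Real.sqrt 2 : ℂ) * Real.sqrt 2 = 2 := by
    rw [← Complex.ofReal_mul, Real.mul_self_sqrt (by norm_num)]
    norm_num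
  have hk' : (k : ℂ) + 1 ≠ 0 := by
    have : k + 1 ≠ 0 := by positivity
    exact_mod_cast this
  -- Rescaling the middle component removes the factors √2 of the spin-one ladder matrices.
  set χ := ((Real.sqrt 2 : ℂ) / 2) • slot 2 1 φ with hχ
  have hφ : slot 2 1 φ = (Real.sqrt 2 : ℂ) • χ := by
    rw [hχ, smul_smul, mul_div_assoc', hs, div_self two_ne_zero, one_smul]
  rw [← map_smul, ← hχ] at h0 h2
  have h1' := congrArg (fun v => (Real.sqrt 2 : ℂ) • v) h1
  simp only [smul_add, smul_smul, mul_div_assoc', hs, div_self (two_ne_zero (α := ℂ)), one_smul,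
    hφ] at h1'
  rw [mul_comm, mul_assoc, hs, mul_comm] at h1'
  obtain ⟨h4, h5⟩ := casimir_of_triple (opH_opX 2) (opH_opY 2) (opX_opY 2) hk' h0 h1'
    (by linear_combination (norm := module) h2)
  obtain ⟨c0, c1⟩ := casimir_of_pair (opH_opX 2) (opH_opY 2) (opX_opY 2) h0 h5
  obtain ⟨-, c2⟩ := casimir_of_pair (opH_opX 2) (opH_opY 2) (opX_opY 2) h4
    (by linear_combination (norm := module) h2)
  refine laplace_of_slot fun q => ?_
  fin_cases q
  · exact c0
  · change opH 2 (opH 2 (slot 2 1 φ)) + (1 / 2 : ℂ) • (opX 2 (opY 2 (slot 2 1 φ))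
      + opY 2 (opX 2 (slot 2 1 φ))) = ((k : ℂ) * (k + 1)) • slot 2 1 φ
    have := congrArg (fun v => (Real.sqrt 2 : ℂ) • v) c1
    simp only [hφ, map_smul]
    linear_combination (norm := module) this
  · exact c2

/-! ### The flat limit -/

lemma su2_entries_symm (g : SU2) :
    entries g 1 1 = (starRingEnd ℂ) (entries g 0 0) ∧
    entries g 1 0 = -(starRingEnd ℂ) (entries g 0 1) := by
  obtain ⟨hu, hd⟩ := Matrix.mem_specialUnitaryGroup_iff.mp g.2
  have h1 : (g : Matrix (Fin 2) (Fin 2) ℂ).adjugate = star (g : Matrix (Fin 2) (Fin 2) ℂ) := by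
    have h2 := Matrix.mem_unitaryGroup_iff.mp hu
    have h3 := Matrix.adjugate_mul (g : Matrix (Fin 2) (Fin 2) ℂ)
    rw [hd, one_smul] at h3
    calc _ = (g : Matrix (Fin 2) (Fin 2) ℂ).adjugate
          * ((g : Matrix (Fin 2) (Fin 2) ℂ) * star (g : Matrix (Fin 2) (Fin 2) ℂ)) := by
            rw [h2, mul_one]
      _ = _ := by rw [← mul_assoc, h3, one_mul]
  rw [Matrix.adjugate_fin_two] at h1
  constructor
  · exact congrFun (congrFun h1 0) 0
  · have := congrFun (congrFun h1 1) 0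
    exact neg_eq_iff_eq_neg.mp this

/-- The coordinates of an antihermitian traceless matrix in the basis `i t_a`. -/
def algCoord : (Fin 2 → Fin 2 → ℂ) →ₗ[ℝ] E3 where
  toFun M := !₂[2 * (M 0 1).im, 2 * (M 0 1).re, 2 * (M 0 0).im]
  map_add' M N := by ext i; fin_cases i <;> simp <;> ring
  map_smul' c M := by ext i; fin_cases i <;> simp <;> ring

lemma algMat_algCoord {M : Fin 2 → Fin 2 → ℂ} (h0 : (M 0 0).re = 0)
    (h1 : M 1 1 = (starRingEnd ℂ) (M 0 0)) (h2 : M 1 0 = -(starRingEnd ℂ) (M 0 1)) :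
    algMat (algCoord M) = Matrix.of M := by
  ext i j
  fin_cases i <;> fin_cases j <;>
    simp [algMat, algCoord, tGen, Fin.sum_univ_three, h1, h2, Complex.ext_iff, h0] <;> (try constructor) <;> ring

lemma algCoord_algMat (x : E3) : algCoord (algMat x) = x := by
  ext i
  fin_cases i <;> simp [algMat, algCoord, tGen, Fin.sum_univ_three] <;> ring

section
open scoped Matrix.Norms.Operator

lemma contDiff_entries_su2Exp : ContDiff ℝ ∞ fun x : E3 => entries (su2Exp x) := by
  have h1 : ContDiff ℝ ∞ (NormedSpace.exp : Matrix (Fin 2) (Fin 2) ℂ → Matrix (Fin 2) (Fin 2) ℂ) :=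
    contDiff_iff_contDiffAt.mpr fun x => (NormedSpace.exp_analytic (𝕂 := ℝ) x).contDiffAt
  have h2 : ContDiff ℝ ∞ algMat :=
    (LinearMap.toContinuousLinearMap
      { toFun := algMat, map_add' := algMat_add, map_smul' := algMat_smul } :
        E3 →L[ℝ] Matrix (Fin 2) (Fin 2) ℂ).contDiff
  rw [contDiff_pi]
  intro i
  rw [contDiff_pi]
  intro j
  exact ((Matrix.entryLinearMap ℝ ℂ i j).toContinuousLinearMap).contDiff.comp (h1.comp h2)

end

lemma fderiv_entries_su2Exp_zero (w : E3) :
    fderiv ℝ (fun x : E3 => entries (su2Exp x)) 0 w = algMat w := by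
  have h1 : HasFDerivAt (fun x : E3 => entries (su2Exp x))
      (fderiv ℝ (fun x : E3 => entries (su2Exp x)) 0) ((0 : ℝ) • w) := by
    rw [zero_smul]
    exact ((contDiff_entries_su2Exp.differentiable (by simp)) 0).hasFDerivAt
  have h2 := h1.comp_hasDerivAt (0 : ℝ) ((hasDerivAt_id (0 : ℝ)).smul_const w)
  rw [one_smul] at h2
  ext i j
  have h3 := hasDerivAt_pi.mp (hasDerivAt_pi.mp h2 i) j
  have h4 := hasDerivAt_exp_smul_apply (algMat w) i j
  refine h3.unique (h4.congr_of_eventuallyEq (Eventually.of_forall fun r => ?_))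
  simp only [Function.comp_apply, id, entries, coe_su2Exp, algMat_smul]

/-- The right logarithmic derivative of the exponential map. -/
def logDeriv (y w : E3) : Fin 2 → Fin 2 → ℂ := fun i j =>
  ∑ l, fderiv ℝ (fun x : E3 => entries (su2Exp x)) y w i l * (starRingEnd ℂ) (entries (su2Exp y) j l)

lemma logDeriv_mul (y w : E3) (i j : Fin 2) :
    ∑ l, logDeriv y w i l * entries (su2Exp y) l j
      = fderiv ℝ (fun x : E3 => entries (su2Exp x)) y w i j := by
  have h1 : star (su2Exp y : Matrix (Fin 2) (Fin 2) ℂ) * (su2Exp y : Matrix (Fin 2) (Fin 2) ℂ) = 1 :=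
    Matrix.mem_unitaryGroup_iff'.mp (Matrix.mem_specialUnitaryGroup_iff.mp (su2Exp y).2).1
  have h2 (k : Fin 2) : ∑ l, (starRingEnd ℂ) (entries (su2Exp y) l k) * entries (su2Exp y) l j
      = if k = j then 1 else 0 := congrFun (congrFun h1 k) j
  have h3 (l : Fin 2) : logDeriv y w i l * entries (su2Exp y) l j
      = ∑ k, fderiv ℝ (fun x : E3 => entries (su2Exp x)) y w i k
        * ((starRingEnd ℂ) (entries (su2Exp y) l k) * entries (su2Exp y) l j) := by
    simp only [logDeriv, Finset.sum_mul, mul_assoc]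
  simp only [h3]
  rw [Finset.sum_comm]
  simp only [← Finset.mul_sum, h2]
  simp

/-- The logarithmic derivative lies in the Lie algebra: the conjugation relations between the
entries and the unit norm of the first row are differentiated along the line `y + r w`. -/
lemma algMat_algCoord_logDeriv (y w : E3) :
    algMat (algCoord (logDeriv y w)) = Matrix.of (logDeriv y w) := by
  set D := fderiv ℝ (fun x : E3 => entries (su2Exp x)) y w with hD
  have h1 : HasFDerivAt (fun x : E3 => entries (su2Exp x))
      (fderiv ℝ (fun x : E3 => entries (su2Exp x)) y) (y + (0 : ℝ) • w) := by
    rw [zero_smul, add_zero]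
    exact ((contDiff_entries_su2Exp.differentiable (by simp)) y).hasFDerivAt
  have h2 := h1.comp_hasDerivAt (0 : ℝ) (((hasDerivAt_id (0 : ℝ)).smul_const w).const_add y)
  rw [one_smul, ← hD] at h2
  have h3 (i j : Fin 2) : HasDerivAt (fun r : ℝ => entries (su2Exp (y + r • w)) i j) (D i j) 0 :=
    hasDerivAt_pi.mp (hasDerivAt_pi.mp h2 i) j
  have h4 (i j : Fin 2) : HasDerivAt (fun r : ℝ => (starRingEnd ℂ) (entries (su2Exp (y + r • w)) i j))
      ((starRingEnd ℂ) (D i j)) 0 := (h3 i j).star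
  have e11 : D 1 1 = (starRingEnd ℂ) (D 0 0) :=
    (h3 1 1).unique ((h4 0 0).congr_of_eventuallyEq
      (Eventually.of_forall fun r => (su2_entries_symm _).1))
  have e10 : D 1 0 = -(starRingEnd ℂ) (D 0 1) :=
    (h3 1 0).unique ((h4 0 1).neg.congr_of_eventuallyEq
      (Eventually.of_forall fun r => (su2_entries_symm _).2))
  have h5 := ((h3 0 0).mul (h4 0 0)).add ((h3 0 1).mul (h4 0 1))
  have h6 := h5.unique ((hasDerivAt_const (0 : ℝ) (1 : ℂ)).congr_of_eventuallyEq
    (Eventually.of_forall fun r => by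
      have hu := Matrix.mem_unitaryGroup_iff.mp
        (Matrix.mem_specialUnitaryGroup_iff.mp (su2Exp (y + r • w)).2).1
      have := congrFun (congrFun hu 0) 0
      rw [Matrix.mul_apply, Fin.sum_univ_two] at this
      exact this))
  rw [zero_smul, add_zero] at h6
  obtain ⟨g11, g10⟩ := su2_entries_symm (su2Exp y)
  have hX (i j : Fin 2) : logDeriv y w i j = D i 0 * (starRingEnd ℂ) (entries (su2Exp y) j 0)
      + D i 1 * (starRingEnd ℂ) (entries (su2Exp y) j 1) := Fin.sum_univ_two _
  refine algMat_algCoord ?_ ?_ ?_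
  · have h7 := congrArg Complex.re h6
    rw [hX]
    simp at h7 ⊢
    linarith
  · rw [hX, hX, e11, e10, g11, g10]
    simp
    ring
  · rw [hX, hX, e11, e10, g11, g10]
    simp

/-- The logarithmic derivative of the exponential map in coordinates. -/
def logDerivCoord (y : E3) : E3 →L[ℝ] E3 :=
  LinearMap.toContinuousLinearMap
    { toFun := fun w => algCoord (logDeriv y w)
      map_add' := fun v w => by
        rw [← map_add]
        congr 1
        ext i j
        simp [logDeriv, add_mul, Finset.sum_add_distrib]
      map_smul' := fun c w => by
        rw [RingHom.id_apply, ← map_smul]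
        congr 1
        ext i j
        simp only [logDeriv, map_smul, Pi.smul_apply, smul_mul_assoc, Finset.smul_sum] }

lemma continuous_logDerivCoord : Continuous logDerivCoord := by
  rw [continuous_clm_apply]
  intro w
  refine algCoord.continuous_of_finiteDimensional.comp ?_
  have h1 : Continuous fun y => fderiv ℝ (fun x : E3 => entries (su2Exp x)) y w :=
    (contDiff_entries_su2Exp.continuous_fderiv (by simp)).clm_apply continuous_const
  have h2 : Continuous fun y : E3 => entries (su2Exp y) := contDiff_entries_su2Exp.continuous
  rw [continuous_pi_iff]
  intro i
  rw [continuous_pi_iff]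
  intro j
  refine continuous_finsetSum _ fun l _ => ?_
  exact ((continuous_apply_apply i l).comp h1).mul
    (Complex.continuous_conj.comp ((continuous_apply_apply j l).comp h2))

lemma logDerivCoord_zero : logDerivCoord 0 = 1 := by
  ext1 w
  change algCoord (logDeriv 0 w) = w
  have : logDeriv 0 w = algMat w := by
    ext i j
    simp [logDeriv, fderiv_entries_su2Exp_zero, su2Exp_zero, entries, Matrix.one_apply]
  rw [this, algCoord_algMat]

/-- The coordinate vector of the left-generated field at `e^{i y_a t_a}`, for small `y`. -/
def leftVec (a : Fin 3) (y : E3) : E3 :=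
  -- `Ring.inverse` is zero off the units; near the origin `logDerivCoord y` is a unit, as it is the
  -- identity at 0.
  Ring.inverse (logDerivCoord y) (EuclideanSpace.single a (1 : ℝ))

lemma tendsto_leftVec (a : Fin 3) :
    Tendsto (leftVec a) (𝓝 0) (𝓝 (EuclideanSpace.single a (1 : ℝ))) := by
  have h1 : Tendsto logDerivCoord (𝓝 0) (𝓝 ((1 : (E3 →L[ℝ] E3)ˣ) : E3 →L[ℝ] E3)) := by
    rw [Units.val_one, ← logDerivCoord_zero]
    exact continuous_logDerivCoord.tendsto 0
  have h2 := (NormedRing.inverse_continuousAt (1 : (E3 →L[ℝ] E3)ˣ)).tendsto.comp h1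
  rw [Units.val_one, Ring.inverse_one] at h2
  exact (isBoundedBilinearMap_apply.continuous.tendsto _).comp (h2.prodMk_nhds tendsto_const_nhds)

lemma eventually_fderiv_leftVec (a : Fin 3) : ∀ᶠ y in 𝓝 (0 : E3),
    fderiv ℝ (fun x : E3 => entries (su2Exp x)) y (leftVec a y)
      = leftGen a (entries (su2Exp y)) := by
  have h1 : ∀ᶠ y in 𝓝 (0 : E3), IsUnit (logDerivCoord y) := by
    refine continuous_logDerivCoord.continuousAt.eventually_mem (Units.isOpen.mem_nhds ?_)
    rw [logDerivCoord_zero]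
    exact isUnit_one
  filter_upwards [h1] with y hy
  have h2 : algCoord (logDeriv y (leftVec a y)) = EuclideanSpace.single a (1 : ℝ) :=
    congrArg (fun T : E3 →L[ℝ] E3 => T (EuclideanSpace.single a (1 : ℝ)))
      (Ring.mul_inverse_cancel _ hy)
  have h3 := algMat_algCoord_logDeriv y (leftVec a y)
  have h4 := algMat_single a 1
  rw [one_smul, one_smul] at h4
  rw [h2, h4] at h3
  ext i j
  rw [← logDeriv_mul, leftGen_apply, h3]
  rfl

lemma fderiv_pullback {n : ℕ} (r : ℝ) (φ : Fields n) {F : (Fin 2 → Fin 2 → ℂ) → Fin (n + 1) → ℂ}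
    (hF : ContDiff ℝ ∞ F) (h : ∀ g, φ.1 g = F (entries g)) (x v : E3) :
    fderiv ℝ (pullback r φ) x v = r • fderiv ℝ F (entries (su2Exp (r • x)))
      (fderiv ℝ (fun x : E3 => entries (su2Exp x)) (r • x) v) := by
  have h1 : pullback r φ = F ∘ (fun x : E3 => entries (su2Exp x)) ∘ fun x => r • x :=
    funext fun x => h _
  have h2 := (contDiff_entries_su2Exp.differentiable (by simp) (r • x)).hasFDerivAt
  have h3 := (hF.differentiable (by simp) (entries (su2Exp (r • x)))).hasFDerivAt
  have h4 : HasFDerivAt (fun x : E3 => r • x) (r • ContinuousLinearMap.id ℝ E3) x :=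
    (hasFDerivAt_id x).const_smul r
  rw [h1, (h3.comp x (h2.comp x h4)).fderiv]
  simp

/-- The neighbourhood does not depend on the field or the scale, so the formula can be used along a
sequence of varying fields. -/
lemma eventually_fderiv_pullback (a : Fin 3) : ∀ᶠ y in 𝓝 (0 : E3),
    ∀ (n : ℕ) (φ : Fields n) (r : ℝ) (x : E3), r • x = y →
      fderiv ℝ (pullback r φ) x (leftVec a y) = r • (xiL n a φ).1 (su2Exp y) := by
  filter_upwards [eventually_fderiv_leftVec a] with y hy n φ r x hx
  obtain ⟨F, hF, h⟩ := φ.2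
  rw [fderiv_pullback r φ hF h, hx, hy, ← leftField_eq_fderiv hF h]
  rfl

lemma coe_constraintOp (n : ℕ) (k : ℝ) (φ : Fields n) (g : SU2) : (constraintOp n k φ).1 g
    = Complex.I • ∑ a, spinMat n a *ᵥ (xiL n a φ).1 g - ((k * ((n : ℝ) / 2) : ℝ) : ℂ) • φ.1 g := by
  have h1 : (constraintOp n k φ).1 g = Complex.I • ((∑ a, xiL n a * rho n a) φ).1 g
    - ((k * ((n : ℝ) / 2) : ℝ) : ℂ) • φ.1 g := rfl
  have h2 (a : Fin 3) : xiL n a * rho n a = rho n a * xiL n a := xiL_matOp n a _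
  rw [h1]
  simp only [h2, LinearMap.sum_apply, Submodule.coe_sum, Finset.sum_apply]
  rfl

lemma tendsto_constraintOp (n : ℕ) (μ : ℝ) (r k : ℕ → ℝ) (hr : Tendsto r atTop (𝓝 0))
    (hk : ∀ j, r j * k j = μ) (φ : ℕ → Fields n) (f : E3 → Fin (n + 1) → ℂ) (x : E3)
    (h0 : Tendsto (fun j => pullback (r j) (φ j) x) atTop (𝓝 (f x)))
    (h1 : Tendsto (fun j => fderiv ℝ (pullback (r j) (φ j)) x) atTop (𝓝 (fderiv ℝ f x))) :
    Tendsto (fun j => ((r j : ℝ) : ℂ) • pullback (r j) (constraintOp n (k j) (φ j)) x)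
      atTop (𝓝 (flatOp n μ f x)) := by
  have h2 : Tendsto (fun j => r j • x) atTop (𝓝 0) := by
    simpa using hr.smul_const x
  have h3 (a : Fin 3) : Tendsto (fun j => r j • (xiL n a (φ j)).1 (su2Exp (r j • x))) atTop
      (𝓝 (fderiv ℝ f x (EuclideanSpace.single a (1 : ℝ)))) := by
    -- At fixed `x` the derivatives and the direction vectors both converge, and evaluation is
    -- jointly continuous; pointwise convergence is enough.
    have h4 := (isBoundedBilinearMap_apply.continuous.tendsto _).comp
      (h1.prodMk_nhds ((tendsto_leftVec a).comp h2))
    refine h4.congr' ?_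
    filter_upwards [h2.eventually (eventually_fderiv_pullback a)] with j hj
    exact hj n (φ j) (r j) x rfl
  have h5 (a : Fin 3) : Tendsto (fun j => spinMat n a *ᵥ (r j • (xiL n a (φ j)).1
      (su2Exp (r j • x)))) atTop
      (𝓝 (spinMat n a *ᵥ (fderiv ℝ f x (EuclideanSpace.single a (1 : ℝ))))) :=
    ((continuous_const.matrix_mulVec continuous_id).tendsto _).comp (h3 a)
  have h6 := ((tendsto_finsetSum Finset.univ fun a _ => h5 a).const_smul Complex.I).sub
    (h0.const_smul ((μ * ((n : ℝ) / 2) : ℝ) : ℂ))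
  refine h6.congr fun j => ?_
  change _ = ((r j : ℝ) : ℂ) • (constraintOp n (k j) (φ j)).1 (su2Exp (r j • x))
  have h7 (v : Fin (n + 1) → ℂ) : r j • v = ((r j : ℝ) : ℂ) • v := rfl
  rw [coe_constraintOp, ← hk j, smul_sub, smul_comm ((r j : ℝ) : ℂ) Complex.I,
    mul_assoc, Complex.ofReal_mul, mul_smul]
  simp only [h7, Matrix.mulVec_smul, ← Finset.smul_sum]
  rfl

lemma flatOp_eq_zero (n : ℕ) (μ : ℝ) (r k : ℕ → ℝ) (φ : ℕ → Fields n)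
    (f : E3 → Fin (n + 1) → ℂ) (x : E3) (h : Tendsto (fun j => ((r j : ℝ) : ℂ) •
      pullback (r j) (constraintOp n (k j) (φ j)) x) atTop (𝓝 (flatOp n μ f x)))
    (h0 : ∀ j, constraintOp n (k j) (φ j) = 0) : flatOp n μ f x = 0 := by
  refine tendsto_nhds_unique h (tendsto_const_nhds.congr fun j => ?_)
  rw [h0 j]
  exact (smul_zero _).symm

end SU2Wave

end

open SU2Wave in
theorem mainTheorem5 :
    -- `J^L`, `J^R` represent `su₂ ⊕ su₂` on the fields of spin `s = n / 2`, and the two Casimirs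
    -- differ by the first-order operator
    (∀ n : ℕ,
      (∀ a b, ⁅JL n a, JL n b⁆ = Complex.I • ∑ c, eps a b c • JL n c) ∧
      (∀ a b, ⁅JR n a, JR n b⁆ = Complex.I • ∑ c, eps a b c • JR n c) ∧
      (∀ a b, ⁅JL n a, JR n b⁆ = 0) ∧
      ∑ a, JL n a * JL n a = ∑ a, JR n a * JR n a
        + (2 * Complex.I) • ∑ a, xiL n a * rho n a
        + ((((n : ℝ) / 2) * ((n : ℝ) / 2 + 1) : ℝ) : ℂ) • 1) ∧
    -- the solution space with `s = n / 2`, `k = m / 2` is the irreducible representation of spins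
    -- `(s + k, k)`, of the Lie algebra and of the group `SU₂ × SU₂`
    (∃ R : ∀ p : ℕ, SU2 →* Matrix (Fin (p + 1)) (Fin (p + 1)) ℂ,
      (∀ (p : ℕ) (x : E3), R p (su2Exp x)
        = NormedSpace.exp (Complex.I • ∑ a, ((x a : ℝ) : ℂ) • spinMat p a)) ∧
      ∀ n m : ℕ,
        IsIrrep n (solutions n m) ∧
        Module.finrank ℂ (solutions n m) = (n + m + 1) * (m + 1) ∧
        ∃ P : Representation ℂ (SU2 × SU2) (solutions n m),
          (∀ (g h x : SU2) (φ : solutions n m),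
            (P (g, h) φ).1.1 x = R n g *ᵥ φ.1.1 (g⁻¹ * x * h)) ∧
          Representation.IsIrreducible (G := SU2 × SU2) (k := ℂ) (V := solutions n m) P ∧
          ∃ e : SpinTensor (n + m) m ≃ₗ[ℂ] solutions n m,
            (∀ a v, ((e (TensorProduct.map (Matrix.toLin' (spinMat (n + m) a)) LinearMap.id v) :
              solutions n m) : Fields n) = JL n a (e v)) ∧
            (∀ a v, ((e (TensorProduct.map LinearMap.id (Matrix.toLin' (spinMat m a)) v) :
              solutions n m) : Fields n) = JR n a (e v)) ∧
            (∀ g h v, e (TensorProduct.map (Matrix.toLin' (R (n + m) g)) (Matrix.toLin' (R m h)) v)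
              = P (g, h) (e v))) ∧
    -- for `s = 1/2` and `s = 1` the first-order constraint implies the second-order equation
    (∀ n m : ℕ, n = 1 ∨ n = 2 → ∀ φ : Fields n,
      constraintOp n ((m : ℝ) / 2) φ = 0 → laplaceOp n ((m : ℝ) / 2) φ = 0) ∧
    -- as `r → 0` with `μ = r k` fixed, the rescaled constraint operator tends, in the coordinates
    -- `x ↦ e^{i r x_a t_a}`, to the flat Dirac-type operator of mass `μ`
    (∀ (n : ℕ) (μ : ℝ) (r k : ℕ → ℝ), (∀ j, 0 < r j) → Tendsto r atTop (𝓝 0) →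
      (∀ j, r j * k j = μ) →
      ∀ (φ : ℕ → Fields n) (f : E3 → Fin (n + 1) → ℂ), Differentiable ℝ f →
      (∀ x, Tendsto (fun j => pullback (r j) (φ j) x) atTop (𝓝 (f x))) →
      (∀ x, Tendsto (fun j => fderiv ℝ (pullback (r j) (φ j)) x) atTop (𝓝 (fderiv ℝ f x))) →
      (∀ x, Tendsto (fun j => ((r j : ℝ) : ℂ) • pullback (r j) (constraintOp n (k j) (φ j)) x)
        atTop (𝓝 (flatOp n μ f x))) ∧
      ((∀ j, constraintOp n (k j) (φ j) = 0) → ∀ x, flatOp n μ f x = 0)) := by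
  refine ⟨fun n => ⟨JL_commutator n, JR_commutator n, JL_JR_commute n, casimir_eq n⟩,
    ⟨spinRep, spinRep_su2Exp, fun n m => ⟨isIrrep_solutions n m, finrank_solutions n m,
      solRep n m, solRep_apply n m, isIrreducible_solRep n m, solEquiv n m,
      fun a v => emb_JL n m a v, fun a v => emb_JR n m a v,
      fun g h v => (solRep_solEquiv n m (g, h) v).symm⟩⟩, ?_, ?_⟩
  · rintro n m (rfl | rfl) φ h
    · exact laplace_of_constraint_one h
    · exact laplace_of_constraint_two (by positivity) h
  · intro n μ r k _ hr hk φ f _ h0 h1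
    have h (x : E3) := tendsto_constraintOp n μ r k hr hk φ f x (h0 x) (h1 x)
    exact ⟨h, fun hc x => flatOp_eq_zero n μ r k φ f x (h x) hc⟩
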